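/- Let $k\ge 1$, let $\mathbf s=(\mathbf y,\mathbf X)\in\mathbb R^k\times\mathbb R^{k\times q}$ have distribution $P$, and let $\mathbf V(\boldsymbol\theta)=\sum_{j=1}^l\theta_j\mathbf L_j$, $\boldsymbol\theta\in\mathbb R^l$, where $\mathbf L_1,\dots,\mathbf L_l$ are symmetric $k\times k$ matrices such that the $k^2\times l$ matrix $\mathbf L=[\mathrm{vec}(\mathbf L_1)\ \cdots\ \mathrm{vec}(\mathbf L_l)]$ has rank $l$. Let $\rho:\mathbb R\to\mathbb R$ be even and twice continuously differentiable with $\rho(0)=0$, strictly increasing on $[0,c_0]$ and constant on $[c_0,\infty)$ for some $c_0>0$; let $0<b_0<\rho(c_0)$ and $u(s)=\rho'(s)/s$. For a probability measure $Q$ on $\mathbb R^k\times\mathbb R^{k\times q}$, an S-solution at $Q$ is a pair $(\boldsymbol\beta,\boldsymbol\theta)\in\mathbb R^q\times\mathbb R^l$ that minimizes $\det\mathbf V(\boldsymbol\theta)$ over all pairs for which $\mathbf V(\boldsymbol\theta)$ is positive definite and $$\int\rho\Big(\sqrt{(\mathbf y-\mathbf X\boldsymbol\beta)^T\mathbf V(\boldsymbol\theta)^{-1}(\mathbf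 y-\mathbf X\boldsymbol\beta)}\Big)\,dQ(\mathbf y,\mathbf X)\le b_0 .$$ Let $\boldsymbol\xi(\cdot)=(\boldsymbol\beta(\cdot),\boldsymbol\theta(\cdot))$ be an $\mathbb R^q\times\mathbb R^l$-valued functional on measures such that $\boldsymbol\xi(P)$ is an S-solution at $P$, and write $\boldsymbol\beta=\boldsymbol\beta(P)$ and $\boldsymbol\Sigma=\mathbf V(\boldsymbol\theta(P))$. Suppose that, under $P$, $\mathbf y\mid\mathbf X$ has the elliptically contoured density $f_{\mathbf X\boldsymbol\beta,\boldsymbol\Sigma}$, where $$f_{\boldsymbol\mu,\boldsymbol\Sigma}(\mathbf y)=\det(\boldsymbol\Sigma)^{-1/2}\,g\big((\mathbf y-\boldsymbol\mu)^T\boldsymbol\Sigma^{-1}(\mathbf y-\boldsymbol\mu)\big),\qquad g:[0,\infty)\to[0,\infty)\text{ measurable},$$ that $E\|\mathbf X\|^2<\infty$, and that $\mathbf X$ has rank $q$ with probability one. Let $\mathbb E_{0,I}$ denote expectation for $\mathbf z$ with density $f_{\mathbf 0,\mathbf I_k}$, and put $$\alpha=\mathbb E_{0,I}\Big[\Big(1-\frac1k\Big)\frac{\rho'(\|\mathbf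 z\|)}{\|\mathbf z\|}+\frac1k\rho''(\|\mathbf z\|)\Big],\qquad \gamma_1=\frac{\mathbb E_{0,I}\big[\rho''(\|\mathbf z\|)\|\mathbf z\|^2+(k+1)\rho'(\|\mathbf z\|)\|\mathbf z\|\big]}{k+2},$$ $$\gamma_2=\frac{\mathbb E_{0,I}\big[2\rho''(\|\mathbf z\|)\|\mathbf z\|^2+k\rho'(\|\mathbf z\|)\|\mathbf z\|\big]}{2k(k+2)} .$$ Assume $\mathbb E_{0,I}[\rho''(\|\mathbf z\|)]>0$ and $\gamma_1>0$. Fix $\mathbf s_0=(\mathbf y_0,\mathbf X_0)\in\mathbb R^k\times\mathbb R^{k\times q}$, let $\mathbf r=\mathbf y_0-\mathbf X_0\boldsymbol\beta$, $d_0=\sqrt{\mathbf r^T\boldsymbol\Sigma^{-1}\mathbf r}$ (if $d_0=0$ then $\mathbf r=\mathbf 0$ and the terms with $u(d_0)$ are zero), and $P_h=(1-h)P+h\delta_{\mathbf s_0}$. For a functional $T$, let $\mathrm{IF}(\mathbf s_0;T,P)=\lim_{h\downarrow0}(T(P_h)-T(P))/h$. Then the following hold. (a) $\alpha>0$, $\gamma_1-k\gamma_2>0$,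 and the matrices $E[\mathbf X^T\boldsymbol\Sigma^{-1}\mathbf X]$ and $\mathbf L^T(\boldsymbol\Sigma^{-1}\otimes\boldsymbol\Sigma^{-1})\mathbf L$ are invertible. (b) If $\boldsymbol\xi(P_h)$ is an S-solution at $P_h$ for all sufficiently small $h>0$, and $\boldsymbol\xi(P_h)\to\boldsymbol\xi(P)$ as $h\downarrow0$, then the influence functions of $\boldsymbol\beta(\cdot)$ and $\boldsymbol\theta(\cdot)$ at $\mathbf s_0$ exist and are $$\mathrm{IF}(\mathbf s_0;\boldsymbol\beta,P)=\frac{u(d_0)}{\alpha}\big(E[\mathbf X^T\boldsymbol\Sigma^{-1}\mathbf X]\big)^{-1}\mathbf X_0^T\boldsymbol\Sigma^{-1}(\mathbf y_0-\mathbf X_0\boldsymbol\beta),$$ $$\mathrm{IF}(\mathbf s_0;\boldsymbol\theta,P)=\frac{k\,u(d_0)}{\gamma_1}\big(\mathbf L^T(\boldsymbol\Sigma^{-1}\otimes\boldsymbol\Sigma^{-1})\mathbf L\big)^{-1}\mathbf L^T\mathrm{vec}\big(\boldsymbol\Sigma^{-1}\mathbf r\mathbf r^T\boldsymbol\Sigma^{-1}\big)+\Big(-\frac{u(d_0)d_0^2}{\gamma_1}+\frac{\rho(d_0)-b_0}{\gamma_1-k\gamma_2}\Big)\boldsymbol\theta(P).$$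 (c) If $\boldsymbol\xi(P)$ is the only S-solution at $P$, then the conditions in (b) are not restrictive: for all sufficiently small $h>0$ an S-solution at $P_h$ exists, and if $\boldsymbol\xi(P_h)$ is an S-solution at $P_h$ for all sufficiently small $h>0$, then $\boldsymbol\xi(P_h)\to\boldsymbol\xi(P)$ as $h\downarrow0$. -/

import Mathlib

open MeasureTheory Filter Topology Matrix
open scoped Kronecker

noncomputable section

namespace SEst

/-- The observation space: pairs `s = (y, X)` of a response vector and a design matrix. -/
abbrev Obs (k q : ℕ) : Type := (Fin k → ℝ) × Matrix (Fin k) (Fin q) ℝ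

/-- Matrices carry the product (Borel) σ-algebra of their entries. -/
instance matrixMeasurableSpace (k q : ℕ) : MeasurableSpace (Matrix (Fin k) (Fin q) ℝ) :=
  inferInstanceAs (MeasurableSpace (Fin k → Fin q → ℝ))

/-- The parameter space: pairs `ξ = (β, θ)`. -/
abbrev Param (q l : ℕ) : Type := (Fin q → ℝ) × (Fin l → ℝ)

/-- The conditions on the loss function: `ρ` is even, vanishes at zero, is twice continuously
differentiable, strictly increasing on `[0, c₀]` and constant on `[c₀, ∞)`. -/
structure IsRho (ρ : ℝ → ℝ) (c₀ : ℝ) : Prop where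
  pos : 0 < c₀
  even : ∀ s, ρ (-s) = ρ s
  zero : ρ 0 = 0
  smooth : ContDiff ℝ 2 ρ
  strictMono : StrictMonoOn ρ (Set.Icc 0 c₀)
  const : ∀ s, c₀ ≤ s → ρ s = ρ c₀

/-- The weight function `u(s) = ρ'(s) / s`. -/
def weight (ρ : ℝ → ℝ) (s : ℝ) : ℝ := deriv ρ s / s

/-- The linear covariance structure `V(θ) = ∑ⱼ θⱼ Lⱼ`. -/
def linCov {k l : ℕ} (L : Fin l → Matrix (Fin k) (Fin k) ℝ) (θ : Fin l → ℝ) :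
    Matrix (Fin k) (Fin k) ℝ :=
  ∑ j, θ j • L j

/-- The `k² × l` matrix whose columns are `vec L₁, …, vec L_l`. -/
def vecMat {k l : ℕ} (L : Fin l → Matrix (Fin k) (Fin k) ℝ) :
    Matrix (Fin k × Fin k) (Fin l) ℝ :=
  Matrix.of fun p j => (L j).vec p

/-- The residual `y - X β`. -/
def resid {k q : ℕ} (s : Obs k q) (β : Fin q → ℝ) : Fin k → ℝ := s.1 - s.2 *ᵥ β

/-- The Mahalanobis distance, `d² = (y - X β)ᵀ S⁻¹ (y - X β)`. -/
def mahal {k q : ℕ} (S : Matrix (Fin k) (Fin k) ℝ) (β : Fin q → ℝ) (s : Obs k q) : ℝ :=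
  Real.sqrt (resid s β ⬝ᵥ (S⁻¹ *ᵥ resid s β))

/-- `ξ = (β, θ)` is feasible at `P`: the matrix `V(θ)` is symmetric and positive definite and
`∫ ρ(d(s, ξ)) dP(s) ≤ b₀`. -/
def IsFeasible {k q l : ℕ} (ρ : ℝ → ℝ) (b₀ : ℝ) (L : Fin l → Matrix (Fin k) (Fin k) ℝ)
    (P : Measure (Obs k q)) (ξ : Param q l) : Prop :=
  (linCov L ξ.2).PosDef ∧ ∫ s, ρ (mahal (linCov L ξ.2) ξ.1 s) ∂P ≤ b₀

/-- `ξ` solves the S-minimization problem at `P`: it minimizes `det V(θ)` over all feasible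
parameters. -/
def IsSSolution {k q l : ℕ} (ρ : ℝ → ℝ) (b₀ : ℝ) (L : Fin l → Matrix (Fin k) (Fin k) ℝ)
    (P : Measure (Obs k q)) (ξ : Param q l) : Prop :=
  IsFeasible ρ b₀ L P ξ ∧
    ∀ ξ' : Param q l, IsFeasible ρ b₀ L P ξ' → (linCov L ξ.2).det ≤ (linCov L ξ'.2).det

/-- The contaminated measure `(1 - h) P + h δ_{s₀}`, for `0 ≤ h ≤ 1`. -/
def contam {k q : ℕ} (P : Measure (Obs k q)) (s₀ : Obs k q) (h : ℝ) : Measure (Obs k q) :=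
  ENNReal.ofReal (1 - h) • P + ENNReal.ofReal h • Measure.dirac s₀

/-- The influence function at `s₀` of the functional `T` at `P` exists and equals `v`:
`(T((1 - h) P + h δ_{s₀}) - T(P)) / h → v` as `h ↓ 0`. -/
def HasInfluence {k q n : ℕ} (T : Measure (Obs k q) → (Fin n → ℝ)) (P : Measure (Obs k q))
    (s₀ : Obs k q) (v : Fin n → ℝ) : Prop :=
  Tendsto (fun h : ℝ => h⁻¹ • (T (contam P s₀ h) - T P)) (𝓝[>] 0) (𝓝 v)

/-- The elliptically contoured density
`f_{μ,S}(y) = det(S)^{-1/2} g((y - μ)ᵀ S⁻¹ (y - μ))` with generator `g`. -/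
def ellDensity {k : ℕ} (g : ℝ → ℝ) (μ : Fin k → ℝ) (S : Matrix (Fin k) (Fin k) ℝ)
    (y : Fin k → ℝ) : ℝ :=
  (Real.sqrt S.det)⁻¹ * g ((y - μ) ⬝ᵥ (S⁻¹ *ᵥ (y - μ)))

/-- Under `P`, conditionally on `X`, the vector `y` has the elliptically contoured density
`f_{Xβ,S}`; that is, `P(dy, dX) = f_{Xβ,S}(y) dy P_X(dX)`, where `P_X` is the law of `X`. -/
def IsEllipticalGivenX {k q : ℕ} (g : ℝ → ℝ) (β : Fin q → ℝ) (S : Matrix (Fin k) (Fin k) ℝ)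
    (P : Measure (Obs k q)) : Prop :=
  P = ((volume : Measure (Fin k → ℝ)).prod (P.map Prod.snd)).withDensity
    (fun s => ENNReal.ofReal (ellDensity g (s.2 *ᵥ β) S s.1))

/-- The expectation of `φ(‖z‖)`, with `‖z‖` the Euclidean norm, where `z` has the spherical
density `f_{0,I_k}(z) = g(zᵀz)`. -/
def sphE (k : ℕ) (g : ℝ → ℝ) (φ : ℝ → ℝ) : ℝ :=
  ∫ z : Fin k → ℝ, φ (Real.sqrt (z ⬝ᵥ z)) * ellDensity g 0 (1 : Matrix (Fin k) (Fin k) ℝ) z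

/-- `α = E[(1 - 1/k) ρ'(‖z‖)/‖z‖ + (1/k) ρ''(‖z‖)]`. -/
def alphaC (k : ℕ) (g ρ : ℝ → ℝ) : ℝ :=
  sphE k g fun s => (1 - 1 / (k : ℝ)) * (deriv ρ s / s) + 1 / (k : ℝ) * deriv (deriv ρ) s

/-- `γ₁ = E[ρ''(‖z‖)‖z‖² + (k+1) ρ'(‖z‖)‖z‖] / (k+2)`. -/
def gammaOne (k : ℕ) (g ρ : ℝ → ℝ) : ℝ :=
  sphE k g (fun s => deriv (deriv ρ) s * s ^ 2 + ((k : ℝ) + 1) * (deriv ρ s * s)) / ((k : ℝ) + 2)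

/-- `γ₂ = E[2 ρ''(‖z‖)‖z‖² + k ρ'(‖z‖)‖z‖] / (2k(k+2))`. -/
def gammaTwo (k : ℕ) (g ρ : ℝ → ℝ) : ℝ :=
  sphE k g (fun s => 2 * (deriv (deriv ρ) s * s ^ 2) + (k : ℝ) * (deriv ρ s * s))
    / (2 * (k : ℝ) * ((k : ℝ) + 2))

/-- The `q × q` matrix `E[Xᵀ S⁻¹ X]`. -/
def designInfo {k q : ℕ} (S : Matrix (Fin k) (Fin k) ℝ) (P : Measure (Obs k q)) :
    Matrix (Fin q) (Fin q) ℝ :=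
  Matrix.of fun i j => ∫ s, (s.2ᵀ * S⁻¹ * s.2) i j ∂P

/-- The `l × l` matrix `𝐋ᵀ (S⁻¹ ⊗ S⁻¹) 𝐋`. -/
def covInfo {k l : ℕ} (L : Fin l → Matrix (Fin k) (Fin k) ℝ) (S : Matrix (Fin k) (Fin k) ℝ) :
    Matrix (Fin l) (Fin l) ℝ :=
  (vecMat L)ᵀ * (S⁻¹ ⊗ₖ S⁻¹) * vecMat L

end SEst

end

/-! An S-solution solves a constrained minimization problem, so it satisfies Lagrange conditions.
Let `J` be the mean loss and `T v = tr(V⁻¹ V(v))` the derivative of `log det V` in the direction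
`v`. No direction can lower both to first order, so the linear forms `DJ` and `T` are proportional.
Pairing with the scale direction `(0, θ)`, where `T = k` and `τ = d²` has derivative `-τ`,
eliminates the multiplier. Since the constraint is active, any multiple `c` of `(ρ(d) - b₀) T(v)`
may be added. This yields the family `score`, whose mean vanishes at every S-solution
(`IsSSolution.integral_score_eq_zero`).

At `P_h` the equation reads `(1 - h) Ψ(ξ) + h ψ(ξ, s₀) = 0`, where `Ψ` is the mean score under `P`.
Hence `h⁻¹ Ψ(ξ(P_h))` tends to `-ψ(ξ(P), s₀)`. If `Ψ` has an injective derivative `D` at its zero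
`ξ(P)`, convergence of `ξ(P_h)` forces the difference quotients to converge to the solution `w` of
`D w = -ψ(ξ(P), s₀)` (`tendsto_smul_sub_of_hasFDerivAt`). Differentiability under the integral uses
that `ρ'` vanishes beyond `c₀`, which bounds the relevant residuals, that the singularity at `d = 0`
cancels, and that `E‖X‖²` is finite (`exists_score_bound`).

To compute `D`, write `Σ⁻¹ = NᵀN`; the standardized residual `N r` is spherical and independent of
`X` (`map_standardized`). Odd terms integrate to zero, which decouples `β` from `θ`; second and
fourth spherical moments follow from invariance under reflections. One unwanted term, proportional
to `tr K tr K'`, remains, and `c = γ₁ / E[ρ'(‖z‖)‖z‖]` removes it. Then `D` is block diagonal with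
blocks `-kα E[XᵀΣ⁻¹X]` and `-(γ₁/2) 𝐋ᵀ(Σ⁻¹ ⊗ Σ⁻¹)𝐋` (`integral_dscore`), and inverting it gives the
influence functions (`hasInfluence`).

Part (c) is a compactness argument. A mean loss below `ρ(c₀)` gives `d < c₀` a probability bounded
away from zero, while residuals avoid thin slabs uniformly in direction and in `β`. So the
eigenvalues of `V` are bounded below; a bounded determinant then bounds `V`, and full rank of `X`
bounds `β` (`exists_isCompact_posDef`). Inflating the covariance makes the constraint slack, which
supplies competitors that remain feasible at `P_h`; every cluster point of S-solutions at `P_h` is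
therefore an S-solution at `P` (`exists_and_tendsto_of_unique`). -/

noncomputable section

namespace SEst

/-! ### The loss function, its derivatives and its weight function -/

namespace IsRho

variable {ρ : ℝ → ℝ} {c₀ : ℝ}

lemma differentiable (h : IsRho ρ c₀) : Differentiable ℝ ρ :=
  h.smooth.differentiable (by norm_num)

lemma contDiff_deriv (h : IsRho ρ c₀) : ContDiff ℝ 1 (deriv ρ) :=
  (contDiff_succ_iff_deriv.1 (show ContDiff ℝ (1 + 1) ρ from h.smooth)).2.2

lemma differentiable_deriv (h : IsRho ρ c₀) : Differentiable ℝ (deriv ρ) :=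
  h.contDiff_deriv.differentiable (by norm_num)

lemma continuous_deriv (h : IsRho ρ c₀) : Continuous (deriv ρ) := h.differentiable_deriv.continuous

lemma continuous_deriv_deriv (h : IsRho ρ c₀) : Continuous (deriv (deriv ρ)) :=
  h.contDiff_deriv.continuous_deriv le_rfl

lemma continuous (h : IsRho ρ c₀) : Continuous ρ := h.differentiable.continuous

lemma monotoneOn (h : IsRho ρ c₀) : MonotoneOn ρ (Set.Ici 0) := by
  intro a ha b hb hab
  rcases le_total b c₀ with hbc | hbc
  · exact h.strictMono.monotoneOn ⟨ha, hab.trans hbc⟩ ⟨hb, hbc⟩ hab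
  · rw [h.const b hbc]
    rcases le_total a c₀ with hac | hac
    · exact h.strictMono.monotoneOn ⟨ha, hac⟩ ⟨h.pos.le, le_rfl⟩ hac
    · rw [h.const a hac]

lemma nonneg (h : IsRho ρ c₀) {s : ℝ} (hs : 0 ≤ s) : 0 ≤ ρ s := by
  rw [← h.zero]; exact h.monotoneOn (Set.mem_Ici.2 le_rfl) hs hs

lemma le_top (h : IsRho ρ c₀) {s : ℝ} (hs : 0 ≤ s) : ρ s ≤ ρ c₀ := by
  rw [← h.const (max s c₀) (le_max_right _ _)]
  exact h.monotoneOn hs (hs.trans (le_max_left _ _)) (le_max_left _ _)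

lemma deriv_zero (h : IsRho ρ c₀) : deriv ρ 0 = 0 := by
  have h1 := deriv_comp_neg (f := ρ) (0 : ℝ)
  simp only [h.even, neg_zero] at h1
  linarith

lemma deriv_nonneg (h : IsRho ρ c₀) {s : ℝ} (hs : 0 ≤ s) : 0 ≤ deriv ρ s := by
  rcases hs.eq_or_lt with rfl | hs
  · exact h.deriv_zero.ge
  · have h1 : 0 ≤ derivWithin ρ (Set.Ici 0) s := h.monotoneOn.derivWithin_nonneg
    rwa [derivWithin_of_mem_nhds (Ici_mem_nhds hs)] at h1

/-- Beyond `c₀` the loss is locally constant; the endpoint itself is reached by continuity of `ρ'`.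
-/
lemma deriv_eq_zero (h : IsRho ρ c₀) {s : ℝ} (hs : c₀ ≤ s) : deriv ρ s = 0 := by
  have hcl : IsClosed {s | deriv ρ s = 0} := isClosed_eq h.continuous_deriv continuous_const
  have hsub : Set.Ioi c₀ ⊆ {s | deriv ρ s = 0} := fun s (hs : c₀ < s) => by
    have : ρ =ᶠ[𝓝 s] fun _ => ρ c₀ := by
      filter_upwards [Ioi_mem_nhds hs] with t ht using h.const t (le_of_lt ht)
    simpa using this.deriv_eq
  exact hcl.closure_subset_iff.2 hsub (by rw [closure_Ioi]; exact hs)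

lemma deriv_deriv_eq_zero (h : IsRho ρ c₀) {s : ℝ} (hs : c₀ ≤ s) : deriv (deriv ρ) s = 0 := by
  have hcl : IsClosed {s | deriv (deriv ρ) s = 0} :=
    isClosed_eq h.continuous_deriv_deriv continuous_const
  have hsub : Set.Ioi c₀ ⊆ {s | deriv (deriv ρ) s = 0} := fun s (hs : c₀ < s) => by
    have : deriv ρ =ᶠ[𝓝 s] fun _ => 0 := by
      filter_upwards [Ioi_mem_nhds hs] with t ht using h.deriv_eq_zero (le_of_lt ht)
    simpa using this.deriv_eq
  exact hcl.closure_subset_iff.2 hsub (by rw [closure_Ioi]; exact hs)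

/-- A zero of `ρ'` on the positive half line is an interior minimum of `ρ'`. -/
lemma deriv_deriv_eq_zero_of_deriv (h : IsRho ρ c₀) {s : ℝ} (hs : 0 < s) (h0 : deriv ρ s = 0) :
    deriv (deriv ρ) s = 0 := by
  refine IsLocalMin.deriv_eq_zero (f := deriv ρ) ?_
  filter_upwards [Ioi_mem_nhds hs] with t ht
  rw [h0]
  exact h.deriv_nonneg (le_of_lt ht)

lemma rho_pos (h : IsRho ρ c₀) : 0 < ρ c₀ := by
  rw [← h.zero]
  exact h.strictMono ⟨le_rfl, h.pos.le⟩ ⟨h.pos.le, le_rfl⟩ h.pos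

end IsRho

/-- The continuous extension of the weight function `u` to the origin. -/
def weightExt (ρ : ℝ → ℝ) : ℝ → ℝ := dslope (deriv ρ) 0

namespace IsRho

variable {ρ : ℝ → ℝ} {c₀ : ℝ}

lemma weightExt_of_ne (h : IsRho ρ c₀) {s : ℝ} (hs : s ≠ 0) : weightExt ρ s = deriv ρ s / s := by
  rw [weightExt, dslope_of_ne _ hs, slope_def_field, h.deriv_zero]; simp

lemma weightExt_zero (_ : IsRho ρ c₀) : weightExt ρ 0 = deriv (deriv ρ) 0 := dslope_same _ _

lemma weightExt_mul (h : IsRho ρ c₀) (s : ℝ) : weightExt ρ s * s = deriv ρ s := by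
  rcases eq_or_ne s 0 with rfl | hs
  · simp [h.deriv_zero]
  · rw [h.weightExt_of_ne hs]; field_simp

lemma continuous_weightExt (h : IsRho ρ c₀) : Continuous (weightExt ρ) := by
  rw [continuous_iff_continuousAt]
  intro s
  rcases eq_or_ne s 0 with rfl | hs
  · exact continuousAt_dslope_same.2 (h.differentiable_deriv 0)
  · exact (continuousAt_dslope_of_ne hs).2 h.continuous_deriv.continuousAt

lemma weightExt_eq_zero (h : IsRho ρ c₀) {s : ℝ} (hs : c₀ ≤ s) : weightExt ρ s = 0 := by
  rw [h.weightExt_of_ne (h.pos.trans_le hs).ne', h.deriv_eq_zero hs, zero_div]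

lemma weightExt_nonneg (h : IsRho ρ c₀) {s : ℝ} (hs : 0 < s) : 0 ≤ weightExt ρ s := by
  rw [h.weightExt_of_ne hs.ne']
  exact div_nonneg (h.deriv_nonneg hs.le) hs.le

/-- A continuous function vanishing on `[c₀, ∞)` is bounded on `[0, ∞)`. -/
lemma exists_bound (h : IsRho ρ c₀) {f : ℝ → ℝ} (hf : Continuous f) (h0 : ∀ s, c₀ ≤ s → f s = 0) :
    ∃ C, 0 ≤ C ∧ ∀ s, 0 ≤ s → |f s| ≤ C := by
  obtain ⟨C, hC⟩ := (isCompact_Icc (a := (0 : ℝ)) (b := c₀)).exists_bound_of_continuousOn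
    hf.continuousOn
  refine ⟨C, (norm_nonneg _).trans (hC 0 ⟨le_rfl, h.pos.le⟩), fun s hs => ?_⟩
  rcases le_total s c₀ with hs' | hs'
  · exact hC s ⟨hs, hs'⟩
  · rw [h0 s hs', abs_zero]
    exact (norm_nonneg _).trans (hC 0 ⟨le_rfl, h.pos.le⟩)

/-- The squared distance is smooth in the parameter while the distance is not, so the loss is
differentiated as a function of `t = d²`. -/
lemma hasDerivAt_comp_sqrt (h : IsRho ρ c₀) {t : ℝ} (ht : 0 < t) :
    HasDerivAt (fun t => ρ (√t)) (weightExt ρ (√t) / 2) t := by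
  have h1 := (h.differentiable (√t)).hasDerivAt.comp t (Real.hasDerivAt_sqrt ht.ne')
  refine h1.congr_deriv ?_
  have := Real.sqrt_pos.2 ht
  rw [h.weightExt_of_ne this.ne']
  field_simp

lemma hasDerivWithinAt_comp_sqrt (h : IsRho ρ c₀) {t : ℝ} (ht : 0 ≤ t) :
    HasDerivWithinAt (fun t => ρ (√t)) (weightExt ρ (√t) / 2) (Set.Ici 0) t := by
  rcases ht.eq_or_lt with rfl | ht
  -- The square root is not differentiable at the origin. The one-sided derivative is the limit of
  -- the derivatives at positive `t`, which exists because `weightExt ρ` is continuous.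
  · refine hasDerivWithinAt_Ici_of_tendsto_deriv (s := Set.Ioi 0)
      (fun x hx => (h.hasDerivAt_comp_sqrt hx).differentiableAt.differentiableWithinAt)
      (h.continuous.comp Real.continuous_sqrt).continuousWithinAt self_mem_nhdsWithin ?_
    have h1 : Tendsto (fun t => weightExt ρ (√t) / 2) (𝓝[>] 0) (𝓝 (weightExt ρ (√0) / 2)) :=
      (((h.continuous_weightExt.comp Real.continuous_sqrt).div_const 2).tendsto 0).mono_left
        nhdsWithin_le_nhds
    refine h1.congr' ?_
    filter_upwards [self_mem_nhdsWithin] with t ht using (h.hasDerivAt_comp_sqrt ht).deriv.symm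
  · exact (h.hasDerivAt_comp_sqrt ht).hasDerivWithinAt

/-- The factor `1 / t` may be unbounded near the origin; in the score it is compensated by two
factors that each vanish with the residual. -/
lemma hasDerivAt_weightExt_comp_sqrt (h : IsRho ρ c₀) {t : ℝ} (ht : 0 < t) :
    HasDerivAt (fun t => weightExt ρ (√t))
      ((deriv (deriv ρ) (√t) - weightExt ρ (√t)) / (2 * t)) t := by
  have hs := Real.sqrt_pos.2 ht
  have h1 : HasDerivAt (fun s => deriv ρ s / s)
      ((deriv (deriv ρ) (√t) * √t - deriv ρ (√t) * 1) / (√t) ^ 2) (√t) :=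
    (h.differentiable_deriv (√t)).hasDerivAt.div (hasDerivAt_id _) hs.ne'
  have h2 := h1.comp t (Real.hasDerivAt_sqrt ht.ne')
  have h3 : (fun t => weightExt ρ (√t)) =ᶠ[𝓝 t] (fun s => deriv ρ s / s) ∘ fun t => √t := by
    filter_upwards [Ioi_mem_nhds ht] with u hu
    exact h.weightExt_of_ne (Real.sqrt_pos.2 hu).ne'
  refine (h2.congr_of_eventuallyEq h3).congr_deriv ?_
  rw [h.weightExt_of_ne hs.ne']
  have h4 : √t ^ 2 = t := Real.sq_sqrt ht.le
  have h5 : t = √t * √t := (Real.mul_self_sqrt ht.le).symm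
  set w := √t
  rw [h5]
  field_simp

end IsRho

/-! ### Calculus of Fréchet derivatives given by explicit formulas -/

/-- `f` is Fréchet differentiable at `x`, with derivative given by the function `D`. -/
def HasFD {E F : Type*} [NormedAddCommGroup E] [NormedSpace ℝ E] [NormedAddCommGroup F]
    [NormedSpace ℝ F] (f : E → F) (D : E → F) (x : E) : Prop :=
  ∃ f' : E →L[ℝ] F, HasFDerivAt f f' x ∧ ∀ v, f' v = D v

namespace HasFD

variable {E F G : Type*} [NormedAddCommGroup E] [NormedSpace ℝ E] [NormedAddCommGroup F]
    [NormedSpace ℝ F] [NormedAddCommGroup G] [NormedSpace ℝ G] {x : E}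

lemma congr_deriv {f : E → F} {D D' : E → F} (h : HasFD f D x) (hD : ∀ v, D v = D' v) :
    HasFD f D' x := by
  obtain ⟨f', h1, h2⟩ := h
  exact ⟨f', h1, fun v => (h2 v).trans (hD v)⟩

lemma continuousAt {f : E → F} {D : E → F} (h : HasFD f D x) : ContinuousAt f x := by
  obtain ⟨f', h1, -⟩ := h
  exact h1.continuousAt

lemma const (c : F) : HasFD (fun _ : E => c) (fun _ => 0) x :=
  ⟨0, hasFDerivAt_const c x, fun _ => rfl⟩

lemma clm (A : E →L[ℝ] F) : HasFD (fun y => A y) (fun v => A v) x :=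
  ⟨A, A.hasFDerivAt, fun _ => rfl⟩

lemma add {f g : E → F} {Df Dg : E → F} (hf : HasFD f Df x) (hg : HasFD g Dg x) :
    HasFD (fun y => f y + g y) (fun v => Df v + Dg v) x := by
  obtain ⟨f', h1, h2⟩ := hf
  obtain ⟨g', h3, h4⟩ := hg
  exact ⟨f' + g', h1.add h3, fun v => by simp [h2, h4]⟩

lemma sub {f g : E → F} {Df Dg : E → F} (hf : HasFD f Df x) (hg : HasFD g Dg x) :
    HasFD (fun y => f y - g y) (fun v => Df v - Dg v) x := by
  obtain ⟨f', h1, h2⟩ := hf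
  obtain ⟨g', h3, h4⟩ := hg
  exact ⟨f' - g', h1.sub h3, fun v => by simp [h2, h4]⟩

lemma const_mul {f : E → ℝ} {Df : E → ℝ} (hf : HasFD f Df x) (c : ℝ) :
    HasFD (fun y => c * f y) (fun v => c * Df v) x := by
  obtain ⟨f', h1, h2⟩ := hf
  exact ⟨c • f', h1.const_mul c, fun v => by simp [h2]⟩

lemma mul {f g : E → ℝ} {Df Dg : E → ℝ} (hf : HasFD f Df x) (hg : HasFD g Dg x) :
    HasFD (fun y => f y * g y) (fun v => f x * Dg v + Df v * g x) x := by
  obtain ⟨f', h1, h2⟩ := hf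
  obtain ⟨g', h3, h4⟩ := hg
  exact ⟨_, h1.mul h3, fun v => by simp [h2, h4, mul_comm]⟩

lemma sum {ι : Type*} (s : Finset ι) {f : ι → E → F} {D : ι → E → F}
    (hf : ∀ i ∈ s, HasFD (f i) (D i) x) :
    HasFD (fun y => ∑ i ∈ s, f i y) (fun v => ∑ i ∈ s, D i v) x := by
  classical
  induction s using Finset.induction_on with
  | empty => simpa using const (0 : F)
  | insert a s ha ih =>
    simp only [Finset.sum_insert ha]
    exact (hf a (by simp)).add (ih fun i hi => hf i (by simp [hi]))

lemma pi {ι : Type*} [Fintype ι] {f : E → ι → ℝ} {D : E → ι → ℝ}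
    (hf : ∀ i, HasFD (fun y => f y i) (fun v => D v i) x) : HasFD f D x := by
  choose f' h1 h2 using hf
  exact ⟨ContinuousLinearMap.pi f', hasFDerivAt_pi.2 h1, fun v => by ext i; simp [h2]⟩

lemma apply {ι : Type*} [Fintype ι] {f : E → ι → ℝ} {D : E → ι → ℝ} (hf : HasFD f D x) (i : ι) :
    HasFD (fun y => f y i) (fun v => D v i) x := by
  obtain ⟨f', h1, h2⟩ := hf
  exact ⟨(ContinuousLinearMap.proj i).comp f', hasFDerivAt_pi'.1 h1 i, fun v => by simp [h2]⟩

lemma dotProduct {ι : Type*} [Fintype ι] {f g : E → ι → ℝ} {Df Dg : E → ι → ℝ}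
    (hf : HasFD f Df x) (hg : HasFD g Dg x) :
    HasFD (fun y => f y ⬝ᵥ g y) (fun v => f x ⬝ᵥ Dg v + Df v ⬝ᵥ g x) x := by
  have := sum (x := x) Finset.univ fun i _ => (hf.apply i).mul (hg.apply i)
  refine this.congr_deriv fun v => ?_
  simp [_root_.dotProduct, Finset.sum_add_distrib]

lemma mulVec {ι κ : Type*} [Fintype ι] [Fintype κ] (A : Matrix ι κ ℝ) {f : E → κ → ℝ}
    {Df : E → κ → ℝ} (hf : HasFD f Df x) :
    HasFD (fun y => A *ᵥ f y) (fun v => A *ᵥ Df v) x := by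
  refine pi fun i => ?_
  refine ((const (x := x) (A i)).dotProduct hf).congr_deriv fun v => ?_
  simp [Matrix.mulVec]

/-- Because `τ` is nonnegative near `x`, the one-sided derivative of `ρ ∘ √` suffices, even where `τ
x = 0`. -/
lemma comp_sqrt {ρ : ℝ → ℝ} {c₀ : ℝ} (h : IsRho ρ c₀) {τ : E → ℝ} {D : E → ℝ}
    (hτ : HasFD τ D x) (h0 : ∀ᶠ y in 𝓝 x, 0 ≤ τ y) :
    HasFD (fun y => ρ (√(τ y))) (fun v => weightExt ρ (√(τ x)) / 2 * D v) x := by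
  obtain ⟨f', h1, h2⟩ := hτ
  have h3 := (h.hasDerivWithinAt_comp_sqrt h0.self_of_nhds).comp_hasFDerivWithinAt
    (s := {y | 0 ≤ τ y}) x h1.hasFDerivWithinAt (fun y hy => hy)
  exact ⟨_, h3.hasFDerivAt h0, fun v => by simp [h2]⟩

/-- Where `τ x = 0` the weight need not be differentiable, but it is continuous and `p` vanishes
there, so the product has derivative weight times `Dp`. The second summand of the formula is then
zero as well, since `p x = 0`. -/
lemma weight_mul {ρ : ℝ → ℝ} {c₀ : ℝ} (h : IsRho ρ c₀) {τ p : E → ℝ} {Dτ Dp : E → ℝ}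
    (hτ : HasFD τ Dτ x) (hp : HasFD p Dp x) (h0 : 0 ≤ τ x) (hp0 : τ x = 0 → p x = 0) :
    HasFD (fun y => weightExt ρ (√(τ y)) * p y)
      (fun v => weightExt ρ (√(τ x)) * Dp v +
        (deriv (deriv ρ) (√(τ x)) - weightExt ρ (√(τ x))) / (2 * τ x) * p x * Dτ v) x := by
  rcases h0.eq_or_lt with h0 | h0
  · have hp1 := hp0 h0.symm
    have hcont : ContinuousAt (fun y => weightExt ρ (√(τ y))) x :=
      (h.continuous_weightExt.comp Real.continuous_sqrt).continuousAt.comp hτ.continuousAt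
    obtain ⟨p', h1, h2⟩ := hp
    refine ⟨weightExt ρ (√(τ x)) • p', ?_, fun v => by simp [h2, hp1]⟩
    have h3 : HasFDerivAt (fun y => weightExt ρ (√(τ x)) * p y) (weightExt ρ (√(τ x)) • p') x :=
      h1.const_mul _
    have h4 : HasFDerivAt (fun y => (weightExt ρ (√(τ y)) - weightExt ρ (√(τ x))) * p y)
        (0 : E →L[ℝ] ℝ) x := by
      rw [hasFDerivAt_iff_isLittleO]
      have h5 : (fun y => p y) =O[𝓝 x] fun y => y - x := by
        simpa [hp1] using h1.isBigO_sub
      have h6 : (fun y => weightExt ρ (√(τ y)) - weightExt ρ (√(τ x))) =o[𝓝 x]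
          fun _ => (1 : ℝ) := by
        rw [Asymptotics.isLittleO_one_iff]
        simpa using hcont.tendsto.sub_const (weightExt ρ (√(τ x)))
      have h7 := (h6.mul_isBigO h5.norm_right)
      simp only [one_mul] at h7
      simpa [hp1] using h7.norm_right
    have h8 := h4.add h3
    rw [zero_add] at h8
    refine h8.congr_of_eventuallyEq (Eventually.of_forall fun y => ?_)
    simp only [Pi.add_apply]
    ring
  · obtain ⟨t', h1, h2⟩ := hτ
    have h3 : HasFD (fun y => weightExt ρ (√(τ y)))
        (fun v => (deriv (deriv ρ) (√(τ x)) - weightExt ρ (√(τ x))) / (2 * τ x) * Dτ v) x :=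
      ⟨_, (h.hasDerivAt_weightExt_comp_sqrt h0).comp_hasFDerivAt x h1, fun v => by simp [h2]⟩
    refine (h3.mul hp).congr_deriv fun v => by ring

end HasFD

/-! ### Entrywise bounds for matrices -/

/-- The sum of the absolute values of the entries of a matrix. -/
def asum {m n : ℕ} (A : Matrix (Fin m) (Fin n) ℝ) : ℝ := ∑ i, ∑ j, |A i j|

section asum

variable {m n p : ℕ}

lemma asum_nonneg (A : Matrix (Fin m) (Fin n) ℝ) : 0 ≤ asum A :=
  Finset.sum_nonneg fun _ _ => Finset.sum_nonneg fun _ _ => abs_nonneg _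

lemma sum_abs_row_le_asum (A : Matrix (Fin m) (Fin n) ℝ) (i : Fin m) : ∑ j, |A i j| ≤ asum A :=
  Finset.single_le_sum (f := fun i => ∑ j, |A i j|)
    (fun _ _ => Finset.sum_nonneg fun _ _ => abs_nonneg _) (Finset.mem_univ i)

lemma abs_le_asum (A : Matrix (Fin m) (Fin n) ℝ) (i : Fin m) (j : Fin n) : |A i j| ≤ asum A :=
  (Finset.single_le_sum (f := fun j => |A i j|) (fun _ _ => abs_nonneg _)
    (Finset.mem_univ j)).trans (sum_abs_row_le_asum A i)

lemma norm_mulVec_le_asum (A : Matrix (Fin m) (Fin n) ℝ) (x : Fin n → ℝ) :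
    ‖A *ᵥ x‖ ≤ asum A * ‖x‖ := by
  refine (pi_norm_le_iff_of_nonneg (mul_nonneg (asum_nonneg A) (norm_nonneg x))).2 fun i => ?_
  have h0 : (A *ᵥ x) i = ∑ j, A i j * x j := rfl
  rw [Real.norm_eq_abs, h0]
  calc |∑ j, A i j * x j| ≤ ∑ j, |A i j * x j| := Finset.abs_sum_le_sum_abs _ _
    _ ≤ ∑ j, |A i j| * ‖x‖ := Finset.sum_le_sum fun j _ => by
        rw [abs_mul]
        exact mul_le_mul_of_nonneg_left (norm_le_pi_norm x j) (abs_nonneg _)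
    _ = (∑ j, |A i j|) * ‖x‖ := by rw [Finset.sum_mul]
    _ ≤ _ := mul_le_mul_of_nonneg_right (sum_abs_row_le_asum A i) (norm_nonneg x)

lemma abs_dotProduct_le (x y : Fin m → ℝ) : |x ⬝ᵥ y| ≤ m * (‖x‖ * ‖y‖) := by
  calc |x ⬝ᵥ y| ≤ ∑ i, |x i * y i| := Finset.abs_sum_le_sum_abs _ _
    _ ≤ ∑ _i : Fin m, ‖x‖ * ‖y‖ := Finset.sum_le_sum fun i _ => by
        rw [abs_mul]
        exact mul_le_mul (norm_le_pi_norm x i) (norm_le_pi_norm y i) (abs_nonneg _) (norm_nonneg _)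
    _ = _ := by simp

lemma abs_trace_le_asum (A : Matrix (Fin m) (Fin m) ℝ) : |A.trace| ≤ asum A := by
  refine (Finset.abs_sum_le_sum_abs _ _).trans (Finset.sum_le_sum fun i _ => ?_)
  exact Finset.single_le_sum (f := fun j => |A i j|) (fun _ _ => abs_nonneg _) (Finset.mem_univ i)

lemma asum_mul_le (A : Matrix (Fin m) (Fin n) ℝ) (B : Matrix (Fin n) (Fin p) ℝ) :
    asum (A * B) ≤ asum A * asum B := by
  unfold asum
  rw [Finset.sum_mul]
  refine Finset.sum_le_sum fun i _ => ?_
  calc ∑ j, |(A * B) i j| ≤ ∑ j, ∑ a, |A i a| * |B a j| := Finset.sum_le_sum fun j _ => by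
        rw [Matrix.mul_apply]
        exact (Finset.abs_sum_le_sum_abs _ _).trans (by simp [abs_mul])
    _ = ∑ a, |A i a| * ∑ j, |B a j| := by
        rw [Finset.sum_comm]; simp [Finset.mul_sum]
    _ ≤ ∑ a, |A i a| * asum B := Finset.sum_le_sum fun a _ =>
        mul_le_mul_of_nonneg_left (sum_abs_row_le_asum B a) (abs_nonneg _)
    _ = _ := by rw [Finset.sum_mul, asum]

lemma asum_add_le (A B : Matrix (Fin m) (Fin n) ℝ) : asum (A + B) ≤ asum A + asum B := by
  simp only [asum, ← Finset.sum_add_distrib]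
  exact Finset.sum_le_sum fun i _ => Finset.sum_le_sum fun j _ => abs_add_le _ _

lemma asum_smul (c : ℝ) (A : Matrix (Fin m) (Fin n) ℝ) : asum (c • A) = |c| * asum A := by
  simp [asum, abs_mul, Finset.mul_sum]

lemma continuous_asum : Continuous (asum : Matrix (Fin m) (Fin n) ℝ → ℝ) := by
  unfold asum
  exact continuous_finsetSum _ fun i _ => continuous_finsetSum _ fun j _ =>
    (continuous_id.matrix_elem i j).abs

/-- Cauchy–Schwarz; it turns square integrability of the entries of `X` into integrability of `dom`.
-/
lemma sq_asum_le (A : Matrix (Fin m) (Fin n) ℝ) :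
    asum A ^ 2 ≤ (m * n) * ∑ i, ∑ j, A i j ^ 2 := by
  have h := sq_sum_le_card_mul_sum_sq (s := (Finset.univ : Finset (Fin m × Fin n)))
    (f := fun p => |A p.1 p.2|)
  simpa [Fintype.sum_prod_type, asum] using h

lemma abs_dotProduct_mulVec_le (A : Matrix (Fin m) (Fin m) ℝ) (x : Fin m → ℝ) :
    |x ⬝ᵥ (A *ᵥ x)| ≤ asum A * (x ⬝ᵥ x) := by
  have hx : ∀ i, x i ^ 2 ≤ x ⬝ᵥ x := fun i => by
    have := Finset.single_le_sum (f := fun i => x i * x i) (fun i _ => mul_self_nonneg (x i))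
      (Finset.mem_univ i)
    rw [pow_two]; exact this
  have h0 : x ⬝ᵥ (A *ᵥ x) = ∑ i, ∑ j, x i * (A i j * x j) := by
    simp only [dotProduct, mulVec, Finset.mul_sum]
  rw [h0, asum, Finset.sum_mul]
  refine (Finset.abs_sum_le_sum_abs _ _).trans ?_
  refine Finset.sum_le_sum fun i _ => (Finset.abs_sum_le_sum_abs _ _).trans ?_
  rw [Finset.sum_mul]
  refine Finset.sum_le_sum fun j _ => ?_
  rw [abs_mul, abs_mul]
  have h1 : |x i| * |x j| ≤ x ⬝ᵥ x := by
    nlinarith [hx i, hx j, sq_abs (x i), sq_abs (x j), sq_nonneg (|x i| - |x j|)]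
  have h2 := mul_le_mul_of_nonneg_left h1 (abs_nonneg (A i j))
  linarith

end asum

/-! ### Inequalities for positive definite matrices -/

section PosDef

variable {n : ℕ} {V : Matrix (Fin n) (Fin n) ℝ}

lemma posDef_pos (hV : V.PosDef) {x : Fin n → ℝ} (hx : x ≠ 0) : 0 < x ⬝ᵥ (V *ᵥ x) := by
  simpa using hV.dotProduct_mulVec_pos hx

lemma posDef_nonneg (hV : V.PosDef) (x : Fin n → ℝ) : 0 ≤ x ⬝ᵥ (V *ᵥ x) := by
  simpa using hV.posSemidef.dotProduct_mulVec_nonneg x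

lemma posDef_isSymm (hV : V.PosDef) : V.IsSymm := by
  have := hV.isHermitian
  rwa [Matrix.IsHermitian, conjTranspose_eq_transpose_of_trivial] at this

lemma posDef_isUnit_det (hV : V.PosDef) : IsUnit V.det := hV.det_pos.ne'.isUnit

lemma symm_dotProduct_mulVec (hV : V.IsSymm) (x y : Fin n → ℝ) :
    x ⬝ᵥ (V *ᵥ y) = (V *ᵥ x) ⬝ᵥ y := by
  rw [dotProduct_mulVec, ← mulVec_transpose, hV.eq]

/-- The Cauchy–Schwarz inequality for a positive definite matrix and its inverse. -/
lemma sq_dotProduct_le (hV : V.PosDef) (v r : Fin n → ℝ) :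
    (v ⬝ᵥ r) ^ 2 ≤ (v ⬝ᵥ (V *ᵥ v)) * (r ⬝ᵥ (V⁻¹ *ᵥ r)) := by
  rcases eq_or_ne v 0 with rfl | hv
  · simp
  have hpos := posDef_pos hV hv
  set A := v ⬝ᵥ (V *ᵥ v) with hA
  -- This `c` minimizes the `V⁻¹`-norm of `r - c V v`; nonnegativity of the minimum is the
  -- inequality.
  set c := (v ⬝ᵥ r) / A with hc
  have h := posDef_nonneg hV.inv (r - c • (V *ᵥ v))
  have hWs := posDef_isSymm hV.inv
  have h1 : V⁻¹ *ᵥ (V *ᵥ v) = v := by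
    rw [mulVec_mulVec, Matrix.nonsing_inv_mul _ (posDef_isUnit_det hV), one_mulVec]
  have h2 : (V *ᵥ v) ⬝ᵥ (V⁻¹ *ᵥ r) = v ⬝ᵥ r := by
    rw [symm_dotProduct_mulVec hWs, h1]
  rw [mulVec_sub, mulVec_smul, h1, sub_dotProduct, dotProduct_sub, dotProduct_sub, smul_dotProduct,
    smul_dotProduct, dotProduct_smul, dotProduct_smul, h2, dotProduct_comm r v,
    dotProduct_comm (V *ᵥ v) v, ← hA] at h
  simp only [smul_eq_mul] at h
  have h3 : c * A = v ⬝ᵥ r := by rw [hc]; field_simp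
  have h4 : 0 ≤ r ⬝ᵥ (V⁻¹ *ᵥ r) - c * (v ⬝ᵥ r) := by rw [h3] at h; linarith
  have h5 := mul_nonneg hpos.le h4
  have h6 : A * (c * (v ⬝ᵥ r)) = (v ⬝ᵥ r) ^ 2 := by rw [← mul_assoc, mul_comm A, h3]; ring
  nlinarith

lemma sq_apply_le (hV : V.PosDef) (r : Fin n → ℝ) (i : Fin n) :
    r i ^ 2 ≤ V i i * (r ⬝ᵥ (V⁻¹ *ᵥ r)) := by
  simpa using sq_dotProduct_le hV (Pi.single i 1) r

lemma sq_norm_le_asum (hV : V.PosDef) (r : Fin n → ℝ) :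
    ‖r‖ ^ 2 ≤ asum V * (r ⬝ᵥ (V⁻¹ *ᵥ r)) := by
  have h0 := mul_nonneg (asum_nonneg V) (posDef_nonneg hV.inv r)
  have h : ‖r‖ ≤ √(asum V * (r ⬝ᵥ (V⁻¹ *ᵥ r))) := by
    refine (pi_norm_le_iff_of_nonneg (Real.sqrt_nonneg _)).2 fun i => ?_
    refine Real.abs_le_sqrt ((sq_apply_le hV r i).trans ?_)
    exact mul_le_mul_of_nonneg_right ((le_abs_self _).trans (abs_le_asum V i i))
      (posDef_nonneg hV.inv r)
  calc ‖r‖ ^ 2 ≤ _ := pow_le_pow_left₀ (norm_nonneg r) h 2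
    _ = _ := Real.sq_sqrt h0

lemma dotProduct_self_le_asum (hV : V.PosDef) (r : Fin n → ℝ) :
    r ⬝ᵥ r ≤ asum V * (r ⬝ᵥ (V⁻¹ *ᵥ r)) := by
  rw [dotProduct]
  calc ∑ i, r i * r i ≤ ∑ i, ∑ j, |V i j| * (r ⬝ᵥ (V⁻¹ *ᵥ r)) := Finset.sum_le_sum fun i _ => by
        rw [← Finset.sum_mul, ← pow_two]
        refine (sq_apply_le hV r i).trans (mul_le_mul_of_nonneg_right ?_ (posDef_nonneg hV.inv r))
        exact (le_abs_self _).trans (Finset.single_le_sum (f := fun j => |V i j|)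
          (fun _ _ => abs_nonneg _) (Finset.mem_univ i))
    _ = _ := by simp only [← Finset.sum_mul, asum]

/-- Positive definiteness is stable under small symmetric perturbations. -/
lemma posDef_of_asum_sub_lt (hV : V.PosDef) {V' : Matrix (Fin n) (Fin n) ℝ} (hV' : V'.IsSymm)
    (h : asum V⁻¹ * asum (V' - V) < 1) : V'.PosDef := by
  refine Matrix.PosDef.of_dotProduct_mulVec_pos
    (by rw [Matrix.IsHermitian, conjTranspose_eq_transpose_of_trivial]; exact hV') fun {x} hx => ?_
  -- Since `x ⬝ x ≤ asum V⁻¹ * (x ⬝ V x)`, the perturbation changes the quadratic form by less than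
  -- `x ⬝ V x`.
  have h1 := dotProduct_self_le_asum hV.inv x
  rw [Matrix.nonsing_inv_nonsing_inv _ (posDef_isUnit_det hV)] at h1
  have h2 := (abs_le.1 (abs_dotProduct_mulVec_le (V' - V) x)).1
  have h3 := posDef_pos hV hx
  rw [sub_mulVec, dotProduct_sub] at h2
  have h4 := mul_le_mul_of_nonneg_left h1 (asum_nonneg (V' - V))
  simp only [star_trivial]
  nlinarith

end PosDef

/-! ### The linear covariance structure -/

section linCov

variable {k l : ℕ} (L : Fin l → Matrix (Fin k) (Fin k) ℝ)

/-- The linear covariance structure as a linear map. -/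
def linCovLM : (Fin l → ℝ) →ₗ[ℝ] Matrix (Fin k) (Fin k) ℝ where
  toFun := linCov L
  map_add' := fun a b => by simp [linCov, add_smul, Finset.sum_add_distrib]
  map_smul' := fun c a => by simp [linCov, smul_smul, Finset.smul_sum]

lemma linCov_add (a b : Fin l → ℝ) : linCov L (a + b) = linCov L a + linCov L b :=
  (linCovLM L).map_add a b

lemma linCov_smul (c : ℝ) (a : Fin l → ℝ) : linCov L (c • a) = c • linCov L a :=
  (linCovLM L).map_smul c a

lemma linCov_zero : linCov L 0 = 0 := (linCovLM L).map_zero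

lemma continuous_linCov : Continuous (linCov L) := by
  unfold linCov
  exact continuous_finsetSum _ fun j _ => (continuous_apply j).smul continuous_const

variable {L}

lemma linCov_isSymm (hL : ∀ j, (L j).IsSymm) (θ : Fin l → ℝ) : (linCov L θ).IsSymm := by
  simp [Matrix.IsSymm, linCov, transpose_sum, fun j => (hL j).eq]

variable (L) in
lemma asum_linCov_le (θ : Fin l → ℝ) : asum (linCov L θ) ≤ (∑ j, asum (L j)) * ‖θ‖ := by
  calc asum (linCov L θ) ≤ ∑ j, asum (θ j • L j) :=
        Finset.le_sum_of_subadditive asum (by simp [asum]) asum_add_le _ _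
    _ ≤ ∑ j, asum (L j) * ‖θ‖ := Finset.sum_le_sum fun j _ => by
        rw [asum_smul, mul_comm]
        exact mul_le_mul_of_nonneg_left (norm_le_pi_norm θ j) (asum_nonneg _)
    _ = _ := by rw [Finset.sum_mul]

lemma vecMat_mulVec (θ : Fin l → ℝ) : vecMat L *ᵥ θ = (linCov L θ).vec := by
  ext p
  simp [vecMat, mulVec, dotProduct, linCov, Matrix.vec, Matrix.sum_apply, mul_comm]

lemma linCov_injective (hLrank : (vecMat L).rank = l) : Function.Injective (linCov L) := by
  have h1 : Function.Injective (vecMat L).mulVecLin := by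
    rw [← LinearMap.ker_eq_bot]
    have := LinearMap.finrank_range_add_finrank_ker (vecMat L).mulVecLin
    rw [← Matrix.rank, hLrank, Module.finrank_fin_fun] at this
    exact Submodule.finrank_eq_zero.1 (by omega)
  intro a b hab
  apply h1
  simp [vecMat_mulVec, hab]

section

attribute [local instance] Matrix.linftyOpNormedRing Matrix.linftyOpNormedAlgebra

-- The derivative of ring inversion, read entry by entry so that the choice of a norm on matrices
-- stays local to this proof.
variable (L) in
lemma hasFD_inv_linCov {q : ℕ} (ξ : Param q l) (h : IsUnit (linCov L ξ.2).det) (a b : Fin k) :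
    HasFD (fun ξ : Param q l => (linCov L ξ.2)⁻¹ a b)
      (fun v => -((linCov L ξ.2)⁻¹ * linCov L v.2 * (linCov L ξ.2)⁻¹) a b) ξ := by
  have hu := (Matrix.isUnit_iff_isUnit_det _).2 h
  let A : Param q l →L[ℝ] Matrix (Fin k) (Fin k) ℝ :=
    (LinearMap.toContinuousLinearMap (linCovLM L)).comp (ContinuousLinearMap.snd ℝ _ _)
  have hA : ∀ ξ, A ξ = linCov L ξ.2 := fun _ => rfl
  obtain ⟨u, hu'⟩ := hu
  have h1 := hasFDerivAt_ringInverse (𝕜 := ℝ) u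
  rw [hu', ← hA ξ] at h1
  have h2 := h1.comp ξ A.hasFDerivAt
  let B : Matrix (Fin k) (Fin k) ℝ →L[ℝ] ℝ := LinearMap.toContinuousLinearMap
    { toFun := fun M => M a b, map_add' := fun _ _ => rfl, map_smul' := fun _ _ => rfl }
  have hB : ∀ M, B M = M a b := fun _ => rfl
  have h3 := B.hasFDerivAt.comp ξ h2
  refine ⟨_, h3.congr_of_eventuallyEq (Eventually.of_forall fun x => by
      simp [hB, hA, Matrix.nonsing_inv_eq_ringInverse]), fun v => ?_⟩
  have : (↑u⁻¹ : Matrix (Fin k) (Fin k) ℝ) = (linCov L ξ.2)⁻¹ := by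
    rw [← hu', Matrix.coe_units_inv]
  rw [← this]
  rfl

end

end linCov

/-! ### The score of the minimization problem and its derivative -/

section score

variable {k q l : ℕ} (L : Fin l → Matrix (Fin k) (Fin k) ℝ)

/-- The precision matrix `V(θ)⁻¹`. -/
def prec (ξ : Param q l) : Matrix (Fin k) (Fin k) ℝ := (linCov L ξ.2)⁻¹

/-- The scaled residual `V(θ)⁻¹ (y - X β)`. -/
def sres (ξ : Param q l) (s : Obs k q) : Fin k → ℝ := prec L ξ *ᵥ resid s ξ.1

/-- The squared Mahalanobis distance. -/
def tau (ξ : Param q l) (s : Obs k q) : ℝ := resid s ξ.1 ⬝ᵥ sres L ξ s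

lemma mahal_eq_sqrt_tau (ξ : Param q l) (s : Obs k q) :
    mahal (linCov L ξ.2) ξ.1 s = √(tau L ξ s) := rfl

/-- The derivative of `tau`. -/
def dtau (ξ : Param q l) (s : Obs k q) (v : Param q l) : ℝ :=
  -2 * (sres L ξ s ⬝ᵥ (s.2 *ᵥ v.1)) - sres L ξ s ⬝ᵥ (linCov L v.2 *ᵥ sres L ξ s)

/-- The derivative of `sres`. -/
def dsres (ξ : Param q l) (s : Obs k q) (v : Param q l) : Fin k → ℝ :=
  -(prec L ξ *ᵥ (linCov L v.2 *ᵥ sres L ξ s)) - prec L ξ *ᵥ (s.2 *ᵥ v.1)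

/-- The derivative of `log det V(θ)` in the direction `v`. -/
def trPrec (v ξ : Param q l) : ℝ := (prec L ξ * linCov L v.2).trace

/-- The derivative of `trPrec`. -/
def dtrPrec (v ξ v' : Param q l) : ℝ :=
  -(prec L ξ * linCov L v'.2 * (prec L ξ * linCov L v.2)).trace

/-- The factor of the weight function in the score in the direction `v`. -/
def scoreFactor (v ξ : Param q l) (s : Obs k q) : ℝ :=
  k * (sres L ξ s ⬝ᵥ (s.2 *ᵥ v.1)) +
    k / 2 * (sres L ξ s ⬝ᵥ (linCov L v.2 *ᵥ sres L ξ s)) -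
    1 / 2 * (tau L ξ s * trPrec L v ξ)

/-- The derivative of `scoreFactor`. -/
def dscoreFactor (v ξ : Param q l) (s : Obs k q) (v' : Param q l) : ℝ :=
  k * (dsres L ξ s v' ⬝ᵥ (s.2 *ᵥ v.1)) +
    k / 2 * (sres L ξ s ⬝ᵥ (linCov L v.2 *ᵥ dsres L ξ s v') +
      dsres L ξ s v' ⬝ᵥ (linCov L v.2 *ᵥ sres L ξ s)) -
    1 / 2 * (tau L ξ s * dtrPrec L v ξ v' + dtau L ξ s v' * trPrec L v ξ)

/-- The score of the S-minimization problem in the direction `v`; the constant `c` weighs the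
constraint. -/
def score (ρ : ℝ → ℝ) (b₀ c : ℝ) (v ξ : Param q l) (s : Obs k q) : ℝ :=
  weightExt ρ (√(tau L ξ s)) * scoreFactor L v ξ s +
    c * ((ρ (√(tau L ξ s)) - b₀) * trPrec L v ξ)

/-- The derivative of `score`. -/
def dscore (ρ : ℝ → ℝ) (b₀ c : ℝ) (v ξ : Param q l) (s : Obs k q) (v' : Param q l) : ℝ :=
  (weightExt ρ (√(tau L ξ s)) * dscoreFactor L v ξ s v' +
    (deriv (deriv ρ) (√(tau L ξ s)) - weightExt ρ (√(tau L ξ s))) / (2 * tau L ξ s) *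
      scoreFactor L v ξ s * dtau L ξ s v') +
    c * ((ρ (√(tau L ξ s)) - b₀) * dtrPrec L v ξ v' +
      weightExt ρ (√(tau L ξ s)) / 2 * dtau L ξ s v' * trPrec L v ξ)

variable {L}

lemma tau_nonneg {ξ : Param q l} (h : (linCov L ξ.2).PosDef) (s : Obs k q) : 0 ≤ tau L ξ s :=
  posDef_nonneg h.inv _

lemma prec_isSymm {ξ : Param q l} (h : (linCov L ξ.2).PosDef) : (prec L ξ).IsSymm :=
  posDef_isSymm h.inv

lemma resid_eq_zero {ξ : Param q l} (h : (linCov L ξ.2).PosDef) {s : Obs k q}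
    (h0 : tau L ξ s = 0) : resid s ξ.1 = 0 := by
  by_contra hne
  exact (posDef_pos h.inv hne).ne' h0

lemma hasFD_resid (ξ : Param q l) (s : Obs k q) :
    HasFD (fun ξ : Param q l => resid s ξ.1) (fun v => -(s.2 *ᵥ v.1)) ξ := by
  have h := (HasFD.const (x := ξ) s.1).sub
    ((HasFD.clm (x := ξ) (ContinuousLinearMap.fst ℝ (Fin q → ℝ) (Fin l → ℝ))).mulVec s.2)
  exact h.congr_deriv fun v => by simp

lemma hasFD_sres {ξ : Param q l} (h : (linCov L ξ.2).PosDef) (s : Obs k q) :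
    HasFD (fun ξ => sres L ξ s) (dsres L ξ s) ξ := by
  refine HasFD.pi fun a => ?_
  have h1 := (HasFD.pi (f := fun ξ : Param q l => (linCov L ξ.2)⁻¹ a)
    (D := fun v b => -((linCov L ξ.2)⁻¹ * linCov L v.2 * (linCov L ξ.2)⁻¹) a b)
    fun b => hasFD_inv_linCov L ξ (posDef_isUnit_det h) a b).dotProduct (hasFD_resid ξ s)
  refine h1.congr_deriv fun v => ?_
  have e1 : ∀ x, (linCov L ξ.2)⁻¹ a ⬝ᵥ x = ((linCov L ξ.2)⁻¹ *ᵥ x) a := fun _ => rfl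
  have e2 : ∀ x, (fun b => -((linCov L ξ.2)⁻¹ * linCov L v.2 * (linCov L ξ.2)⁻¹) a b) ⬝ᵥ x =
      ((-((linCov L ξ.2)⁻¹ * linCov L v.2 * (linCov L ξ.2)⁻¹)) *ᵥ x) a := fun _ => rfl
  rw [e1, e2]
  simp only [dsres, sres, prec, neg_mulVec, mulVec_neg, ← mulVec_mulVec, Pi.neg_apply,
    Pi.sub_apply]
  ring

lemma hasFD_tau {ξ : Param q l} (h : (linCov L ξ.2).PosDef) (s : Obs k q) :
    HasFD (fun ξ => tau L ξ s) (dtau L ξ s) ξ := by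
  refine ((hasFD_resid ξ s).dotProduct (hasFD_sres h s)).congr_deriv fun v => ?_
  have hW := prec_isSymm h
  simp only [dtau, dsres, dotProduct_sub, dotProduct_neg, neg_dotProduct]
  rw [symm_dotProduct_mulVec hW, symm_dotProduct_mulVec hW, ← sres,
    dotProduct_comm (s.2 *ᵥ v.1)]
  ring

lemma hasFD_trPrec (v : Param q l) {ξ : Param q l} (h : (linCov L ξ.2).PosDef) :
    HasFD (fun ξ => trPrec L v ξ) (dtrPrec L v ξ) ξ := by
  have h1 := HasFD.sum (x := ξ) Finset.univ fun (a : Fin k) _ =>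
    HasFD.sum (x := ξ) Finset.univ fun (b : Fin k) _ =>
      (hasFD_inv_linCov L ξ (posDef_isUnit_det h) a b).mul (HasFD.const (linCov L v.2 b a))
  refine HasFD.congr_deriv (f := fun ξ => trPrec L v ξ) h1 fun v' => ?_
  simp only [mul_zero, zero_add, dtrPrec, ← Matrix.mul_assoc]
  rw [Matrix.trace, ← Finset.sum_neg_distrib]
  refine Finset.sum_congr rfl fun a _ => ?_
  rw [Matrix.diag_apply, Matrix.mul_apply, ← Finset.sum_neg_distrib]
  exact Finset.sum_congr rfl fun b _ => by rw [neg_mul]; rfl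

lemma hasFD_scoreFactor (v : Param q l) {ξ : Param q l} (h : (linCov L ξ.2).PosDef)
    (s : Obs k q) : HasFD (fun ξ => scoreFactor L v ξ s) (dscoreFactor L v ξ s) ξ := by
  have hy := hasFD_sres h s
  have h1 := (hy.dotProduct (HasFD.const (x := ξ) (s.2 *ᵥ v.1))).const_mul (k : ℝ)
  have h2 := (hy.dotProduct (hy.mulVec (linCov L v.2))).const_mul ((k : ℝ) / 2)
  have h3 := ((hasFD_tau h s).mul (hasFD_trPrec v h)).const_mul (1 / 2)
  refine ((h1.add h2).sub h3).congr_deriv fun v' => ?_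
  simp [dscoreFactor]

/-- This is the vanishing condition that `HasFD.weight_mul` needs at a zero residual. -/
lemma scoreFactor_eq_zero (v : Param q l) {ξ : Param q l} (h : (linCov L ξ.2).PosDef)
    {s : Obs k q} (h0 : tau L ξ s = 0) : scoreFactor L v ξ s = 0 := by
  simp [scoreFactor, h0, sres, resid_eq_zero h h0]

end score

/-! ### Openness of positive definiteness; differentiability of loss and score -/

section openness

variable {k q l : ℕ} {L : Fin l → Matrix (Fin k) (Fin k) ℝ}

/-- Locally uniform control of the covariance and precision matrices. -/
lemma exists_nhds_bound (hL : ∀ j, (L j).IsSymm) {ξ₁ : Param q l} (h : (linCov L ξ₁.2).PosDef) :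
    ∃ U ∈ 𝓝 ξ₁, ∃ B, ∀ ξ ∈ U, (linCov L ξ.2).PosDef ∧ asum (linCov L ξ.2) ≤ B ∧
      asum (prec L ξ) ≤ B := by
  have hc : Continuous fun ξ : Param q l => linCov L ξ.2 := (continuous_linCov L).comp continuous_snd
  have h1 : ∀ᶠ ξ : Param q l in 𝓝 ξ₁, (linCov L ξ.2).PosDef := by
    have h2 : Continuous fun ξ : Param q l =>
        asum (linCov L ξ₁.2)⁻¹ * asum (linCov L ξ.2 - linCov L ξ₁.2) :=
      continuous_const.mul (continuous_asum.comp (hc.sub continuous_const))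
    have h3 := h2.tendsto ξ₁
    have h4 : asum (linCov L ξ₁.2)⁻¹ * asum (linCov L ξ₁.2 - linCov L ξ₁.2) < 1 := by
      simp [asum]
    filter_upwards [h3.eventually_lt_const h4] with ξ hξ
    exact posDef_of_asum_sub_lt h (linCov_isSymm hL _) hξ
  have h2 : ∀ᶠ ξ : Param q l in 𝓝 ξ₁, asum (linCov L ξ.2) < asum (linCov L ξ₁.2) + 1 :=
    ((continuous_asum.comp hc).tendsto ξ₁).eventually_lt_const (by simp)
  have h3 : ∀ᶠ ξ : Param q l in 𝓝 ξ₁, asum (prec L ξ) < asum (prec L ξ₁) + 1 := by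
    have hW : ContinuousAt (fun ξ : Param q l => asum (prec L ξ)) ξ₁ := by
      unfold asum prec
      refine tendsto_finsetSum _ fun a _ => tendsto_finsetSum _ fun b _ => ?_
      exact (hasFD_inv_linCov L ξ₁ (posDef_isUnit_det h) a b).continuousAt.abs
    exact hW.tendsto.eventually_lt_const (by simp)
  refine ⟨_, h1.and (h2.and h3), max (asum (linCov L ξ₁.2) + 1) (asum (prec L ξ₁) + 1),
    fun ξ hξ => ⟨hξ.1, hξ.2.1.le.trans (le_max_left _ _), hξ.2.2.le.trans (le_max_right _ _)⟩⟩

lemma eventually_posDef (hL : ∀ j, (L j).IsSymm) {ξ₁ : Param q l}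
    (h : (linCov L ξ₁.2).PosDef) : ∀ᶠ ξ in 𝓝 ξ₁, (linCov L ξ.2).PosDef := by
  obtain ⟨U, hU, B, hB⟩ := exists_nhds_bound hL h
  filter_upwards [hU] with ξ hξ using (hB ξ hξ).1

variable {ρ : ℝ → ℝ} {c₀ : ℝ}

lemma hasFD_rho (hρ : IsRho ρ c₀) (hL : ∀ j, (L j).IsSymm) {ξ : Param q l}
    (h : (linCov L ξ.2).PosDef) (s : Obs k q) :
    HasFD (fun ξ => ρ (√(tau L ξ s))) (fun v => weightExt ρ (√(tau L ξ s)) / 2 * dtau L ξ s v) ξ := by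
  refine (hasFD_tau h s).comp_sqrt hρ ?_
  filter_upwards [eventually_posDef hL h] with ξ' h' using tau_nonneg h' s

lemma hasFD_score (hρ : IsRho ρ c₀) (hL : ∀ j, (L j).IsSymm) (b₀ c : ℝ) (v : Param q l)
    {ξ : Param q l} (h : (linCov L ξ.2).PosDef) (s : Obs k q) :
    HasFD (fun ξ => score L ρ b₀ c v ξ s) (dscore L ρ b₀ c v ξ s) ξ := by
  have h1 := HasFD.weight_mul hρ (hasFD_tau h s) (hasFD_scoreFactor v h s) (tau_nonneg h s)
    (scoreFactor_eq_zero v h)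
  have h2 := ((((hasFD_rho hρ hL h s).sub (HasFD.const b₀)).mul (hasFD_trPrec v h)).const_mul c)
  refine (h1.add h2).congr_deriv fun v' => ?_
  simp only [dscore, sub_zero]

end openness

/-! ### Locally uniform domination of the score and its derivative -/

section bigO

open Asymptotics

variable {α : Type*} {F : Filter α} {m n p : ℕ}

lemma isBigO_mulVec {A : α → Matrix (Fin m) (Fin n) ℝ} {f : α → Fin n → ℝ} {a b : α → ℝ}
    (hA : (fun x => asum (A x)) =O[F] a) (hf : f =O[F] b) :
    (fun x => A x *ᵥ f x) =O[F] fun x => a x * b x := by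
  refine IsBigO.trans ?_ (hA.mul hf.norm_left)
  refine IsBigO.of_bound 1 (Eventually.of_forall fun x => ?_)
  rw [one_mul, Real.norm_of_nonneg (mul_nonneg (asum_nonneg _) (norm_nonneg _))]
  exact norm_mulVec_le_asum _ _

lemma isBigO_dotProduct {f g : α → Fin n → ℝ} {a b : α → ℝ} (hf : f =O[F] a) (hg : g =O[F] b) :
    (fun x => f x ⬝ᵥ g x) =O[F] fun x => a x * b x := by
  refine IsBigO.trans ?_ (hf.norm_left.mul hg.norm_left)
  refine IsBigO.of_bound n (Eventually.of_forall fun x => ?_)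
  rw [Real.norm_of_nonneg (mul_nonneg (norm_nonneg _) (norm_nonneg _))]
  exact abs_dotProduct_le _ _

lemma isBigO_asum_mul {A : α → Matrix (Fin m) (Fin n) ℝ} {B : α → Matrix (Fin n) (Fin p) ℝ}
    {a b : α → ℝ} (hA : (fun x => asum (A x)) =O[F] a) (hB : (fun x => asum (B x)) =O[F] b) :
    (fun x => asum (A x * B x)) =O[F] fun x => a x * b x := by
  refine IsBigO.trans ?_ (hA.mul hB)
  refine IsBigO.of_bound 1 (Eventually.of_forall fun x => ?_)
  rw [one_mul, Real.norm_of_nonneg (mul_nonneg (asum_nonneg _) (asum_nonneg _)),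
    Real.norm_of_nonneg (asum_nonneg _)]
  exact asum_mul_le _ _

lemma isBigO_trace {A : α → Matrix (Fin m) (Fin m) ℝ} {a : α → ℝ}
    (hA : (fun x => asum (A x)) =O[F] a) : (fun x => (A x).trace) =O[F] a := by
  refine IsBigO.trans ?_ hA
  refine IsBigO.of_bound 1 (Eventually.of_forall fun x => ?_)
  rw [one_mul, Real.norm_of_nonneg (asum_nonneg _)]
  exact abs_trace_le_asum _

end bigO

section bounds

open Asymptotics

variable {k q l : ℕ} {L : Fin l → Matrix (Fin k) (Fin k) ℝ} {ρ : ℝ → ℝ} {c₀ : ℝ}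

/-- The function `(1 + ∑ |X i j|)²`, which dominates the derivatives of the score. -/
def dom (s : Obs k q) : ℝ := (1 + asum s.2) ^ 2

lemma one_le_dom (s : Obs k q) : 1 ≤ dom s := by
  have := asum_nonneg s.2
  unfold dom; nlinarith

/-- On a set where the parameter is confined and `d ≤ c₀`, all constituents are controlled. -/
lemma isBigO_constituents {U : Set (Param q l)} {B : ℝ}
    (hB : ∀ ξ ∈ U, (linCov L ξ.2).PosDef ∧ asum (linCov L ξ.2) ≤ B ∧ asum (prec L ξ) ≤ B)
    (v : Param q l) {S : Set (Param q l × Obs k q × Param q l)}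
    (hS : S = {x | x.1 ∈ U ∧ tau L x.1 x.2.1 ≤ c₀ ^ 2}) :
    ((fun x : Param q l × Obs k q × Param q l => scoreFactor L v x.1 x.2.1) =O[𝓟 S]
      fun x => (1 + asum x.2.1.2) * ‖resid x.2.1 x.1.1‖) ∧
    ((fun x : Param q l × Obs k q × Param q l => dtau L x.1 x.2.1 x.2.2) =O[𝓟 S]
      fun x => (1 + asum x.2.1.2) * ‖resid x.2.1 x.1.1‖ * ‖x.2.2‖) ∧
    ((fun x : Param q l × Obs k q × Param q l => dscoreFactor L v x.1 x.2.1 x.2.2) =O[𝓟 S]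
      fun x => dom x.2.1 * ‖x.2.2‖) ∧
    ((fun x : Param q l × Obs k q × Param q l => ‖resid x.2.1 x.1.1‖) =O[𝓟 S] fun _ => (1 : ℝ)) ∧
    ((fun x : Param q l × Obs k q × Param q l => trPrec L v x.1) =O[𝓟 {x | x.1 ∈ U}]
      fun _ => (1 : ℝ)) ∧
    ((fun x : Param q l × Obs k q × Param q l => dtrPrec L v x.1 x.2.2) =O[𝓟 {x | x.1 ∈ U}]
      fun x => ‖x.2.2‖) := by
  have hSU : 𝓟 S ≤ 𝓟 {x : Param q l × Obs k q × Param q l | x.1 ∈ U} := by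
    rw [principal_mono, hS]; exact fun x hx => hx.1
  set t : Param q l × Obs k q × Param q l → ℝ := fun x => 1 + asum x.2.1.2 with ht
  set r : Param q l × Obs k q × Param q l → ℝ := fun x => ‖resid x.2.1 x.1.1‖ with hr
  set n : Param q l × Obs k q × Param q l → ℝ := fun x => ‖x.2.2‖ with hn
  have ht1 : ∀ x, 1 ≤ t x := fun x => le_add_of_nonneg_right (asum_nonneg _)
  have hW' : (fun x : Param q l × Obs k q × Param q l => asum (prec L x.1)) =O[𝓟 {x | x.1 ∈ U}]
      fun _ => (1 : ℝ) := by
    refine isBigO_principal.2 ⟨B, fun x hx => ?_⟩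
    rw [Real.norm_of_nonneg (asum_nonneg _), norm_one, mul_one]
    exact (hB x.1 hx).2.2
  have hW := hW'.mono hSU
  have hVv' : (fun x : Param q l × Obs k q × Param q l => asum (linCov L x.2.2.2))
      =O[𝓟 {x | x.1 ∈ U}] n := by
    refine isBigO_principal.2 ⟨∑ j, asum (L j), fun x hx => ?_⟩
    rw [Real.norm_of_nonneg (asum_nonneg _), hn, norm_norm]
    exact (asum_linCov_le L _).trans (mul_le_mul_of_nonneg_left (norm_snd_le _)
      (Finset.sum_nonneg fun _ _ => asum_nonneg _))
  have hVv := hVv'.mono hSU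
  have hV0' : (fun _ : Param q l × Obs k q × Param q l => asum (linCov L v.2))
      =O[𝓟 {x | x.1 ∈ U}] fun _ => (1 : ℝ) :=
    isBigO_const_const _ one_ne_zero _
  have hV0 := hV0'.mono hSU
  -- On `S` the squared residual norm is at most `asum V * d²`, and `d ≤ c₀`.
  have hr1 : r =O[𝓟 S] fun _ => (1 : ℝ) := by
    refine isBigO_principal.2 ⟨√(B * c₀ ^ 2), fun x hx => ?_⟩
    rw [hS] at hx
    obtain ⟨hx1, hx2⟩ := hx
    obtain ⟨h1, h2, -⟩ := hB x.1 hx1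
    rw [norm_one, mul_one, hr, norm_norm]
    refine Real.le_sqrt_of_sq_le ((sq_norm_le_asum h1 _).trans ?_)
    exact mul_le_mul h2 hx2 (tau_nonneg h1 _) ((asum_nonneg _).trans h2)
  have hrt : r =O[𝓟 S] t := hr1.trans (IsBigO.of_bound 1 (Eventually.of_forall fun x => by
    rw [norm_one, one_mul, Real.norm_of_nonneg (by linarith [ht1 x])]; exact ht1 x))
  have hres : (fun x : Param q l × Obs k q × Param q l => resid x.2.1 x.1.1) =O[𝓟 S] r :=
    (isBigO_refl _ _).norm_right
  have hX : (fun x : Param q l × Obs k q × Param q l => asum x.2.1.2) =O[𝓟 S] t :=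
    IsBigO.of_bound 1 (Eventually.of_forall fun x => by
      rw [Real.norm_of_nonneg (asum_nonneg _), Real.norm_of_nonneg (by linarith [ht1 x]), ht]
      simp)
  have hy : (fun x : Param q l × Obs k q × Param q l => sres L x.1 x.2.1) =O[𝓟 S] r := by
    exact (isBigO_mulVec hW hres).congr_right fun x => one_mul _
  have hXv : (fun x : Param q l × Obs k q × Param q l => x.2.1.2 *ᵥ x.2.2.1) =O[𝓟 S]
      fun x => t x * n x := by
    refine isBigO_mulVec hX (IsBigO.of_bound 1 (Eventually.of_forall fun x => ?_))
    rw [one_mul, hn, norm_norm]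
    exact norm_fst_le _
  have hX0 : (fun x : Param q l × Obs k q × Param q l => x.2.1.2 *ᵥ v.1) =O[𝓟 S] t := by
    simpa using isBigO_mulVec hX (isBigO_const_const v.1 (one_ne_zero (α := ℝ)) (𝓟 S))
  have hφ : (fun x : Param q l × Obs k q × Param q l => trPrec L v x.1) =O[𝓟 {x | x.1 ∈ U}]
      fun _ => (1 : ℝ) := by
    exact (isBigO_trace (isBigO_asum_mul hW' hV0')).congr_right fun x => one_mul _
  have hdφ : (fun x : Param q l × Obs k q × Param q l => dtrPrec L v x.1 x.2.2)
      =O[𝓟 {x | x.1 ∈ U}] n := by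
    exact (isBigO_trace (isBigO_asum_mul (isBigO_asum_mul hW' hVv')
      (isBigO_asum_mul hW' hV0'))).neg_left.congr_right fun x => by ring
  have hV0y : (fun x : Param q l × Obs k q × Param q l => linCov L v.2 *ᵥ sres L x.1 x.2.1)
      =O[𝓟 S] r := by
    simpa using isBigO_mulVec hV0 hy
  have hVy : (fun x : Param q l × Obs k q × Param q l => linCov L x.2.2.2 *ᵥ sres L x.1 x.2.1)
      =O[𝓟 S] fun x => n x * r x := isBigO_mulVec hVv hy
  have hτ : (fun x : Param q l × Obs k q × Param q l => tau L x.1 x.2.1)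
      =O[𝓟 S] fun x => r x * r x := isBigO_dotProduct hres hy
  have hτt : (fun x : Param q l × Obs k q × Param q l => tau L x.1 x.2.1)
      =O[𝓟 S] fun x => t x * r x := hτ.trans (hrt.mul (isBigO_refl r _))
  -- Here and in `hp` one factor `r` is kept rather than bounded; the two factors will cancel the
  -- singular `1 / τ` in the derivative of the score.
  have hdτ : (fun x : Param q l × Obs k q × Param q l => dtau L x.1 x.2.1 x.2.2) =O[𝓟 S]
      fun x => t x * r x * n x := by
    refine IsBigO.sub ?_ ?_
    · refine IsBigO.const_mul_left ?_ _
      refine (isBigO_dotProduct hy hXv).congr_right fun x => by ring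
    · refine (isBigO_dotProduct hy hVy).trans ?_
      refine ((hrt.mul (isBigO_refl r _)).mul (isBigO_refl n _)).congr_left fun x => by ring
  have hp : (fun x : Param q l × Obs k q × Param q l => scoreFactor L v x.1 x.2.1) =O[𝓟 S]
      fun x => t x * r x := by
    refine IsBigO.sub (IsBigO.add ?_ ?_) ?_
    · refine IsBigO.const_mul_left ?_ _
      exact (isBigO_dotProduct hy hX0).congr_right fun x => by ring
    · refine IsBigO.const_mul_left ?_ _
      exact (isBigO_dotProduct hy hV0y).trans (hrt.mul (isBigO_refl r _))
    · refine IsBigO.const_mul_left ?_ _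
      simpa using hτt.mul (hφ.mono hSU)
  have hdy : (fun x : Param q l × Obs k q × Param q l => dsres L x.1 x.2.1 x.2.2) =O[𝓟 S]
      fun x => t x * n x := by
    refine IsBigO.sub (IsBigO.neg_left ?_) ?_
    · refine (isBigO_mulVec hW hVy).trans ?_
      refine (hrt.mul (isBigO_refl n _)).congr_left fun x => by ring
    · simpa using isBigO_mulVec hW hXv
  have hdp : (fun x : Param q l × Obs k q × Param q l => dscoreFactor L v x.1 x.2.1 x.2.2)
      =O[𝓟 S] fun x => dom x.2.1 * n x := by
    have hdom : ∀ x : Param q l × Obs k q × Param q l, dom x.2.1 = t x * t x := fun x => by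
      rw [dom, pow_two]
    simp only [hdom]
    have htn := isBigO_refl (fun x => t x * n x) (𝓟 S)
    refine IsBigO.sub (IsBigO.add ?_ ?_) ?_
    · refine IsBigO.const_mul_left ?_ _
      exact (isBigO_dotProduct hdy hX0).congr_right fun x => by ring
    · refine IsBigO.const_mul_left (IsBigO.add ?_ ?_) _
      · have := isBigO_mulVec hV0 hdy
        refine (isBigO_dotProduct (hy.trans hrt) this).congr_right fun x => by ring
      · refine (isBigO_dotProduct hdy (hV0y.trans hrt)).congr_right fun x => by ring
    · refine IsBigO.const_mul_left (IsBigO.add ?_ ?_) _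
      · refine ((hτ.trans (hrt.mul hrt)).mul (hdφ.mono hSU))
      · refine (hdτ.mul (hφ.mono hSU)).trans ?_
        have := ((isBigO_refl t (𝓟 S)).mul hrt).mul (isBigO_refl n (𝓟 S))
        simpa using this
  exact ⟨hp, hdτ, hdp, hr1, hφ, hdφ⟩

lemma abs_rho_le (hρ : IsRho ρ c₀) : ∀ s, 0 ≤ s → |ρ s| ≤ ρ c₀ := fun s hs => by
  rw [abs_of_nonneg (hρ.nonneg hs)]; exact hρ.le_top hs

lemma exists_bound_weightExt (hρ : IsRho ρ c₀) :
    ∃ C, 0 ≤ C ∧ (∀ s, 0 ≤ s → |weightExt ρ s| ≤ C) ∧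
      ∀ s, 0 ≤ s → |deriv (deriv ρ) s - weightExt ρ s| ≤ C := by
  obtain ⟨C₁, h1, h2⟩ := hρ.exists_bound hρ.continuous_weightExt fun s hs => hρ.weightExt_eq_zero hs
  obtain ⟨C₂, h3, h4⟩ := hρ.exists_bound
    (hρ.continuous_deriv_deriv.sub hρ.continuous_weightExt) fun s hs => by
      rw [Pi.sub_apply, hρ.weightExt_eq_zero hs, hρ.deriv_deriv_eq_zero hs, sub_zero]
  exact ⟨max C₁ C₂, h1.trans (le_max_left _ _), fun s hs => (h2 s hs).trans (le_max_left _ _),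
    fun s hs => (h4 s hs).trans (le_max_right _ _)⟩

/-- Locally uniform domination of the loss, the score and their derivatives. -/
lemma exists_score_bound (hρ : IsRho ρ c₀) (hL : ∀ j, (L j).IsSymm) (b₀ c : ℝ) (v : Param q l)
    {ξ₁ : Param q l} (h : (linCov L ξ₁.2).PosDef) :
    ∃ U ∈ 𝓝 ξ₁, ∃ C, 0 ≤ C ∧ ∀ ξ ∈ U, (linCov L ξ.2).PosDef ∧ ∀ (s : Obs k q) (v' : Param q l),
      |weightExt ρ (√(tau L ξ s)) / 2 * dtau L ξ s v'| ≤ C * dom s * ‖v'‖ ∧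
      |dscore L ρ b₀ c v ξ s v'| ≤ C * dom s * ‖v'‖ ∧
      |score L ρ b₀ c v ξ s| ≤ C * dom s := by
  obtain ⟨U, hU, B, hB⟩ := exists_nhds_bound hL h
  set S := {x : Param q l × Obs k q × Param q l | x.1 ∈ U ∧ tau L x.1 x.2.1 ≤ c₀ ^ 2} with hS
  obtain ⟨hp, hdτ, hdp, hr1, hφ, hdφ⟩ := isBigO_constituents (c₀ := c₀) hB v hS
  obtain ⟨Cw, hCw0, hCw1, hCw2⟩ := exists_bound_weightExt hρ
  have hS1 : 𝓟 S ≤ 𝓟 {x : Param q l × Obs k q × Param q l | x.1 ∈ U} := by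
    rw [principal_mono, hS]; exact fun x hx => hx.1
  have hdom : ∀ x : Param q l × Obs k q × Param q l,
      dom x.2.1 = (1 + asum x.2.1.2) * (1 + asum x.2.1.2) := fun x => by rw [dom, pow_two]
  set t : Param q l × Obs k q × Param q l → ℝ := fun x => 1 + asum x.2.1.2 with ht
  set r : Param q l × Obs k q × Param q l → ℝ := fun x => ‖resid x.2.1 x.1.1‖ with hr
  set n : Param q l × Obs k q × Param q l → ℝ := fun x => ‖x.2.2‖ with hn
  have ht1 : ∀ x, 1 ≤ t x := fun x => le_add_of_nonneg_right (asum_nonneg _)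
  have h1t : (fun _ => (1 : ℝ)) =O[𝓟 S] t := IsBigO.of_bound 1 (Eventually.of_forall fun x => by
    rw [norm_one, one_mul, Real.norm_of_nonneg (by linarith [ht1 x])]; exact ht1 x)
  have hw : (fun x : Param q l × Obs k q × Param q l => weightExt ρ (√(tau L x.1 x.2.1)))
      =O[𝓟 S] fun _ => (1 : ℝ) :=
    IsBigO.of_bound Cw (Eventually.of_forall fun x => by
      simpa using hCw1 _ (Real.sqrt_nonneg _))
  have hρb : (fun x : Param q l × Obs k q × Param q l => ρ (√(tau L x.1 x.2.1)) - b₀)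
      =O[𝓟 {x | x.1 ∈ U}] fun _ => (1 : ℝ) :=
    IsBigO.of_bound (ρ c₀ + |b₀|) (Eventually.of_forall fun x => by
      simpa using (abs_sub _ _).trans (by
        gcongr; exact abs_rho_le hρ _ (Real.sqrt_nonneg _)))
  have hJ : (fun x : Param q l × Obs k q × Param q l =>
      weightExt ρ (√(tau L x.1 x.2.1)) / 2 * dtau L x.1 x.2.1 x.2.2) =O[𝓟 S]
      fun x => dom x.2.1 * n x := by
    have h2 := ((hw.const_mul_left (1 / 2)).mul hdτ)
    have h3 := (((isBigO_refl t (𝓟 S)).mul (hr1.trans h1t)).mul (isBigO_refl n (𝓟 S)))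
    simp only [hdom]
    refine (h2.congr (fun x => by ring) fun x => by ring).trans h3
  -- The quotient is at most a multiple of `1 / r²`, while `scoreFactor` and `dtau` each contribute
  -- a factor `r`.
  have hsing : (fun x : Param q l × Obs k q × Param q l =>
      (deriv (deriv ρ) (√(tau L x.1 x.2.1)) - weightExt ρ (√(tau L x.1 x.2.1))) /
        (2 * tau L x.1 x.2.1) * scoreFactor L v x.1 x.2.1 * dtau L x.1 x.2.1 x.2.2) =O[𝓟 S]
      fun x => dom x.2.1 * n x := by
    have h2 : (fun x : Param q l × Obs k q × Param q l =>
        (deriv (deriv ρ) (√(tau L x.1 x.2.1)) - weightExt ρ (√(tau L x.1 x.2.1))) /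
        (2 * tau L x.1 x.2.1)) =O[𝓟 S] fun x => (r x * r x)⁻¹ := by
      refine isBigO_principal.2 ⟨Cw * B / 2, fun x hx => ?_⟩
      obtain ⟨hx1, hx2⟩ := hx
      obtain ⟨h3, h4, -⟩ := hB x.1 hx1
      -- At a zero residual the quotient has a zero denominator and takes the value zero.
      rcases (tau_nonneg h3 x.2.1).eq_or_lt with h0 | h0
      · rw [← h0]
        simp only [mul_zero, div_zero, norm_zero]
        have : 0 ≤ B := (asum_nonneg _).trans h4
        positivity
      · have h5 := sq_norm_le_asum h3 (resid x.2.1 x.1.1)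
        have hrp : 0 < r x * r x := by
          refine mul_self_pos.2 (norm_ne_zero_iff.2 fun h0' => ?_)
          simp [tau, h0'] at h0
        rw [Real.norm_eq_abs, abs_div, abs_of_pos (by positivity : 0 < 2 * tau L x.1 x.2.1),
          Real.norm_of_nonneg (inv_nonneg.2 hrp.le), div_le_iff₀ (by positivity)]
        refine (hCw2 _ (Real.sqrt_nonneg _)).trans ?_
        have h6 : r x * r x ≤ B * tau L x.1 x.2.1 := by
          rw [← pow_two]
          exact h5.trans (mul_le_mul_of_nonneg_right h4 h0.le)
        have h7 : 1 ≤ B * tau L x.1 x.2.1 * (r x * r x)⁻¹ := by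
          rw [← div_eq_mul_inv, one_le_div hrp]; exact h6
        calc Cw = Cw * 1 := (mul_one _).symm
          _ ≤ Cw * (B * tau L x.1 x.2.1 * (r x * r x)⁻¹) := mul_le_mul_of_nonneg_left h7 hCw0
          _ = _ := by ring
    refine ((h2.mul hp).mul hdτ).trans ?_
    refine isBigO_principal.2 ⟨1, fun x _ => ?_⟩
    simp only [hdom]
    rcases eq_or_ne (r x) 0 with h0 | h0
    · have h0' : ‖resid x.2.1 x.1.1‖ = 0 := h0
      simp only [r, h0', mul_zero, zero_mul, norm_zero]
      positivity
    · rw [one_mul]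
      refine le_of_eq (congrArg _ ?_)
      change (r x * r x)⁻¹ * (t x * r x) * (t x * r x * n x) = t x * t x * n x
      field_simp
  have hmain : (fun x : Param q l × Obs k q × Param q l => dscore L ρ b₀ c v x.1 x.2.1 x.2.2)
      =O[𝓟 S] fun x => dom x.2.1 * n x := by
    refine IsBigO.add (IsBigO.add ?_ hsing) (IsBigO.const_mul_left (IsBigO.add ?_ ?_) c)
    · simpa using hw.mul hdp
    · have h2 := (hρb.mul hdφ).mono hS1
      simp only [hdom]
      have h3 := (h1t.mul h1t).mul h2
      simpa using h3
    · simpa using hJ.mul (hφ.mono hS1)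
  have hsc : (fun x : Param q l × Obs k q × Param q l => score L ρ b₀ c v x.1 x.2.1)
      =O[𝓟 S] fun x => dom x.2.1 := by
    refine IsBigO.add ?_ (IsBigO.const_mul_left ?_ c)
    · have h2 := (hw.mul hp).trans
        ((isBigO_refl _ _).mul ((isBigO_refl t (𝓟 S)).mul (hr1.trans h1t)))
      simpa [hdom] using h2
    · have h2 := (hρb.mul hφ).mono hS1
      simp only [hdom]
      have h3 := (h1t.mul h1t).mul h2
      simpa using h3
  have hsc' : (fun x : Param q l × Obs k q × Param q l =>
      c * ((ρ (√(tau L x.1 x.2.1)) - b₀) * trPrec L v x.1)) =O[𝓟 {x | x.1 ∈ U}]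
      fun _ => (1 : ℝ) := by
    simpa using (hρb.mul hφ).const_mul_left c
  have hdsc' : (fun x : Param q l × Obs k q × Param q l =>
      c * ((ρ (√(tau L x.1 x.2.1)) - b₀) * dtrPrec L v x.1 x.2.2)) =O[𝓟 {x | x.1 ∈ U}] n := by
    simpa using (hρb.mul hdφ).const_mul_left c
  obtain ⟨C₁, hC₁⟩ := isBigO_principal.1 hJ
  obtain ⟨C₂, hC₂⟩ := isBigO_principal.1 hmain
  obtain ⟨C₃, hC₃⟩ := isBigO_principal.1 hsc
  obtain ⟨C₄, hC₄⟩ := isBigO_principal.1 hsc'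
  obtain ⟨C₅, hC₅⟩ := isBigO_principal.1 hdsc'
  refine ⟨U, hU, |C₁| + |C₂| + |C₃| + |C₄| + |C₅|, by positivity, fun ξ hξ =>
    ⟨(hB ξ hξ).1, fun s v' => ?_⟩⟩
  have hd := one_le_dom s
  have hv := norm_nonneg v'
  have key : ∀ {C a w : ℝ}, 0 ≤ w → C ≤ |C₁| + |C₂| + |C₃| + |C₄| + |C₅| → a ≤ C * w →
      a ≤ (|C₁| + |C₂| + |C₃| + |C₄| + |C₅|) * w := fun hw hC ha =>
    ha.trans (mul_le_mul_of_nonneg_right hC hw)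
  have a1 := abs_nonneg C₁
  have a2 := abs_nonneg C₂
  have a3 := abs_nonneg C₃
  have a4 := abs_nonneg C₄
  have a5 := abs_nonneg C₅
  -- Beyond `c₀` the weight and `ρ''` vanish, so only trace terms survive, and these are bounded
  -- whatever the residual is.
  by_cases hτ : tau L ξ s ≤ c₀ ^ 2
  · have hx : (ξ, s, v') ∈ S := ⟨hξ, hτ⟩
    have e1 : ‖dom s * ‖v'‖‖ = dom s * ‖v'‖ := Real.norm_of_nonneg (by positivity)
    have e2 : ‖dom s‖ = dom s := Real.norm_of_nonneg (by positivity)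
    have b1 := hC₁ _ hx
    have b2 := hC₂ _ hx
    have b3 := hC₃ _ hx
    simp only [hn, e1, e2, Real.norm_eq_abs] at b1 b2 b3
    rw [mul_assoc]
    exact ⟨key (by positivity) (by linarith [le_abs_self C₁]) b1,
      key (by positivity) (by linarith [le_abs_self C₂]) b2,
      key (by positivity) (by linarith [le_abs_self C₃]) b3⟩
  · have hs : c₀ ≤ √_ := Real.le_sqrt_of_sq_le (not_le.1 hτ).le
    have w0 := hρ.weightExt_eq_zero hs
    have w1 := hρ.deriv_deriv_eq_zero hs
    have hx : (ξ, s, v') ∈ {x : Param q l × Obs k q × Param q l | x.1 ∈ U} := hξ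
    have b4 := hC₄ _ hx
    have b5 := hC₅ _ hx
    simp only [hn, norm_one, mul_one, Real.norm_eq_abs] at b4 b5
    refine ⟨by rw [w0]; simp only [zero_div, zero_mul, abs_zero]; positivity, ?_, ?_⟩
    · have : dscore L ρ b₀ c v ξ s v' = c * ((ρ (√(tau L ξ s)) - b₀) * dtrPrec L v ξ v') := by
        simp [dscore, w0, w1]
      rw [this, mul_assoc]
      refine key (by positivity) (C := |C₅|) (by linarith) (b5.trans ?_)
      rw [abs_of_nonneg hv]
      calc C₅ * ‖v'‖ ≤ |C₅| * ‖v'‖ := mul_le_mul_of_nonneg_right (le_abs_self _) hv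
        _ ≤ |C₅| * (dom s * ‖v'‖) := by
          refine mul_le_mul_of_nonneg_left ?_ a5
          nlinarith
    · have : score L ρ b₀ c v ξ s = c * ((ρ (√(tau L ξ s)) - b₀) * trPrec L v ξ) := by
        simp [score, w0]
      rw [this]
      refine key (by positivity) (C := |C₄|) (by linarith) (b4.trans ?_)
      exact (le_abs_self C₄).trans (by nlinarith)

end bounds

/-! ### Measurability and differentiation under the integral sign -/

instance matrixBorelSpace (k q : ℕ) : BorelSpace (Matrix (Fin k) (Fin q) ℝ) :=
  inferInstanceAs (BorelSpace (Fin k → Fin q → ℝ))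

instance matrixSecondCountableTopology (k q : ℕ) :
    SecondCountableTopology (Matrix (Fin k) (Fin q) ℝ) :=
  inferInstanceAs (SecondCountableTopology (Fin k → Fin q → ℝ))

/-- Differentiation under the integral sign. -/
lemma HasFD.integral {α E : Type*} [MeasurableSpace α] {μ : Measure α} [NormedAddCommGroup E]
    [NormedSpace ℝ E] [FiniteDimensional ℝ E] {f : E → α → ℝ} {D : E → α → E → ℝ} {x₀ : E}
    {U : Set E} (hU : U ∈ 𝓝 x₀) {bound : α → ℝ}
    (hf : ∀ᶠ x in 𝓝 x₀, AEStronglyMeasurable (f x) μ) (hf_int : Integrable (f x₀) μ)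
    (hD : ∀ v, AEStronglyMeasurable (fun a => D x₀ a v) μ) (hb : Integrable bound μ)
    (hb0 : ∀ a, 0 ≤ bound a)
    (hbound : ∀ x ∈ U, ∀ a v, |D x a v| ≤ bound a * ‖v‖)
    (hd : ∀ x ∈ U, ∀ a, HasFD (fun x => f x a) (D x a) x) :
    HasFD (fun x => ∫ a, f x a ∂μ) (fun v => ∫ a, D x₀ a v ∂μ) x₀ := by
  choose! f' h1 h2 using hd
  have hx₀ := mem_of_mem_nhds hU
  -- In finite dimension the operator-valued derivative is a finite combination of its values on a
  -- basis.
  have hmeas : AEStronglyMeasurable (fun a => f' x₀ a) μ := by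
    let b := Module.finBasis ℝ E
    have : (fun a => f' x₀ a) = fun a =>
        ∑ i, D x₀ a (b i) • LinearMap.toContinuousLinearMap (b.coord i) := by
      ext a v
      conv_lhs => rw [← b.sum_repr v, map_sum]
      simp_rw [← h2 x₀ hx₀]
      simp [mul_comm]
    rw [this]
    exact Finset.aestronglyMeasurable_fun_sum _ fun i _ => (hD (b i)).smul_const _
  have hnorm : ∀ x ∈ U, ∀ a, ‖f' x a‖ ≤ bound a := fun x hx a =>
    ContinuousLinearMap.opNorm_le_bound _ (hb0 a) fun v => by
      rw [h2 x hx a v]; exact hbound x hx a v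
  have hint : Integrable (fun a => f' x₀ a) μ :=
    hb.mono' hmeas (Eventually.of_forall (hnorm x₀ hx₀))
  refine ⟨∫ a, f' x₀ a ∂μ, hasFDerivAt_integral_of_dominated_of_fderiv_le hU hf hf_int hmeas
    (Eventually.of_forall fun a x hx => hnorm x hx a) hb
    (Eventually.of_forall fun a x hx => h1 x hx a), fun v => ?_⟩
  rw [ContinuousLinearMap.integral_apply hint]
  exact integral_congr_ae (Eventually.of_forall fun a => h2 x₀ hx₀ a v)

section continuity

variable {k q l : ℕ} (L : Fin l → Matrix (Fin k) (Fin k) ℝ)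

lemma continuous_resid (β : Fin q → ℝ) : Continuous fun s : Obs k q => resid s β :=
  continuous_fst.sub (continuous_snd.matrix_mulVec continuous_const)

lemma continuous_sres (ξ : Param q l) : Continuous fun s : Obs k q => sres L ξ s :=
  continuous_const.matrix_mulVec (continuous_resid _)

lemma continuous_tau (ξ : Param q l) : Continuous fun s : Obs k q => tau L ξ s :=
  (continuous_resid _).dotProduct (continuous_sres L ξ)

lemma continuous_design (b : Fin q → ℝ) : Continuous fun s : Obs k q => s.2 *ᵥ b :=
  continuous_snd.matrix_mulVec continuous_const

lemma continuous_dtau (ξ v : Param q l) : Continuous fun s : Obs k q => dtau L ξ s v :=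
  (continuous_const.mul ((continuous_sres L ξ).dotProduct (continuous_design _))).sub
    ((continuous_sres L ξ).dotProduct (continuous_const.matrix_mulVec (continuous_sres L ξ)))

lemma continuous_dsres (ξ v : Param q l) : Continuous fun s : Obs k q => dsres L ξ s v :=
  (continuous_const.matrix_mulVec (continuous_const.matrix_mulVec (continuous_sres L ξ))).neg.sub
    (continuous_const.matrix_mulVec (continuous_design _))

lemma continuous_scoreFactor (v ξ : Param q l) :
    Continuous fun s : Obs k q => scoreFactor L v ξ s :=
  ((continuous_const.mul ((continuous_sres L ξ).dotProduct (continuous_design _))).add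
    (continuous_const.mul ((continuous_sres L ξ).dotProduct
      (continuous_const.matrix_mulVec (continuous_sres L ξ))))).sub
    (continuous_const.mul ((continuous_tau L ξ).mul continuous_const))

lemma continuous_dscoreFactor (v ξ v' : Param q l) :
    Continuous fun s : Obs k q => dscoreFactor L v ξ s v' :=
  ((continuous_const.mul ((continuous_dsres L ξ v').dotProduct (continuous_design _))).add
    (continuous_const.mul (((continuous_sres L ξ).dotProduct
      (continuous_const.matrix_mulVec (continuous_dsres L ξ v'))).add
      ((continuous_dsres L ξ v').dotProduct
        (continuous_const.matrix_mulVec (continuous_sres L ξ)))))).sub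
    (continuous_const.mul (((continuous_tau L ξ).mul continuous_const).add
      ((continuous_dtau L ξ v').mul continuous_const)))

variable {ρ : ℝ → ℝ} {c₀ : ℝ}

lemma continuous_rho_tau (hρ : IsRho ρ c₀) (ξ : Param q l) :
    Continuous fun s : Obs k q => ρ (√(tau L ξ s)) :=
  hρ.continuous.comp (continuous_tau L ξ).sqrt

lemma continuous_weight_tau (hρ : IsRho ρ c₀) (ξ : Param q l) :
    Continuous fun s : Obs k q => weightExt ρ (√(tau L ξ s)) :=
  hρ.continuous_weightExt.comp (continuous_tau L ξ).sqrt

lemma continuous_score (hρ : IsRho ρ c₀) (b₀ c : ℝ) (v ξ : Param q l) :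
    Continuous fun s : Obs k q => score L ρ b₀ c v ξ s :=
  ((continuous_weight_tau L hρ ξ).mul (continuous_scoreFactor L v ξ)).add
    (continuous_const.mul (((continuous_rho_tau L hρ ξ).sub continuous_const).mul
      continuous_const))

lemma measurable_dscore (hρ : IsRho ρ c₀) (b₀ c : ℝ) (v ξ v' : Param q l) :
    Measurable fun s : Obs k q => dscore L ρ b₀ c v ξ s v' := by
  have hw := (continuous_weight_tau (q := q) L hρ ξ).measurable
  have hρ2 := (hρ.continuous_deriv_deriv.comp (continuous_tau (q := q) L ξ).sqrt).measurable
  have hτ := (continuous_tau (q := q) L ξ).measurable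
  have hdτ := (continuous_dtau (q := q) L ξ v').measurable
  refine ((hw.mul (continuous_dscoreFactor L v ξ v').measurable).add
    ((((hρ2.sub hw).div (measurable_const.mul hτ)).mul
      (continuous_scoreFactor L v ξ).measurable).mul hdτ)).add
    (measurable_const.mul ((((continuous_rho_tau L hρ ξ).measurable.sub measurable_const).mul
      measurable_const).add (((hw.div measurable_const).mul hdτ).mul measurable_const)))

lemma continuous_dom : Continuous fun s : Obs k q => dom s :=
  (continuous_const.add (continuous_asum.comp continuous_snd)).pow 2

end continuity

section integral

variable {k q l : ℕ} {L : Fin l → Matrix (Fin k) (Fin k) ℝ} {ρ : ℝ → ℝ} {c₀ : ℝ}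
  {Q : Measure (Obs k q)}

lemma integrable_dom [IsFiniteMeasure Q]
    (h : Integrable (fun s : Obs k q => ∑ i, ∑ j, (s.2 i j) ^ 2) Q) :
    Integrable (fun s : Obs k q => dom s) Q := by
  refine Integrable.mono' (((integrable_const (2 : ℝ)).add (h.const_mul (2 * (k * q : ℝ)))))
    (continuous_dom).aestronglyMeasurable (Eventually.of_forall fun s => ?_)
  rw [Real.norm_of_nonneg (zero_le_one.trans (one_le_dom s)), dom]
  have := sq_asum_le s.2
  simp only [Pi.add_apply]
  nlinarith [sq_nonneg (1 - asum s.2)]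

lemma integrable_rho_tau (hρ : IsRho ρ c₀) [IsFiniteMeasure Q] (ξ : Param q l) :
    Integrable (fun s => ρ (√(tau L ξ s))) Q :=
  Integrable.mono' (integrable_const (ρ c₀)) (continuous_rho_tau L hρ ξ).aestronglyMeasurable
    (Eventually.of_forall fun _ => abs_rho_le hρ _ (Real.sqrt_nonneg _))

lemma hasFD_integral_rho (hρ : IsRho ρ c₀) (hL : ∀ j, (L j).IsSymm) [IsFiniteMeasure Q]
    (hQ : Integrable (fun s : Obs k q => dom s) Q) {ξ : Param q l} (h : (linCov L ξ.2).PosDef) :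
    HasFD (fun ξ => ∫ s, ρ (√(tau L ξ s)) ∂Q)
      (fun v => ∫ s, weightExt ρ (√(tau L ξ s)) / 2 * dtau L ξ s v ∂Q) ξ := by
  obtain ⟨U, hU, C, hC, hb⟩ := exists_score_bound hρ hL 0 0 0 h
  refine HasFD.integral hU
    (Eventually.of_forall fun ξ => (continuous_rho_tau L hρ ξ).aestronglyMeasurable)
    (integrable_rho_tau hρ ξ)
    (fun v => (((continuous_weight_tau L hρ ξ).div_const 2).mul
      (continuous_dtau L ξ v)).aestronglyMeasurable)
    (hQ.const_mul C) (fun s => mul_nonneg hC (zero_le_one.trans (one_le_dom s)))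
    (D := fun ξ s v => weightExt ρ (√(tau L ξ s)) / 2 * dtau L ξ s v)
    (fun ξ hξ s v => ((hb ξ hξ).2 s v).1)
    fun ξ hξ s => hasFD_rho hρ hL (hb ξ hξ).1 s

lemma integrable_score (hρ : IsRho ρ c₀) (hL : ∀ j, (L j).IsSymm)
    (hQ : Integrable (fun s : Obs k q => dom s) Q) (b₀ c : ℝ) (v : Param q l) {ξ : Param q l}
    (h : (linCov L ξ.2).PosDef) : Integrable (fun s => score L ρ b₀ c v ξ s) Q := by
  obtain ⟨U, hU, C, hC, hb⟩ := exists_score_bound hρ hL b₀ c v h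
  exact Integrable.mono' (hQ.const_mul C) (continuous_score L hρ b₀ c v ξ).aestronglyMeasurable
    (Eventually.of_forall fun s => ((hb ξ (mem_of_mem_nhds hU)).2 s 0).2.2)

lemma integrable_dscore (hρ : IsRho ρ c₀) (hL : ∀ j, (L j).IsSymm)
    (hQ : Integrable (fun s : Obs k q => dom s) Q) (b₀ c : ℝ) (v v' : Param q l) {ξ : Param q l}
    (h : (linCov L ξ.2).PosDef) : Integrable (fun s => dscore L ρ b₀ c v ξ s v') Q := by
  obtain ⟨U, hU, C, hC, hb⟩ := exists_score_bound hρ hL b₀ c v h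
  exact Integrable.mono' ((hQ.const_mul C).mul_const ‖v'‖)
    (measurable_dscore L hρ b₀ c v ξ v').aestronglyMeasurable
    (Eventually.of_forall fun s => ((hb ξ (mem_of_mem_nhds hU)).2 s v').2.1)

lemma integrable_weight_dtau (hρ : IsRho ρ c₀) (hL : ∀ j, (L j).IsSymm)
    (hQ : Integrable (fun s : Obs k q => dom s) Q) (v : Param q l) {ξ : Param q l}
    (h : (linCov L ξ.2).PosDef) :
    Integrable (fun s => weightExt ρ (√(tau L ξ s)) / 2 * dtau L ξ s v) Q := by
  obtain ⟨U, hU, C, hC, hb⟩ := exists_score_bound hρ hL 0 0 0 h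
  exact Integrable.mono' ((hQ.const_mul C).mul_const ‖v‖)
    (((continuous_weight_tau L hρ ξ).div_const 2).mul
      (continuous_dtau L ξ v)).aestronglyMeasurable
    (Eventually.of_forall fun s => ((hb ξ (mem_of_mem_nhds hU)).2 s v).1)

lemma hasFD_integral_score (hρ : IsRho ρ c₀) (hL : ∀ j, (L j).IsSymm)
    (hQ : Integrable (fun s : Obs k q => dom s) Q) (b₀ c : ℝ) (v : Param q l) {ξ : Param q l}
    (h : (linCov L ξ.2).PosDef) :
    HasFD (fun ξ => ∫ s, score L ρ b₀ c v ξ s ∂Q)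
      (fun v' => ∫ s, dscore L ρ b₀ c v ξ s v' ∂Q) ξ := by
  obtain ⟨U, hU, C, hC, hb⟩ := exists_score_bound hρ hL b₀ c v h
  refine HasFD.integral hU
    (Eventually.of_forall fun ξ => (continuous_score L hρ b₀ c v ξ).aestronglyMeasurable)
    (integrable_score hρ hL hQ b₀ c v h)
    (fun v' => (measurable_dscore L hρ b₀ c v ξ v').aestronglyMeasurable)
    (hQ.const_mul C) (fun s => mul_nonneg hC (zero_le_one.trans (one_le_dom s)))
    (D := fun ξ s v' => dscore L ρ b₀ c v ξ s v')
    (fun ξ hξ s v' => ((hb ξ hξ).2 s v').2.1)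
    fun ξ hξ s => hasFD_score hρ hL b₀ c v (hb ξ hξ).1 s

end integral

/-! ### First-order conditions at an S-solution -/

section scoreEquation

variable {k q l : ℕ} {L : Fin l → Matrix (Fin k) (Fin k) ℝ} {ρ : ℝ → ℝ} {c₀ b₀ : ℝ}
  {Q : Measure (Obs k q)}

/-- If `A` is negative only where `T` is nonnegative, then `A` and `T` are proportional. -/
lemma mul_comm_of_neg_imp_nonneg {E : Type*} [AddCommGroup E] [Module ℝ E] (A T : E →ₗ[ℝ] ℝ)
    (h : ∀ w, A w < 0 → 0 ≤ T w) (u v : E) : A u * T v = A v * T u := by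
  by_cases h0 : ∃ w₀, A w₀ < 0
  · obtain ⟨w₀, hw₀⟩ := h0
    -- A kernel vector moved slightly along `w₀` enters the region `A < 0`; if `T w` were negative,
    -- `T` would still be negative there. Applied to `w` and `-w` this gives `T = 0` on the kernel
    -- of `A`, which contains `A u • v - A v • u`.
    have hker : ∀ w, A w = 0 → 0 ≤ T w := fun w hw => by
      by_contra hneg
      rw [not_le] at hneg
      set ε := -T w / (2 * (|T w₀| + 1)) with hε
      have hε0 : 0 < ε := div_pos (by linarith) (by positivity)
      have h1 : A (w + ε • w₀) < 0 := by
        rw [map_add, map_smul, hw, zero_add, smul_eq_mul]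
        exact mul_neg_of_pos_of_neg hε0 hw₀
      have h2 := h _ h1
      rw [map_add, map_smul, smul_eq_mul] at h2
      have h3 : ε * (2 * (|T w₀| + 1)) = -T w := by rw [hε]; field_simp
      nlinarith [le_abs_self (T w₀), mul_le_mul_of_nonneg_left (le_abs_self (T w₀)) hε0.le]
    have hker' : ∀ w, A w = 0 → T w = 0 := fun w hw => by
      have h1 := hker w hw
      have h2 := hker (-w) (by rw [map_neg, hw, neg_zero])
      rw [map_neg] at h2
      linarith
    have h3 := hker' (A u • v - A v • u) (by simp [mul_comm])
    simp only [map_sub, map_smul, smul_eq_mul] at h3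
    linarith
  · rw [not_exists] at h0
    have hA : ∀ w, A w = 0 := fun w => by
      have h1 := h0 w
      have h2 := h0 (-w)
      rw [map_neg] at h2
      linarith
    simp [hA]

lemma eventually_lt_of_hasDerivAt_neg {f : ℝ → ℝ} {f' : ℝ} (h : HasDerivAt f f' 0) (hf' : f' < 0) :
    ∀ᶠ t in 𝓝[>] 0, f t < f 0 := by
  have h1 := (hasDerivAt_iff_tendsto_slope.1 h).mono_left
    (nhdsWithin_mono 0 (fun t (ht : 0 < t) => ht.ne'))
  filter_upwards [h1.eventually_lt_const hf', self_mem_nhdsWithin] with t ht ht0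
  rw [slope_def_field, sub_zero, div_lt_iff₀ ht0, zero_mul] at ht
  linarith

lemma HasFD.hasDerivAt_line {E : Type*} [NormedAddCommGroup E] [NormedSpace ℝ E] {f D : E → ℝ}
    {x : E} (h : HasFD f D x) (w : E) : HasDerivAt (fun t : ℝ => f (x + t • w)) (D w) 0 := by
  obtain ⟨f', h1, h2⟩ := h
  rw [← h2]
  have h3 : HasDerivAt (fun t : ℝ => x + t • w) w 0 := by
    simpa using ((hasDerivAt_id (0 : ℝ)).smul_const w).const_add x
  have h4 : HasFDerivAt f f' (x + (0 : ℝ) • w) := by simpa using h1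
  exact h4.comp_hasDerivAt 0 h3

/-- Jacobi's formula: after `V` is factored out, the derivative is the linear coefficient of the
polynomial `det (1 + t M)`. -/
lemma hasDerivAt_det_line {V : Matrix (Fin k) (Fin k) ℝ} (hV : IsUnit V.det)
    (H : Matrix (Fin k) (Fin k) ℝ) :
    HasDerivAt (fun t : ℝ => (V + t • H).det) (V.det * (V⁻¹ * H).trace) 0 := by
  have h1 : (fun t : ℝ => (V + t • H).det) = fun t : ℝ => V.det * (1 + t • (V⁻¹ * H)).det := by
    ext t
    rw [← det_mul, Matrix.mul_add, mul_one, mul_smul_comm, ← Matrix.mul_assoc,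
      Matrix.mul_nonsing_inv _ hV, one_mul]
  rw [h1]
  refine HasDerivAt.const_mul _ ?_
  rw [funext fun t : ℝ => Matrix.det_one_add_smul t (V⁻¹ * H)]
  set p := (Matrix.det (1 + (Polynomial.X : Polynomial ℝ) • (V⁻¹ * H).map Polynomial.C)).divX.divX
  have h2 := (((hasDerivAt_id (0 : ℝ)).const_mul (V⁻¹ * H).trace).const_add 1).add
    ((p.hasDerivAt 0).mul ((hasDerivAt_id (0 : ℝ)).pow 2))
  refine h2.congr_deriv ?_
  simp

lemma linCov_posDef_smul {θ : Fin l → ℝ} (h : (linCov L θ).PosDef) {t : ℝ} (ht : 0 < t) :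
    (linCov L (t • θ)).PosDef := by
  rw [linCov_smul]; exact h.smul ht

/-- At an S-solution the constraint is active. -/
lemma IsSSolution.integral_eq (hk : 0 < k) (hρ : IsRho ρ c₀) (hL : ∀ j, (L j).IsSymm)
    [IsFiniteMeasure Q] (hQ : Integrable (fun s : Obs k q => dom s) Q) {ξ : Param q l}
    (h : IsSSolution ρ b₀ L Q ξ) : ∫ s, ρ (√(tau L ξ s)) ∂Q = b₀ := by
  obtain ⟨⟨hpd, hle⟩, hmin⟩ := h
  refine le_antisymm hle (not_lt.1 fun hlt => ?_)
  -- With a slack constraint `θ` could be shrunk by a factor `t < 1` and stay feasible, while the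
  -- determinant drops by the factor `t ^ k`.
  have hcont := (hasFD_integral_rho hρ hL hQ hpd).continuousAt
  have hline : Tendsto (fun t : ℝ => ((ξ.1, t • ξ.2) : Param q l)) (𝓝[<] 1) (𝓝 ξ) := by
    have : Continuous fun t : ℝ => ((ξ.1, t • ξ.2) : Param q l) := by fun_prop
    have h1 := this.tendsto 1
    rw [one_smul] at h1
    exact h1.mono_left nhdsWithin_le_nhds
  have h1 := (hcont.tendsto.comp hline).eventually_lt_const hlt
  have h2 : ∀ᶠ t : ℝ in 𝓝[<] 1, 0 < t := nhdsWithin_le_nhds (Ioi_mem_nhds one_pos)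
  obtain ⟨t, h1, h2, h3⟩ := (h1.and (h2.and self_mem_nhdsWithin)).exists
  have h4 := hmin (ξ.1, t • ξ.2) ⟨linCov_posDef_smul hpd h2, le_of_lt h1⟩
  rw [linCov_smul, det_smul, Fintype.card_fin] at h4
  have h5 : t ^ k < 1 := pow_lt_one₀ h2.le h3 hk.ne'
  nlinarith [hpd.det_pos]

/-- Euler's relation for a function of degree `-1` in the covariance. Together with `trPrec_scale`
it evaluates both linear forms in the scale direction, which eliminates the Lagrange multiplier. -/
lemma dtau_scale {ξ : Param q l} (h : (linCov L ξ.2).PosDef) (s : Obs k q) :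
    dtau L ξ s (0, ξ.2) = -tau L ξ s := by
  have h1 : linCov L ξ.2 *ᵥ sres L ξ s = resid s ξ.1 := by
    rw [sres, prec, mulVec_mulVec, Matrix.mul_nonsing_inv _ (posDef_isUnit_det h), one_mulVec]
  simp [dtau, h1, tau, dotProduct_comm]

lemma trPrec_scale {ξ : Param q l} (h : (linCov L ξ.2).PosDef) :
    trPrec L (0, ξ.2) ξ = k := by
  simp [trPrec, prec, Matrix.nonsing_inv_mul _ (posDef_isUnit_det h)]

/-- The score equations of the S-minimization problem. -/
lemma IsSSolution.integral_score_eq_zero (hk : 0 < k) (hρ : IsRho ρ c₀) (hL : ∀ j, (L j).IsSymm)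
    [IsProbabilityMeasure Q] (hQ : Integrable (fun s : Obs k q => dom s) Q) {ξ : Param q l}
    (h : IsSSolution ρ b₀ L Q ξ) (c : ℝ) (v : Param q l) :
    ∫ s, score L ρ b₀ c v ξ s ∂Q = 0 := by
  have hact := h.integral_eq hk hρ hL hQ
  obtain ⟨⟨hpd, hle⟩, hmin⟩ := h
  have hJ := hasFD_integral_rho hρ hL hQ hpd
  have hJ' := hJ
  obtain ⟨A, -, hA2⟩ := hJ'
  let T : Param q l →ₗ[ℝ] ℝ :=
    { toFun := fun v => trPrec L v ξ
      map_add' := fun a b => by simp [trPrec, linCov_add, Matrix.mul_add]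
      map_smul' := fun a b => by simp [trPrec, linCov_smul] }
  have hT : ∀ v, T v = trPrec L v ξ := fun _ => rfl
  -- A direction lowering both the mean loss and the determinant to first order would lead to a
  -- feasible parameter with smaller determinant.
  have hneg : ∀ w, (A : Param q l →ₗ[ℝ] ℝ) w < 0 → 0 ≤ T w := fun w hw => by
    by_contra hTw
    rw [not_le] at hTw
    rw [ContinuousLinearMap.coe_coe, hA2] at hw
    have h1 := eventually_lt_of_hasDerivAt_neg (hJ.hasDerivAt_line w) hw
    have h2 := eventually_lt_of_hasDerivAt_neg
      (hasDerivAt_det_line (posDef_isUnit_det hpd) (linCov L w.2))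
      (mul_neg_of_pos_of_neg hpd.det_pos hTw)
    have h3 : ∀ᶠ t : ℝ in 𝓝[>] 0, (linCov L (ξ + t • w).2).PosDef := by
      have : Continuous fun t : ℝ => ξ + t • w := by fun_prop
      have h4 := this.tendsto 0
      simp only [zero_smul, add_zero] at h4
      exact (h4.mono_left nhdsWithin_le_nhds).eventually (eventually_posDef hL hpd)
    obtain ⟨t, h1, h2, h3⟩ := (h1.and (h2.and h3)).exists
    have h5 := hmin (ξ + t • w) ⟨h3, (le_of_lt h1).trans (by simp only [zero_smul, add_zero]; exact hle)⟩
    have h6 : linCov L (ξ + t • w).2 = linCov L ξ.2 + t • linCov L w.2 := by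
      rw [Prod.snd_add, Prod.smul_snd, linCov_add, linCov_smul]
    rw [h6] at h5
    simp only [zero_smul, add_zero] at h2
    linarith
  have hprop := mul_comm_of_neg_imp_nonneg _ T hneg (0, ξ.2) v
  rw [ContinuousLinearMap.coe_coe, hA2, hA2, hT, hT, trPrec_scale hpd] at hprop
  -- The first two terms integrate to zero together by proportionality of the two linear forms, the
  -- third by the active constraint; hence `c` is free.
  have hsplit : ∀ s, score L ρ b₀ c v ξ s =
      -k * (weightExt ρ (√(tau L ξ s)) / 2 * dtau L ξ s v) +
      trPrec L v ξ * (weightExt ρ (√(tau L ξ s)) / 2 * dtau L ξ s (0, ξ.2)) +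
      (c * trPrec L v ξ) * (ρ (√(tau L ξ s)) - b₀) := fun s => by
    rw [dtau_scale hpd, score, scoreFactor, dtau]; ring
  have i1 := integrable_weight_dtau hρ hL hQ v hpd
  have i2 := integrable_weight_dtau hρ hL hQ (0, ξ.2) hpd
  have i3 : Integrable (fun s => ρ (√(tau L ξ s)) - b₀) Q :=
    (integrable_rho_tau hρ ξ).sub (integrable_const _)
  have i12 : Integrable (fun s => -k * (weightExt ρ (√(tau L ξ s)) / 2 * dtau L ξ s v) +
      trPrec L v ξ * (weightExt ρ (√(tau L ξ s)) / 2 * dtau L ξ s (0, ξ.2))) Q :=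
    (i1.const_mul _).add (i2.const_mul _)
  simp_rw [hsplit]
  rw [integral_add i12 (i3.const_mul _),
    integral_add (i1.const_mul _) (i2.const_mul _), integral_const_mul, integral_const_mul,
    integral_const_mul, integral_sub (integrable_rho_tau hρ ξ) (integrable_const _), hact]
  simp only [integral_const, probReal_univ, one_smul, sub_self, mul_zero, add_zero] at hprop ⊢
  linarith

end scoreEquation

/-! ### Moments of spherically invariant measures -/

/-- `f` is integrable with integral `a`. -/
def HasInt {α : Type*} [MeasurableSpace α] (μ : Measure α) (f : α → ℝ) (a : ℝ) : Prop :=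
  Integrable f μ ∧ ∫ x, f x ∂μ = a

namespace HasInt

variable {α : Type*} [MeasurableSpace α] {μ : Measure α} {f g : α → ℝ} {a b : ℝ}

lemma of_integrable (h : Integrable f μ) : HasInt μ f (∫ x, f x ∂μ) := ⟨h, rfl⟩

lemma add (hf : HasInt μ f a) (hg : HasInt μ g b) : HasInt μ (fun x => f x + g x) (a + b) :=
  ⟨hf.1.add hg.1, by rw [integral_add hf.1 hg.1, hf.2, hg.2]⟩

lemma sub (hf : HasInt μ f a) (hg : HasInt μ g b) : HasInt μ (fun x => f x - g x) (a - b) :=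
  ⟨hf.1.sub hg.1, by rw [integral_sub hf.1 hg.1, hf.2, hg.2]⟩

lemma const_mul (hf : HasInt μ f a) (c : ℝ) : HasInt μ (fun x => c * f x) (c * a) :=
  ⟨hf.1.const_mul c, by rw [integral_const_mul, hf.2]⟩

lemma congr (hf : HasInt μ f a) (h : ∀ x, f x = g x) (hab : a = b) : HasInt μ g b := by
  rw [← hab, ← funext h]; exact hf

lemma sum {ι : Type*} [Fintype ι] {f : ι → α → ℝ} {a : ι → ℝ} (h : ∀ i, HasInt μ (f i) (a i)) :
    HasInt μ (fun x => ∑ i, f i x) (∑ i, a i) :=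
  ⟨integrable_finsetSum _ fun i _ => (h i).1, by
    rw [integral_finsetSum _ fun i _ => (h i).1]
    exact Finset.sum_congr rfl fun i _ => (h i).2⟩

end HasInt

section spherical

variable {k : ℕ}

/-- Invariance of a measure under all linear isometric involutions. -/
def SphInv (ν : Measure (Fin k → ℝ)) : Prop :=
  ∀ T : (Fin k → ℝ) →ₗ[ℝ] (Fin k → ℝ), (∀ z, T (T z) = z) → (∀ z, T z ⬝ᵥ T z = z ⬝ᵥ z) →
    MeasurePreserving T ν ν

/-- The reflection in the hyperplane orthogonal to `v`. -/
def reflect (v : Fin k → ℝ) : (Fin k → ℝ) →ₗ[ℝ] (Fin k → ℝ) where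
  toFun z := z - (2 * (v ⬝ᵥ z) / (v ⬝ᵥ v)) • v
  map_add' a b := by
    ext i
    simp only [dotProduct_add, Pi.sub_apply, Pi.add_apply, Pi.smul_apply, smul_eq_mul]
    ring
  map_smul' c a := by
    ext i
    simp only [dotProduct_smul, Pi.sub_apply, Pi.smul_apply, smul_eq_mul, RingHom.id_apply]
    ring

lemma reflect_apply (v z : Fin k → ℝ) : reflect v z = z - (2 * (v ⬝ᵥ z) / (v ⬝ᵥ v)) • v := rfl

lemma reflect_reflect {v : Fin k → ℝ} (hv : v ⬝ᵥ v ≠ 0) (z : Fin k → ℝ) :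
    reflect v (reflect v z) = z := by
  ext i
  simp only [reflect_apply, dotProduct_sub, dotProduct_smul, Pi.sub_apply, Pi.smul_apply,
    smul_eq_mul]
  field_simp
  ring

lemma reflect_dotProduct {v : Fin k → ℝ} (hv : v ⬝ᵥ v ≠ 0) (z : Fin k → ℝ) :
    reflect v z ⬝ᵥ reflect v z = z ⬝ᵥ z := by
  simp only [reflect_apply, dotProduct_sub, sub_dotProduct, dotProduct_smul, smul_dotProduct,
    smul_eq_mul, dotProduct_comm z v]
  field_simp
  ring

lemma SphInv.reflect {ν : Measure (Fin k → ℝ)} (h : SphInv ν) {v : Fin k → ℝ} (hv : v ⬝ᵥ v ≠ 0) :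
    MeasurePreserving (reflect v) ν ν :=
  h _ (reflect_reflect hv) (reflect_dotProduct hv)

lemma SphInv.integral_comp {ν : Measure (Fin k → ℝ)} (h : SphInv ν)
    {T : (Fin k → ℝ) →ₗ[ℝ] (Fin k → ℝ)} (h1 : ∀ z, T (T z) = z)
    (h2 : ∀ z, T z ⬝ᵥ T z = z ⬝ᵥ z) (F : (Fin k → ℝ) → ℝ) :
    ∫ z, F (T z) ∂ν = ∫ z, F z ∂ν :=
  (h T h1 h2).integral_comp ((LinearMap.continuous_on_pi T).measurableEmbedding
    (Function.LeftInverse.injective h1)) F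

lemma SphInv.integral_radial {ν : Measure (Fin k → ℝ)} (h : SphInv ν)
    {T : (Fin k → ℝ) →ₗ[ℝ] (Fin k → ℝ)} (h1 : ∀ z, T (T z) = z)
    (h2 : ∀ z, T z ⬝ᵥ T z = z ⬝ᵥ z) (f : ℝ → ℝ) (F : (Fin k → ℝ) → ℝ) :
    ∫ z, f (√(z ⬝ᵥ z)) * F (T z) ∂ν = ∫ z, f (√(z ⬝ᵥ z)) * F z ∂ν := by
  rw [← h.integral_comp h1 h2 fun z => f (√(z ⬝ᵥ z)) * F z]
  simp only [h2]

/-- An integrand that is odd in one coordinate integrates to zero. -/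
lemma SphInv.integral_odd {ν : Measure (Fin k → ℝ)} (h : SphInv ν) (f : ℝ → ℝ)
    (F : (Fin k → ℝ) → ℝ) (i : Fin k)
    (hF : ∀ z, F (fun a => if a = i then -z a else z a) = -F z) :
    ∫ z, f (√(z ⬝ᵥ z)) * F z ∂ν = 0 := by
  have hi : (Pi.single i 1 : Fin k → ℝ) ⬝ᵥ Pi.single i 1 ≠ 0 := by simp
  have h1 := h.integral_radial (reflect_reflect hi) (reflect_dotProduct hi) f F
  have h2 : ∀ z : Fin k → ℝ, SEst.reflect (Pi.single i 1) z =
      fun a => if a = i then -z a else z a := fun z => by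
    ext a
    simp only [reflect_apply, single_one_dotProduct, Pi.single_eq_same, Pi.sub_apply,
      Pi.smul_apply, smul_eq_mul, Pi.single_apply]
    split_ifs with ha
    · rw [ha]; ring
    · ring
  simp only [h2, hF, mul_neg, integral_neg] at h1
  linarith

/-- The reflection in the hyperplane orthogonal to `eᵢ - eⱼ` exchanges the two coordinates. -/
lemma SphInv.integral_swap {ν : Measure (Fin k → ℝ)} (h : SphInv ν) (f : ℝ → ℝ) (F : ℝ → ℝ)
    (i j : Fin k) :
    ∫ z, f (√(z ⬝ᵥ z)) * F (z i) ∂ν = ∫ z, f (√(z ⬝ᵥ z)) * F (z j) ∂ν := by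
  rcases eq_or_ne i j with rfl | hij
  · rfl
  set v : Fin k → ℝ := Pi.single i 1 - Pi.single j 1 with hv
  have hvi : v i = 1 := by simp [hv, hij]
  have hvz : ∀ z : Fin k → ℝ, v ⬝ᵥ z = z i - z j := fun z => by simp [hv, sub_dotProduct]
  have hvv : v ⬝ᵥ v = 2 := by rw [hvz, hvi]; simp [hv, hij.symm]; norm_num
  have hvv0 : v ⬝ᵥ v ≠ 0 := by rw [hvv]; norm_num
  have h1 := h.integral_radial (reflect_reflect hvv0) (reflect_dotProduct hvv0) f fun z => F (z i)
  have h2 : ∀ z : Fin k → ℝ, SEst.reflect v z i = z j := fun z => by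
    rw [reflect_apply, Pi.sub_apply, Pi.smul_apply, hvv, hvz, hvi, smul_eq_mul]; ring
  rw [← h1]
  simp only [h2]

lemma abs_mul_apply_le (z : Fin k → ℝ) (a b : Fin k) : |z a * z b| ≤ z ⬝ᵥ z := by
  have hx : ∀ i, z i ^ 2 ≤ z ⬝ᵥ z := fun i => by
    have := Finset.single_le_sum (f := fun i => z i * z i) (fun i _ => mul_self_nonneg (z i))
      (Finset.mem_univ i)
    rw [pow_two]; exact this
  rw [abs_mul]
  nlinarith [hx a, hx b, sq_abs (z a), sq_abs (z b), sq_nonneg (|z a| - |z b|)]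

lemma measurable_radial {f : ℝ → ℝ} (hf : Measurable f) :
    Measurable fun z : Fin k → ℝ => f (√(z ⬝ᵥ z)) :=
  hf.comp (continuous_id.dotProduct continuous_id).sqrt.measurable

lemma integrable_radial_mul_mul {ν : Measure (Fin k → ℝ)} {f : ℝ → ℝ} (hf : Measurable f)
    (hint : Integrable (fun z => f (√(z ⬝ᵥ z)) * (z ⬝ᵥ z)) ν) (a b : Fin k) :
    Integrable (fun z => f (√(z ⬝ᵥ z)) * (z a * z b)) ν := by
  refine hint.mono ((measurable_radial hf).mul ((measurable_pi_apply a).mul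
    (measurable_pi_apply b))).aestronglyMeasurable (Eventually.of_forall fun z => ?_)
  rw [Real.norm_eq_abs, Real.norm_eq_abs, abs_mul, abs_mul (f _)]
  exact mul_le_mul_of_nonneg_left ((abs_mul_apply_le z a b).trans (le_abs_self _)) (abs_nonneg _)

lemma integrable_radial_mul_mul_mul_mul {ν : Measure (Fin k → ℝ)} {f : ℝ → ℝ} (hf : Measurable f)
    (hint : Integrable (fun z => f (√(z ⬝ᵥ z)) * (z ⬝ᵥ z) ^ 2) ν) (a b c d : Fin k) :
    Integrable (fun z => f (√(z ⬝ᵥ z)) * (z a * z b * (z c * z d))) ν := by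
  refine hint.mono ((measurable_radial hf).mul (((measurable_pi_apply a).mul
    (measurable_pi_apply b)).mul ((measurable_pi_apply c).mul
    (measurable_pi_apply d)))).aestronglyMeasurable (Eventually.of_forall fun z => ?_)
  rw [Real.norm_eq_abs, Real.norm_eq_abs, abs_mul, abs_mul (f _)]
  refine mul_le_mul_of_nonneg_left ?_ (abs_nonneg _)
  rw [abs_mul, abs_pow, pow_two]
  exact mul_le_mul ((abs_mul_apply_le z a b).trans (le_abs_self _))
    ((abs_mul_apply_le z c d).trans (le_abs_self _)) (abs_nonneg _) (abs_nonneg _)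

lemma dotProduct_mulVec_eq_sum (K : Matrix (Fin k) (Fin k) ℝ) (z : Fin k → ℝ) :
    z ⬝ᵥ (K *ᵥ z) = ∑ a, ∑ b, K a b * (z a * z b) := by
  simp only [dotProduct, mulVec, Finset.mul_sum]
  exact Finset.sum_congr rfl fun a _ => Finset.sum_congr rfl fun b _ => by ring

/-- Second moments of a spherical distribution. -/
lemma SphInv.integral_quadForm {ν : Measure (Fin k → ℝ)} (h : SphInv ν) (hk : 0 < k) {f : ℝ → ℝ}
    (hf : Measurable f) (hint : Integrable (fun z => f (√(z ⬝ᵥ z)) * (z ⬝ᵥ z)) ν)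
    (K : Matrix (Fin k) (Fin k) ℝ) :
    ∫ z, f (√(z ⬝ᵥ z)) * (z ⬝ᵥ (K *ᵥ z)) ∂ν =
      K.trace / k * ∫ z, f (√(z ⬝ᵥ z)) * (z ⬝ᵥ z) ∂ν := by
  have key : ∀ K : Matrix (Fin k) (Fin k) ℝ, ∫ z, f (√(z ⬝ᵥ z)) * (z ⬝ᵥ (K *ᵥ z)) ∂ν =
      K.trace * ∫ z, f (√(z ⬝ᵥ z)) * (z ⟨0, hk⟩ * z ⟨0, hk⟩) ∂ν := fun K => by
    simp only [dotProduct_mulVec_eq_sum, Finset.mul_sum]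
    have hI : ∀ a b, Integrable (fun z => f (√(z ⬝ᵥ z)) * (K a b * (z a * z b))) ν := fun a b =>
      ((integrable_radial_mul_mul hf hint a b).const_mul (K a b)).congr
        (Eventually.of_forall fun z => by ring)
    rw [integral_finsetSum _ fun a _ => integrable_finsetSum _ fun b _ => hI a b, Matrix.trace,
      Finset.sum_mul]
    refine Finset.sum_congr rfl fun a _ => ?_
    rw [integral_finsetSum _ fun b _ => hI a b, Finset.sum_eq_single a]
    · rw [Matrix.diag_apply, ← h.integral_swap f (fun t => t * t) a ⟨0, hk⟩, ← integral_const_mul]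
      exact integral_congr_ae (Eventually.of_forall fun z => by ring)
    · intro b _ hb
      refine h.integral_odd f (fun z => K a b * (z a * z b)) a fun z => ?_
      simp [hb]
    · simp
  -- The identity matrix expresses the second moment of one coordinate as `1 / k` of the radial
  -- moment.
  have h1 := key 1
  simp only [one_mulVec, Matrix.trace_one, Fintype.card_fin] at h1
  rw [key K, h1]
  have : (k : ℝ) ≠ 0 := by exact_mod_cast hk.ne'
  field_simp

/-- Reflection along `eᵢ - 2 eⱼ` sends `zᵢ` to `(3 zᵢ + 4 zⱼ) / 5`. Expanding the fourth power,
dropping the odd terms and using exchangeability leaves `288 E[zᵢ⁴] = 864 E[zᵢ² zⱼ²]`, all weighted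
by `f`. -/
lemma SphInv.integral_fourth_eq {ν : Measure (Fin k → ℝ)} (h : SphInv ν) {f : ℝ → ℝ}
    (hf : Measurable f) (hint : Integrable (fun z => f (√(z ⬝ᵥ z)) * (z ⬝ᵥ z) ^ 2) ν)
    {i j : Fin k} (hij : i ≠ j) :
    ∫ z, f (√(z ⬝ᵥ z)) * (z i * z i * (z i * z i)) ∂ν =
      3 * ∫ z, f (√(z ⬝ᵥ z)) * (z i * z i * (z j * z j)) ∂ν := by
  set v : Fin k → ℝ := Pi.single i 1 - (2 : ℝ) • Pi.single j 1 with hv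
  have hvi : v i = 1 := by simp [hv, hij]
  have hvz : ∀ z : Fin k → ℝ, v ⬝ᵥ z = z i - 2 * z j := fun z => by simp [hv, sub_dotProduct]
  have hvv : v ⬝ᵥ v = 5 := by rw [hvz, hvi]; simp [hv, hij.symm]; norm_num
  have hvv0 : v ⬝ᵥ v ≠ 0 := by rw [hvv]; norm_num
  have h1 := h.integral_radial (reflect_reflect hvv0) (reflect_dotProduct hvv0) f
    fun z => z i * z i * (z i * z i)
  have h2 : ∀ z : Fin k → ℝ, SEst.reflect v z i = (3 * z i + 4 * z j) / 5 := fun z => by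
    rw [reflect_apply, Pi.sub_apply, Pi.smul_apply, hvv, hvz, hvi, smul_eq_mul]; ring
  simp only [h2] at h1
  have I := integrable_radial_mul_mul_mul_mul hf hint
  have e : ∀ z : Fin k → ℝ, f (√(z ⬝ᵥ z)) * ((3 * z i + 4 * z j) / 5 * ((3 * z i + 4 * z j) / 5) *
      ((3 * z i + 4 * z j) / 5 * ((3 * z i + 4 * z j) / 5))) =
      81 / 625 * (f (√(z ⬝ᵥ z)) * (z i * z i * (z i * z i))) +
      432 / 625 * (f (√(z ⬝ᵥ z)) * (z i * z i * (z i * z j))) +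
      864 / 625 * (f (√(z ⬝ᵥ z)) * (z i * z i * (z j * z j))) +
      768 / 625 * (f (√(z ⬝ᵥ z)) * (z i * z j * (z j * z j))) +
      256 / 625 * (f (√(z ⬝ᵥ z)) * (z j * z j * (z j * z j))) := fun z => by ring
  have J := fun a b c d => HasInt.of_integrable (I a b c d)
  have h3 := ((((((J i i i i).const_mul (81 / 625)).add ((J i i i j).const_mul (432 / 625))).add
    ((J i i j j).const_mul (864 / 625))).add ((J i j j j).const_mul (768 / 625))).add
    ((J j j j j).const_mul (256 / 625))).2
  simp only [e, h3] at h1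
  have z1 : ∫ z, f (√(z ⬝ᵥ z)) * (z i * z i * (z i * z j)) ∂ν = 0 :=
    h.integral_odd f (fun z => z i * z i * (z i * z j)) j fun z => by simp [hij]
  have z2 : ∫ z, f (√(z ⬝ᵥ z)) * (z i * z j * (z j * z j)) ∂ν = 0 :=
    h.integral_odd f (fun z => z i * z j * (z j * z j)) i fun z => by simp [hij.symm]
  have z3 := h.integral_swap f (fun t => t * t * (t * t)) j i
  rw [z1, z2, z3] at h1
  linarith

/-- The sum over the three pairings of the indices, as for Gaussian variables: an index of odd
multiplicity gives zero, and a pure fourth moment is three times a mixed one. -/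
lemma SphInv.integral_fourth {ν : Measure (Fin k → ℝ)} (h : SphInv ν) (hk : 0 < k) {f : ℝ → ℝ}
    (hf : Measurable f) (hint : Integrable (fun z => f (√(z ⬝ᵥ z)) * (z ⬝ᵥ z) ^ 2) ν)
    (a b c d : Fin k) :
    ∫ z, f (√(z ⬝ᵥ z)) * (z a * z b * (z c * z d)) ∂ν =
      ((if a = b then if c = d then 1 else 0 else 0) +
        (if a = c then if b = d then 1 else 0 else 0) +
        (if a = d then if b = c then 1 else 0 else 0)) *
      ((∫ z, f (√(z ⬝ᵥ z)) * (z ⟨0, hk⟩ * z ⟨0, hk⟩ * (z ⟨0, hk⟩ * z ⟨0, hk⟩)) ∂ν) / 3) := by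
  set μ := ∫ z, f (√(z ⬝ᵥ z)) * (z ⟨0, hk⟩ * z ⟨0, hk⟩ * (z ⟨0, hk⟩ * z ⟨0, hk⟩)) ∂ν with hμ
  have h4 : ∀ i, ∫ z, f (√(z ⬝ᵥ z)) * (z i * z i * (z i * z i)) ∂ν = μ := fun i =>
    h.integral_swap f (fun t => t * t * (t * t)) i ⟨0, hk⟩
  have h22 : ∀ i j, i ≠ j → ∫ z, f (√(z ⬝ᵥ z)) * (z i * z i * (z j * z j)) ∂ν = μ / 3 :=
    fun i j hij => by
      rw [← h4 i, h.integral_fourth_eq hf hint hij]; ring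
  by_cases hab : a = b
  · subst hab
    by_cases hcd : c = d
    · subst hcd
      by_cases hac : a = c
      · subst hac
        rw [h4]; simp; ring
      · rw [h22 a c hac]; simp [hac]
    · by_cases hac : c = a
      · subst hac
        rw [h.integral_odd f (fun z => z c * z c * (z c * z d)) d fun z => by simp [hcd]]
        simp [hcd]
      · rw [h.integral_odd f (fun z => z a * z a * (z c * z d)) c fun z => by
          simp [Ne.symm hcd, Ne.symm hac]]
        simp [hcd, Ne.symm hac]
  · by_cases hac : a = c
    · subst hac
      by_cases hbd : b = d
      · subst hbd
        have : ∀ z : Fin k → ℝ, f (√(z ⬝ᵥ z)) * (z a * z b * (z a * z b)) =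
          f (√(z ⬝ᵥ z)) * (z a * z a * (z b * z b)) := fun z => by ring
        simp only [this]
        rw [h22 a b hab]; simp [hab]
      · rw [h.integral_odd f (fun z => z a * z b * (z a * z d)) b fun z => by
          simp [hab, Ne.symm hbd]]
        simp [hab, hbd, Ne.symm hab]
    · by_cases had : a = d
      · subst had
        by_cases hbc : b = c
        · subst hbc
          have : ∀ z : Fin k → ℝ, f (√(z ⬝ᵥ z)) * (z a * z b * (z b * z a)) =
            f (√(z ⬝ᵥ z)) * (z a * z a * (z b * z b)) := fun z => by ring
          simp only [this]
          rw [h22 a b hab]; simp [hab]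
        · rw [h.integral_odd f (fun z => z a * z b * (z c * z a)) b fun z => by
            simp [hab, Ne.symm hbc]]
          simp [hab, hac, hbc]
      · rw [h.integral_odd f (fun z => z a * z b * (z c * z d)) a fun z => by
          simp [Ne.symm hab, Ne.symm hac, Ne.symm had]]
        simp [hab, hac, had]

/-- Fourth moments of a spherical distribution. -/
lemma SphInv.integral_quadForm_mul {ν : Measure (Fin k → ℝ)} (h : SphInv ν) (hk : 0 < k)
    {f : ℝ → ℝ} (hf : Measurable f)
    (hint : Integrable (fun z => f (√(z ⬝ᵥ z)) * (z ⬝ᵥ z) ^ 2) ν)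
    (K K' : Matrix (Fin k) (Fin k) ℝ) (hK' : K'.IsSymm) :
    ∫ z, f (√(z ⬝ᵥ z)) * ((z ⬝ᵥ (K *ᵥ z)) * (z ⬝ᵥ (K' *ᵥ z))) ∂ν =
      (2 * (K * K').trace + K.trace * K'.trace) / (k * (k + 2)) *
        ∫ z, f (√(z ⬝ᵥ z)) * (z ⬝ᵥ z) ^ 2 ∂ν := by
  have key : ∀ K K' : Matrix (Fin k) (Fin k) ℝ, K'.IsSymm →
      ∫ z, f (√(z ⬝ᵥ z)) * ((z ⬝ᵥ (K *ᵥ z)) * (z ⬝ᵥ (K' *ᵥ z))) ∂ν =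
      (2 * (K * K').trace + K.trace * K'.trace) * ((∫ z, f (√(z ⬝ᵥ z)) *
        (z ⟨0, hk⟩ * z ⟨0, hk⟩ * (z ⟨0, hk⟩ * z ⟨0, hk⟩)) ∂ν) / 3) := fun K K' hK' => by
    have e : ∀ z : Fin k → ℝ, f (√(z ⬝ᵥ z)) * ((z ⬝ᵥ (K *ᵥ z)) * (z ⬝ᵥ (K' *ᵥ z))) =
        ∑ a, ∑ b, ∑ c, ∑ d, (K a b * K' c d) *
          (f (√(z ⬝ᵥ z)) * (z a * z b * (z c * z d))) := fun z => by
      rw [dotProduct_mulVec_eq_sum, dotProduct_mulVec_eq_sum, Finset.sum_mul, Finset.mul_sum]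
      refine Finset.sum_congr rfl fun a _ => ?_
      rw [Finset.sum_mul, Finset.mul_sum]
      refine Finset.sum_congr rfl fun b _ => ?_
      rw [Finset.mul_sum, Finset.mul_sum]
      refine Finset.sum_congr rfl fun c _ => ?_
      rw [Finset.mul_sum, Finset.mul_sum]
      exact Finset.sum_congr rfl fun d _ => by ring
    simp only [e]
    have J := (HasInt.sum fun a => HasInt.sum fun b => HasInt.sum fun c => HasInt.sum fun d =>
      HasInt.const_mul ⟨integrable_radial_mul_mul_mul_mul hf hint a b c d,
        h.integral_fourth hk hf hint a b c d⟩ (K a b * K' c d))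
    rw [J.2]
    simp only [← mul_assoc, ← Finset.sum_mul]
    congr 1
    simp only [mul_add, Finset.sum_add_distrib, mul_ite, mul_one, mul_zero, Finset.sum_ite_eq,
      Finset.mem_univ, if_true, Finset.sum_ite_irrel, Finset.sum_const_zero]
    have e1 : ∑ a, ∑ c, K a a * K' c c = K.trace * K'.trace := by
      simp only [Matrix.trace, Matrix.diag_apply, Finset.sum_mul_sum]
    have e2 : ∑ a, ∑ b, K a b * K' b a = (K * K').trace := by
      simp only [Matrix.trace, Matrix.diag_apply, Matrix.mul_apply]
    have e3 : ∑ a, ∑ b, K a b * K' a b = (K * K').trace := by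
      rw [← e2]
      exact Finset.sum_congr rfl fun a _ => Finset.sum_congr rfl fun b _ => by rw [hK'.apply]
    rw [e1, e2, e3]
    ring
  -- With both matrices equal to the identity the trace factor is `2k + k²`, which fixes the
  -- constant.
  have h1 := key 1 1 (Matrix.isSymm_one)
  rw [show (1 : Matrix (Fin k) (Fin k) ℝ) * 1 = 1 from Matrix.mul_one _] at h1
  simp only [one_mulVec, Matrix.trace_one, Fintype.card_fin, ← pow_two] at h1
  rw [key K K' hK']
  simp only [pow_two] at h1 ⊢
  rw [h1]
  have : (k : ℝ) ≠ 0 := by exact_mod_cast hk.ne'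
  field_simp
  ring

end spherical

/-! ### The law of the standardized residual -/

section law

variable {k q : ℕ} {g : ℝ → ℝ}

/-- The spherical distribution with density `g(zᵀz)`. -/
def radial (k : ℕ) (g : ℝ → ℝ) : Measure (Fin k → ℝ) :=
  volume.withDensity fun z => ENNReal.ofReal (g (z ⬝ᵥ z))

lemma measurable_radial_density (hg : Measurable g) :
    Measurable fun z : Fin k → ℝ => ENNReal.ofReal (g (z ⬝ᵥ z)) :=
  (hg.comp (continuous_id.dotProduct continuous_id).measurable).ennreal_ofReal

lemma radial_absolutelyContinuous : radial k g ≪ volume := withDensity_absolutelyContinuous _ _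

/-- An involution has determinant `1` or `-1`. -/
lemma involution_measurePreserving_volume {T : (Fin k → ℝ) →ₗ[ℝ] (Fin k → ℝ)}
    (h1 : ∀ z, T (T z) = z) : MeasurePreserving T volume volume := by
  have hdet : LinearMap.det T * LinearMap.det T = 1 := by
    rw [← LinearMap.det_comp, show T ∘ₗ T = LinearMap.id from LinearMap.ext h1, LinearMap.det_id]
  have h0 : LinearMap.det T ≠ 0 := fun h => by simp [h] at hdet
  refine ⟨(LinearMap.continuous_on_pi T).measurable, ?_⟩
  rw [Real.map_linearMap_volume_pi_eq_smul_volume_pi h0]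
  have : |(LinearMap.det T)⁻¹| = 1 := by
    rcases mul_self_eq_one_iff.1 hdet with h | h <;> simp [h]
  simp [this]

lemma sphInv_radial (hg : Measurable g) : SphInv (radial k g) := by
  intro T h1 h2
  have hT := involution_measurePreserving_volume h1
  refine ⟨hT.measurable, Measure.ext fun A hA => ?_⟩
  rw [Measure.map_apply hT.measurable hA, radial, withDensity_apply _ (hT.measurable hA),
    withDensity_apply _ hA, ← hT.setLIntegral_comp_preimage hA (measurable_radial_density hg)]
  simp only [h2]

lemma exists_transpose_mul_self {W : Matrix (Fin k) (Fin k) ℝ} (hW : W.PosDef) :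
    ∃ N : Matrix (Fin k) (Fin k) ℝ, W = Nᵀ * N ∧ N.det ≠ 0 := by
  open scoped MatrixOrder in
  obtain ⟨N, hN⟩ := CStarAlgebra.nonneg_iff_eq_star_mul_self.mp hW.posSemidef.nonneg
  rw [star_eq_conjTranspose, conjTranspose_eq_transpose_of_trivial] at hN
  refine ⟨N, hN, fun h0 => hW.det_pos.ne' ?_⟩
  rw [hN, det_mul, h0, mul_zero]

lemma measurable_ellDensity (hg : Measurable g) (β : Fin q → ℝ) (S : Matrix (Fin k) (Fin k) ℝ) :
    Measurable fun s : Obs k q => ENNReal.ofReal (ellDensity g (s.2 *ᵥ β) S s.1) := by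
  have h : Continuous fun s : Obs k q => resid s β ⬝ᵥ (S⁻¹ *ᵥ resid s β) :=
    (continuous_resid β).dotProduct (continuous_const.matrix_mulVec (continuous_resid β))
  exact (measurable_const.mul (hg.comp h.measurable)).ennreal_ofReal

lemma lintegral_comp_affine {N : Matrix (Fin k) (Fin k) ℝ} (hN : N.det ≠ 0) (m : Fin k → ℝ)
    {H : (Fin k → ℝ) → ENNReal} (hH : Measurable H) :
    ∫⁻ y, H (N *ᵥ (y - m)) = ENNReal.ofReal |N.det⁻¹| * ∫⁻ z, H z := by
  have hm : Measurable (Matrix.toLin' N) := (LinearMap.continuous_on_pi _).measurable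
  rw [lintegral_sub_right_eq_self (fun y => H (N *ᵥ y)) m]
  have h1 := lintegral_map (μ := (volume : Measure (Fin k → ℝ))) hH hm
  rw [Real.map_matrix_volume_pi_eq_smul_volume_pi hN, lintegral_smul_measure, smul_eq_mul] at h1
  simpa using h1.symm

/-- Under an elliptical model the standardized residual is spherical and independent of `X`. -/
lemma map_standardized (hg : Measurable g) {β : Fin q → ℝ} {S N : Matrix (Fin k) (Fin k) ℝ}
    (hN : S⁻¹ = Nᵀ * N) (hN0 : N.det ≠ 0)
    {P : Measure (Obs k q)} [IsProbabilityMeasure P] (hP : IsEllipticalGivenX g β S P) :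
    P.map (fun s => (N *ᵥ resid s β, s.2)) = (radial k g).prod (P.map Prod.snd) := by
  have hfin : IsFiniteMeasure (P.map Prod.snd) := inferInstance
  have hmeas : Measurable fun s : Obs k q => ((N *ᵥ resid s β, s.2) : Obs k q) :=
    ((continuous_const.matrix_mulVec (continuous_resid β)).prodMk continuous_snd).measurable
  -- The Jacobian of the standardization cancels the normalizing factor of the elliptical density.
  have hc : ENNReal.ofReal (√S.det)⁻¹ * ENNReal.ofReal |N.det⁻¹| = 1 := by
    rw [← ENNReal.ofReal_mul (by positivity), ENNReal.ofReal_eq_one]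
    have h1 : S.det⁻¹ = N.det * N.det := by
      have := congrArg Matrix.det hN
      rwa [det_mul, det_transpose, det_nonsing_inv, Ring.inverse_eq_inv'] at this
    have h2 : √S.det = |N.det|⁻¹ := by
      rw [← inv_inv S.det, h1, ← pow_two, Real.sqrt_inv, Real.sqrt_sq_eq_abs]
    rw [h2, inv_inv, abs_inv, mul_inv_cancel₀ (abs_ne_zero.2 hN0)]
  refine Measure.ext_of_lintegral _ fun F hF => ?_
  rw [lintegral_map hF hmeas]
  unfold IsEllipticalGivenX at hP
  -- The model equation expresses `P` through its own marginal, so the marginal is made opaque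
  -- before `P` is rewritten.
  generalize P.map Prod.snd = μX at hP hfin
  have hF' : Measurable fun a : Obs k q => F (N *ᵥ resid a β, a.2) := hF.comp hmeas
  rw [hP, lintegral_withDensity_eq_lintegral_mul _ (measurable_ellDensity hg β S) hF',
    lintegral_prod_symm _ ((measurable_ellDensity hg β S).mul hF').aemeasurable]
  have hrad : SFinite (radial k g) := by unfold radial; infer_instance
  rw [lintegral_prod_symm _ hF.aemeasurable]
  refine lintegral_congr fun X => ?_
  have hFX : Measurable fun z : Fin k → ℝ => F (z, X) := hF.comp measurable_prodMk_right
  have h1 : ∀ y : Fin k → ℝ, ((fun s : Obs k q => ENNReal.ofReal (ellDensity g (s.2 *ᵥ β) S s.1)) *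
      fun a => F (N *ᵥ resid a β, a.2)) (y, X) =
      ENNReal.ofReal (√S.det)⁻¹ * (fun z => ENNReal.ofReal (g (z ⬝ᵥ z)) * F (z, X))
        (N *ᵥ (y - X *ᵥ β)) := fun y => by
    have h2 : (y - X *ᵥ β) ⬝ᵥ (S⁻¹ *ᵥ (y - X *ᵥ β)) =
        (N *ᵥ (y - X *ᵥ β)) ⬝ᵥ (N *ᵥ (y - X *ᵥ β)) := by
      rw [hN, ← mulVec_mulVec, dotProduct_mulVec, vecMul_transpose]
    simp only [Pi.mul_apply, ellDensity, resid]
    rw [h2, ENNReal.ofReal_mul (by positivity), mul_assoc]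
  have h3 : Measurable fun z : Fin k → ℝ => ENNReal.ofReal (g (z ⬝ᵥ z)) * F (z, X) :=
    (measurable_radial_density hg).mul hFX
  have h4 : Measurable fun y : Fin k → ℝ =>
      (fun z => ENNReal.ofReal (g (z ⬝ᵥ z)) * F (z, X)) (N *ᵥ (y - X *ᵥ β)) := h3.comp
    ((continuous_const.matrix_mulVec (continuous_id.sub continuous_const)).measurable)
  rw [lintegral_congr h1, lintegral_const_mul _ h4, lintegral_comp_affine hN0 _ h3, ← mul_assoc,
    hc, one_mul, radial,
    lintegral_withDensity_eq_lintegral_mul _ (measurable_radial_density hg) hFX]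
  rfl

/-- The generator is not normalized by hypothesis; comparing total masses in `map_standardized`
shows that it must be. -/
lemma isProbabilityMeasure_radial (hg : Measurable g) {β : Fin q → ℝ}
    {S : Matrix (Fin k) (Fin k) ℝ} (hS : S.PosDef) {P : Measure (Obs k q)}
    [IsProbabilityMeasure P] (hP : IsEllipticalGivenX g β S P) :
    IsProbabilityMeasure (radial k g) := by
  obtain ⟨N, hN, hN0⟩ := exists_transpose_mul_self hS.inv
  have hmeas : Measurable fun s : Obs k q => ((N *ᵥ resid s β, s.2) : Obs k q) :=
    ((continuous_const.matrix_mulVec (continuous_resid β)).prodMk continuous_snd).measurable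
  have h1 := congrArg (fun μ => μ Set.univ) (map_standardized hg hN hN0 hP)
  have hX : IsProbabilityMeasure (P.map Prod.snd) :=
    Measure.isProbabilityMeasure_map measurable_snd.aemeasurable
  have hrad : SFinite (radial k g) := by unfold radial; infer_instance
  simp only [← Set.univ_prod_univ, Measure.prod_prod, measure_univ, mul_one] at h1
  rw [Set.univ_prod_univ, Measure.map_apply hmeas MeasurableSet.univ, Set.preimage_univ,
    measure_univ] at h1
  exact ⟨h1.symm⟩

lemma sphE_eq (hg : Measurable g) (hg0 : ∀ t, 0 ≤ t → 0 ≤ g t) (φ : ℝ → ℝ) :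
    sphE k g φ = ∫ z, φ (√(z ⬝ᵥ z)) ∂(radial k g) := by
  rw [radial, integral_withDensity_eq_integral_toReal_smul (measurable_radial_density hg)
    (Eventually.of_forall fun _ => ENNReal.ofReal_lt_top)]
  refine integral_congr_ae (Eventually.of_forall fun z => ?_)
  have h0 : 0 ≤ z ⬝ᵥ z := Finset.sum_nonneg fun i _ => mul_self_nonneg (z i)
  simp [ellDensity, ENNReal.toReal_ofReal (hg0 _ h0), mul_comm]

/-- The origin is a null set, so the quotient `ρ'(s) / s` and its continuous extension have the same
integrals. -/
lemma ae_radial_pos (hk : 0 < k) : ∀ᵐ z ∂(radial k g), 0 < √(z ⬝ᵥ z) := by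
  have : Nonempty (Fin k) := ⟨⟨0, hk⟩⟩
  refine radial_absolutelyContinuous.ae_le ?_
  filter_upwards [compl_mem_ae_iff.2 (measure_singleton (0 : Fin k → ℝ))] with z hz
  refine Real.sqrt_pos.2 (lt_of_le_of_ne (Finset.sum_nonneg fun i _ => mul_self_nonneg (z i)) ?_)
  exact fun h => hz (dotProduct_self_eq_zero.1 h.symm)

end law

/-! ### The derivative of the score in standardized coordinates -/

section standardized

variable {k q l : ℕ} {ρ : ℝ → ℝ} {c₀ : ℝ}

/-- The derivative of the score in terms of the standardized residual `z`, the standardized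
designs `a`, `a'` and the standardized covariance directions `K`, `K'`. -/
def stdDeriv (ρ : ℝ → ℝ) (b₀ c : ℝ) (K K' : Matrix (Fin k) (Fin k) ℝ) (a a' z : Fin k → ℝ) : ℝ :=
  (weightExt ρ (√(z ⬝ᵥ z)) * (k * -((K' *ᵥ z + a') ⬝ᵥ a) +
      k / 2 * (-2 * ((K *ᵥ z) ⬝ᵥ (K' *ᵥ z + a'))) -
      1 / 2 * (z ⬝ᵥ z * -(K' * K).trace + (-2 * (z ⬝ᵥ a') - z ⬝ᵥ (K' *ᵥ z)) * K.trace)) +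
    (deriv (deriv ρ) (√(z ⬝ᵥ z)) - weightExt ρ (√(z ⬝ᵥ z))) / (2 * (z ⬝ᵥ z)) *
      (k * (z ⬝ᵥ a) + k / 2 * (z ⬝ᵥ (K *ᵥ z)) - 1 / 2 * (z ⬝ᵥ z * K.trace)) *
      (-2 * (z ⬝ᵥ a') - z ⬝ᵥ (K' *ᵥ z))) +
    c * ((ρ (√(z ⬝ᵥ z)) - b₀) * -(K' * K).trace +
      weightExt ρ (√(z ⬝ᵥ z)) / 2 * (-2 * (z ⬝ᵥ a') - z ⬝ᵥ (K' *ᵥ z)) * K.trace)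

lemma transpose_mulVec_dotProduct (N : Matrix (Fin k) (Fin k) ℝ) (x y : Fin k → ℝ) :
    (Nᵀ *ᵥ x) ⬝ᵥ y = x ⬝ᵥ (N *ᵥ y) := by
  rw [dotProduct_mulVec, mulVec_transpose]

/-- Substituting `V⁻¹ = NᵀN` turns every form in `V⁻¹` into a Euclidean one, with covariance
directions replaced by their congruences under `N`. -/
lemma dscore_eq_stdDeriv {L : Fin l → Matrix (Fin k) (Fin k) ℝ} (hL : ∀ j, (L j).IsSymm)
    (b₀ c : ℝ) {ξ : Param q l} {N : Matrix (Fin k) (Fin k) ℝ} (hN : prec L ξ = Nᵀ * N)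
    (v v' : Param q l) (s : Obs k q) :
    dscore L ρ b₀ c v ξ s v' =
      stdDeriv ρ b₀ c (N * linCov L v.2 * Nᵀ) (N * linCov L v'.2 * Nᵀ) (N *ᵥ (s.2 *ᵥ v.1))
        (N *ᵥ (s.2 *ᵥ v'.1)) (N *ᵥ resid s ξ.1) := by
  have hsym : ∀ x y, x ⬝ᵥ (linCov L v.2 *ᵥ y) = (linCov L v.2 *ᵥ x) ⬝ᵥ y := fun x y =>
    symm_dotProduct_mulVec (linCov_isSymm hL _) x y
  have h1 : sres L ξ s = Nᵀ *ᵥ (N *ᵥ resid s ξ.1) := by rw [sres, hN, mulVec_mulVec]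
  have h2 : tau L ξ s = (N *ᵥ resid s ξ.1) ⬝ᵥ (N *ᵥ resid s ξ.1) := by
    rw [tau, h1, dotProduct_comm, transpose_mulVec_dotProduct]
  have h3 : ∀ w : Param q l, trPrec L w ξ = (N * linCov L w.2 * Nᵀ).trace := fun w => by
    rw [trPrec, hN, Matrix.mul_assoc, Matrix.trace_mul_comm]
  have h4 : dtrPrec L v ξ v' =
      -((N * linCov L v'.2 * Nᵀ) * (N * linCov L v.2 * Nᵀ)).trace := by
    rw [dtrPrec, hN, Matrix.mul_assoc Nᵀ N, Matrix.mul_assoc Nᵀ, Matrix.trace_mul_comm]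
    simp only [Matrix.mul_assoc]
  have h5 : dsres L ξ s v' = -(Nᵀ *ᵥ ((N * linCov L v'.2 * Nᵀ) *ᵥ (N *ᵥ resid s ξ.1) +
      N *ᵥ (s.2 *ᵥ v'.1))) := by
    rw [dsres, h1, hN]
    simp only [mulVec_add, mulVec_mulVec, Matrix.mul_assoc]
    abel
  have h6 : dtau L ξ s v' = -2 * ((N *ᵥ resid s ξ.1) ⬝ᵥ (N *ᵥ (s.2 *ᵥ v'.1))) -
      (N *ᵥ resid s ξ.1) ⬝ᵥ ((N * linCov L v'.2 * Nᵀ) *ᵥ (N *ᵥ resid s ξ.1)) := by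
    rw [dtau, h1, transpose_mulVec_dotProduct, transpose_mulVec_dotProduct]
    simp only [mulVec_mulVec, Matrix.mul_assoc]
  have h7 : ∀ x y : Fin k → ℝ, (linCov L v.2 *ᵥ (Nᵀ *ᵥ x)) ⬝ᵥ (Nᵀ *ᵥ y) =
      ((N * linCov L v.2 * Nᵀ) *ᵥ x) ⬝ᵥ y := fun x y => by
    rw [dotProduct_comm, transpose_mulVec_dotProduct, dotProduct_comm]
    simp only [mulVec_mulVec, Matrix.mul_assoc]
  have h8 : scoreFactor L v ξ s = k * ((N *ᵥ resid s ξ.1) ⬝ᵥ (N *ᵥ (s.2 *ᵥ v.1))) +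
      k / 2 * ((N *ᵥ resid s ξ.1) ⬝ᵥ ((N * linCov L v.2 * Nᵀ) *ᵥ (N *ᵥ resid s ξ.1))) -
      1 / 2 * ((N *ᵥ resid s ξ.1) ⬝ᵥ (N *ᵥ resid s ξ.1) * (N * linCov L v.2 * Nᵀ).trace) := by
    rw [scoreFactor, h2, h3, h1, transpose_mulVec_dotProduct, hsym, h7,
      dotProduct_comm ((N * linCov L v.2 * Nᵀ) *ᵥ _)]
  simp only [dscore, dscoreFactor, h8, h6, h4, h3, h2, h5, h1, stdDeriv, hsym, mulVec_neg,
    neg_dotProduct, dotProduct_neg, h7]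
  have h9 : ∀ x y : Fin k → ℝ, ((N * linCov L v.2 * Nᵀ) *ᵥ x) ⬝ᵥ y =
      ((N * linCov L v.2 * Nᵀ) *ᵥ y) ⬝ᵥ x := fun x y => by
    rw [← h7, ← hsym, dotProduct_comm, h7]
  rw [transpose_mulVec_dotProduct, h9 (_ + _)]
  ring

/-- Symmetrizing in `z` removes the odd terms, among them all products of a regression direction
with a covariance direction; this is why the blocks for `β` and `θ` decouple. What remains consists
of radial functions times quadratic forms, to which the moment formulas apply. -/
lemma stdDeriv_add_neg (ρ : ℝ → ℝ) (b₀ c : ℝ) {K : Matrix (Fin k) (Fin k) ℝ} (hK : K.IsSymm)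
    (K' : Matrix (Fin k) (Fin k) ℝ) (a a' z : Fin k → ℝ) :
    stdDeriv ρ b₀ c K K' a a' z + stdDeriv ρ b₀ c K K' a a' (-z) =
      2 * (-(k * (a ⬝ᵥ a')) * weightExt ρ (√(z ⬝ᵥ z)) -
        k * (weightExt ρ (√(z ⬝ᵥ z)) * (z ⬝ᵥ ((K * K') *ᵥ z))) +
        (K * K').trace / 2 * (weightExt ρ (√(z ⬝ᵥ z)) * (z ⬝ᵥ z)) +
        (1 - c) / 2 * K.trace * (weightExt ρ (√(z ⬝ᵥ z)) * (z ⬝ᵥ (K' *ᵥ z))) +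
        (-k) * ((deriv (deriv ρ) (√(z ⬝ᵥ z)) - weightExt ρ (√(z ⬝ᵥ z))) / (z ⬝ᵥ z) *
          (z ⬝ᵥ (vecMulVec a a' *ᵥ z))) -
        k / 4 * ((deriv (deriv ρ) (√(z ⬝ᵥ z)) - weightExt ρ (√(z ⬝ᵥ z))) / (z ⬝ᵥ z) *
          ((z ⬝ᵥ (K *ᵥ z)) * (z ⬝ᵥ (K' *ᵥ z)))) +
        K.trace / 4 * ((deriv (deriv ρ) (√(z ⬝ᵥ z)) - weightExt ρ (√(z ⬝ᵥ z))) / (z ⬝ᵥ z) *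
          ((z ⬝ᵥ ((1 : Matrix (Fin k) (Fin k) ℝ) *ᵥ z)) * (z ⬝ᵥ (K' *ᵥ z)))) -
        c * (K * K').trace * (ρ (√(z ⬝ᵥ z)) - b₀)) := by
  have h1 : z ⬝ᵥ ((K * K') *ᵥ z) = (K *ᵥ z) ⬝ᵥ (K' *ᵥ z) := by
    rw [← mulVec_mulVec, symm_dotProduct_mulVec hK]
  have h2 : z ⬝ᵥ (vecMulVec a a' *ᵥ z) = (z ⬝ᵥ a) * (z ⬝ᵥ a') := by
    rw [vecMulVec_mulVec, dotProduct_smul, MulOpposite.smul_eq_mul_unop,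
      MulOpposite.unop_op, dotProduct_comm a' z]
  rw [h1, h2, one_mulVec, dotProduct_comm a a', Matrix.trace_mul_comm K K']
  simp only [stdDeriv, mulVec_neg, neg_dotProduct, dotProduct_neg, neg_neg, dotProduct_add,
    add_dotProduct]
  have h3 : ∀ x y : ℝ, x / (2 * y) = x / y / 2 := fun x y => by rw [mul_comm, div_mul_eq_div_div]
  rw [h3]
  ring

end standardized

/-! ### The spherical mean of the derivative of the score -/

section moments

variable {k : ℕ} {ρ : ℝ → ℝ} {c₀ : ℝ} {ν : Measure (Fin k → ℝ)}

lemma IsRho.integrable_radial (hρ : IsRho ρ c₀) [IsFiniteMeasure ν] {f : ℝ → ℝ}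
    (hf : Continuous f) (h0 : ∀ s, c₀ ≤ s → f s = 0) :
    Integrable (fun z => f (√(z ⬝ᵥ z))) ν := by
  obtain ⟨C, -, hC⟩ := hρ.exists_bound hf h0
  exact Integrable.mono' (integrable_const C) (measurable_radial hf.measurable).aestronglyMeasurable
    (Eventually.of_forall fun z => hC _ (Real.sqrt_nonneg _))

lemma IsRho.integrable_radial_mul_sq (hρ : IsRho ρ c₀) [IsFiniteMeasure ν] {f : ℝ → ℝ}
    (hf : Continuous f) (h0 : ∀ s, c₀ ≤ s → f s = 0) :
    Integrable (fun z => f (√(z ⬝ᵥ z)) * (z ⬝ᵥ z)) ν := by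
  refine (hρ.integrable_radial (f := fun s => f s * s ^ 2) (hf.mul (continuous_pow 2))
    fun s hs => by rw [h0 s hs, zero_mul]).congr (Eventually.of_forall fun z => ?_)
  simp only [Real.sq_sqrt (show 0 ≤ z ⬝ᵥ z from dotProduct_self_star_nonneg z)]

lemma integrable_rho_radial (hρ : IsRho ρ c₀) [IsFiniteMeasure ν] :
    Integrable (fun z => ρ (√(z ⬝ᵥ z))) ν :=
  Integrable.mono' (integrable_const (ρ c₀))
    (measurable_radial hρ.continuous.measurable).aestronglyMeasurable
    (Eventually.of_forall fun _ => abs_rho_le hρ _ (Real.sqrt_nonneg _))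

/-- The integral of the derivative of the score over the spherical distribution. -/
lemma integral_stdDeriv (hk : 0 < k) (hρ : IsRho ρ c₀) [IsProbabilityMeasure ν] (hν : SphInv ν)
    {b₀ c : ℝ} (hb : ∫ z, ρ (√(z ⬝ᵥ z)) ∂ν = b₀) {K K' : Matrix (Fin k) (Fin k) ℝ}
    (hK : K.IsSymm) (hK' : K'.IsSymm) (a a' : Fin k → ℝ)
    (hint : Integrable (stdDeriv ρ b₀ c K K' a a') ν)
    {A B e M : ℝ} (hA : ∫ z, weightExt ρ (√(z ⬝ᵥ z)) ∂ν = A)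
    (hB : ∫ z, deriv (deriv ρ) (√(z ⬝ᵥ z)) ∂ν = B)
    (he : ∫ z, weightExt ρ (√(z ⬝ᵥ z)) * (z ⬝ᵥ z) ∂ν = e)
    (hM : ∫ z, deriv (deriv ρ) (√(z ⬝ᵥ z)) * (z ⬝ᵥ z) ∂ν = M)
    (hc : c * e = (M + (k + 1) * e) / (k + 2)) :
    ∫ z, stdDeriv ρ b₀ c K K' a a' z ∂ν =
      -(k * ((1 - 1 / k) * A + 1 / k * B)) * (a ⬝ᵥ a') -
        (M + (k + 1) * e) / (k + 2) / 2 * (K * K').trace := by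
  have hk0 : (k : ℝ) ≠ 0 := by exact_mod_cast hk.ne'
  have hk2 : (k : ℝ) + 2 ≠ 0 := by positivity
  have hu := hρ.continuous_weightExt
  have hu0 : ∀ s, c₀ ≤ s → weightExt ρ s = 0 := fun s hs => hρ.weightExt_eq_zero hs
  have hd := hρ.continuous_deriv_deriv
  have hd0 : ∀ s, c₀ ≤ s → deriv (deriv ρ) s = 0 := fun s hs => hρ.deriv_deriv_eq_zero hs
  have hnn : ∀ z : Fin k → ℝ, 0 ≤ z ⬝ᵥ z := fun z => dotProduct_self_star_nonneg z
  have JA : HasInt ν (fun z => weightExt ρ (√(z ⬝ᵥ z))) A := ⟨hρ.integrable_radial hu hu0, hA⟩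
  have JB : HasInt ν (fun z => deriv (deriv ρ) (√(z ⬝ᵥ z))) B :=
    ⟨hρ.integrable_radial hd hd0, hB⟩
  have Je : HasInt ν (fun z => weightExt ρ (√(z ⬝ᵥ z)) * (z ⬝ᵥ z)) e :=
    ⟨hρ.integrable_radial_mul_sq hu hu0, he⟩
  have JM : HasInt ν (fun z => deriv (deriv ρ) (√(z ⬝ᵥ z)) * (z ⬝ᵥ z)) M :=
    ⟨hρ.integrable_radial_mul_sq hd hd0, hM⟩
  have JR : HasInt ν (fun z => ρ (√(z ⬝ᵥ z)) - b₀) 0 := by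
    have := (show HasInt ν (fun z => ρ (√(z ⬝ᵥ z))) b₀ from
      ⟨integrable_rho_radial hρ, hb⟩).sub (HasInt.of_integrable (integrable_const b₀))
    exact this.congr (fun _ => rfl) (by simp)
  -- The singularity of `f` at the origin is harmless, since `f` is only integrated against
  -- quadratic and quartic forms.
  let f : ℝ → ℝ := fun s => (deriv (deriv ρ) s - weightExt ρ s) / s ^ 2
  have hf : Measurable f := (hd.sub hu).measurable.div (measurable_id.pow_const 2)
  have hfz : ∀ z : Fin k → ℝ, f (√(z ⬝ᵥ z)) =
      (deriv (deriv ρ) (√(z ⬝ᵥ z)) - weightExt ρ (√(z ⬝ᵥ z))) / (z ⬝ᵥ z) := fun z => by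
    simp only [f, Real.sq_sqrt (hnn z)]
  have hf2 : ∀ z : Fin k → ℝ, f (√(z ⬝ᵥ z)) * (z ⬝ᵥ z) =
      deriv (deriv ρ) (√(z ⬝ᵥ z)) - weightExt ρ (√(z ⬝ᵥ z)) := fun z => by
    rw [hfz]
    rcases (hnn z).eq_or_lt with h0 | h0
    -- Both sides vanish at the origin because the weight extends there by `ρ''(0)`.
    · rw [← h0, Real.sqrt_zero, hρ.weightExt_zero]; simp
    · field_simp
  have J2 : HasInt ν (fun z => f (√(z ⬝ᵥ z)) * (z ⬝ᵥ z)) (B - A) :=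
    (JB.sub JA).congr (fun z => (hf2 z).symm) rfl
  have J4 : HasInt ν (fun z => f (√(z ⬝ᵥ z)) * (z ⬝ᵥ z) ^ 2) (M - e) :=
    (JM.sub Je).congr (fun z => by rw [pow_two, ← mul_assoc, hf2]; ring) rfl
  have Q2 : ∀ {f : ℝ → ℝ} {m : ℝ}, Measurable f →
      HasInt ν (fun z => f (√(z ⬝ᵥ z)) * (z ⬝ᵥ z)) m → ∀ K : Matrix (Fin k) (Fin k) ℝ,
      HasInt ν (fun z => f (√(z ⬝ᵥ z)) * (z ⬝ᵥ (K *ᵥ z))) (K.trace / k * m) :=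
    fun {f m} hf h K => ⟨by
      simp only [dotProduct_mulVec_eq_sum, Finset.mul_sum]
      refine integrable_finsetSum _ fun i _ => integrable_finsetSum _ fun j _ => ?_
      exact ((integrable_radial_mul_mul hf h.1 i j).const_mul (K i j)).congr
        (Eventually.of_forall fun z => by ring), by
      rw [hν.integral_quadForm hk hf h.1, h.2]⟩
  have Q4 : ∀ K : Matrix (Fin k) (Fin k) ℝ,
      HasInt ν (fun z => f (√(z ⬝ᵥ z)) * ((z ⬝ᵥ (K *ᵥ z)) * (z ⬝ᵥ (K' *ᵥ z))))
        ((2 * (K * K').trace + K.trace * K'.trace) / (k * (k + 2)) * (M - e)) :=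
    fun K => ⟨by
      have : ∀ z : Fin k → ℝ, f (√(z ⬝ᵥ z)) * ((z ⬝ᵥ (K *ᵥ z)) * (z ⬝ᵥ (K' *ᵥ z))) =
          ∑ a, ∑ b, ∑ c, ∑ d, (K a b * K' c d) *
            (f (√(z ⬝ᵥ z)) * (z a * z b * (z c * z d))) := fun z => by
        rw [dotProduct_mulVec_eq_sum, dotProduct_mulVec_eq_sum, Finset.sum_mul, Finset.mul_sum]
        refine Finset.sum_congr rfl fun a _ => ?_
        rw [Finset.sum_mul, Finset.mul_sum]
        refine Finset.sum_congr rfl fun b _ => ?_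
        simp only [Finset.mul_sum]
        exact Finset.sum_congr rfl fun c _ => Finset.sum_congr rfl fun d _ => by ring
      simp only [this]
      exact integrable_finsetSum _ fun a _ => integrable_finsetSum _ fun b _ =>
        integrable_finsetSum _ fun c _ => integrable_finsetSum _ fun d _ =>
          (integrable_radial_mul_mul_mul_mul hf J4.1 a b c d).const_mul _, by
      rw [hν.integral_quadForm_mul hk hf J4.1 K K' hK', J4.2]⟩
  have hmw := hu.measurable
  have J := (((((((JA.const_mul (-(k * (a ⬝ᵥ a')))).sub
    ((Q2 hmw Je (K * K')).const_mul (k : ℝ))).add (Je.const_mul ((K * K').trace / 2))).add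
    ((Q2 hmw Je K').const_mul ((1 - c) / 2 * K.trace))).add
    ((Q2 hf J2 (vecMulVec a a')).const_mul (-(k : ℝ)))).sub ((Q4 K).const_mul ((k : ℝ) / 4))).add
    ((Q4 1).const_mul (K.trace / 4))).sub (JR.const_mul (c * (K * K').trace))
  -- Invariance under `z ↦ -z` replaces the integrand by its symmetrization.
  have hneg := hν.integral_comp (T := -LinearMap.id) (by simp) (by simp)
    (stdDeriv ρ b₀ c K K' a a')
  have hmp := hν (-LinearMap.id) (by simp) (by simp)
  have hint' : Integrable (fun z => stdDeriv ρ b₀ c K K' a a' (-z)) ν :=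
    hmp.integrable_comp_of_integrable hint
  have h3 : HasInt ν (fun z => stdDeriv ρ b₀ c K K' a a' z + stdDeriv ρ b₀ c K K' a a' (-z)) _ :=
    (J.const_mul 2).congr (fun z => by
      simp only [hfz]
      exact (stdDeriv_add_neg ρ b₀ c hK K' a a' z).symm) rfl
  have h2 := h3.2
  rw [integral_add hint hint'] at h2
  simp only [LinearMap.neg_apply, LinearMap.id_apply] at hneg
  rw [hneg, ← two_mul] at h2
  rw [mul_left_cancel₀ two_ne_zero h2, trace_vecMulVec, Matrix.one_mul, Matrix.trace_one,
    Fintype.card_fin]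
  have hce : c * e = (M + (k + 1) * e) / (k + 2) := hc
  rw [← sub_eq_zero]
  rw [← sub_eq_zero] at hce
  -- The two sides differ by a multiple of `tr K tr K'` times the defect in the equation for `c`.
  have key : ∀ X Y : ℝ, X = -(K.trace * K'.trace / (2 * k)) * Y → Y = 0 → X = 0 := fun X Y h h' => by
    rw [h, h', mul_zero]
  refine key _ _ ?_ hce
  field_simp
  ring

end moments

/-! ### Invertibility of the two information matrices -/

section information

variable {k q l : ℕ} {L : Fin l → Matrix (Fin k) (Fin k) ℝ} {S : Matrix (Fin k) (Fin k) ℝ}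

lemma mulVec_transpose_vecMat_dotProduct (hL : ∀ j, (L j).IsSymm) (η : Fin l → ℝ)
    (M : Matrix (Fin k) (Fin k) ℝ) :
    η ⬝ᵥ ((vecMat L)ᵀ *ᵥ M.vec) = (linCov L η * M).trace := by
  rw [mulVec_transpose, dotProduct_comm, ← dotProduct_mulVec, dotProduct_comm, vecMat_mulVec,
    vec_dotProduct_vec, (linCov_isSymm hL η).eq]

lemma covInfo_mulVec (hS : S⁻¹.IsSymm) (η : Fin l → ℝ) :
    covInfo L S *ᵥ η = (vecMat L)ᵀ *ᵥ (S⁻¹ * linCov L η * S⁻¹).vec := by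
  rw [covInfo, ← mulVec_mulVec, ← mulVec_mulVec, vecMat_mulVec]
  congr 1
  exact (kronecker_mulVec_vec S⁻¹ _ S⁻¹).trans (by rw [hS.eq])

lemma dotProduct_covInfo_mulVec (hL : ∀ j, (L j).IsSymm) (hS : S⁻¹.IsSymm) (η η' : Fin l → ℝ) :
    η ⬝ᵥ (covInfo L S *ᵥ η') = (S⁻¹ * linCov L η * S⁻¹ * linCov L η').trace := by
  rw [covInfo_mulVec hS, mulVec_transpose_vecMat_dotProduct hL, Matrix.trace_mul_comm]
  simp only [Matrix.mul_assoc]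
  rw [Matrix.trace_mul_comm]
  simp only [Matrix.mul_assoc]
  rw [Matrix.trace_mul_comm]
  simp only [Matrix.mul_assoc]

lemma isUnit_det_of_quadForm {n : ℕ} {A : Matrix (Fin n) (Fin n) ℝ}
    (h : ∀ b, b ⬝ᵥ (A *ᵥ b) = 0 → b = 0) : IsUnit A.det := by
  rw [isUnit_iff_ne_zero]
  intro h0
  obtain ⟨b, hb, hb0⟩ := exists_mulVec_eq_zero_iff.2 h0
  exact hb (h b (by rw [hb0, dotProduct_zero]))

/-- With `S⁻¹ = NᵀN` the quadratic form is the squared Frobenius norm of `N V(η) Nᵀ`. It vanishes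
only if `V(η) = 0`, and the rank condition then gives `η = 0`. -/
lemma isUnit_det_covInfo (hL : ∀ j, (L j).IsSymm) (hLrank : (vecMat L).rank = l)
    (hS : S.PosDef) : IsUnit (covInfo L S).det := by
  obtain ⟨N, hN, hN0⟩ := exists_transpose_mul_self hS.inv
  refine isUnit_det_of_quadForm fun η hη => linCov_injective hLrank ?_
  rw [dotProduct_covInfo_mulVec hL (posDef_isSymm hS.inv), hN] at hη
  set V := linCov L η with hV
  have hVs : Vᵀ = V := linCov_isSymm hL η
  have h1 : ((N * V * Nᵀ)ᵀ * (N * V * Nᵀ)).trace = 0 := by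
    rw [← hη, transpose_mul, transpose_mul, transpose_transpose, hVs]
    rw [Matrix.mul_assoc N, Matrix.trace_mul_comm]
    simp only [Matrix.mul_assoc]
    rw [Matrix.trace_mul_comm]
    simp only [Matrix.mul_assoc]
  have h2 : N * V * Nᵀ = 0 := by
    have h3 := h1
    rw [← conjTranspose_eq_transpose_of_trivial] at h3
    exact trace_conjTranspose_mul_self_eq_zero_iff.1 h3
  have hNu : IsUnit N.det := isUnit_iff_ne_zero.2 hN0
  have hNu' : IsUnit Nᵀ.det := by rwa [det_transpose]
  have h3 : V = 0 := by
    have h4 := congrArg (fun A => N⁻¹ * A * Nᵀ⁻¹) h2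
    simp only [Matrix.mul_assoc, Matrix.mul_zero, Matrix.zero_mul] at h4
    rwa [Matrix.mul_nonsing_inv _ hNu', Matrix.mul_one, ← Matrix.mul_assoc,
      Matrix.nonsing_inv_mul _ hNu, Matrix.one_mul] at h4
  rw [linCov_zero]
  exact h3

variable {P : Measure (Obs k q)}

lemma asum_transpose {m n : ℕ} (A : Matrix (Fin m) (Fin n) ℝ) : asum Aᵀ = asum A := by
  unfold asum; exact Finset.sum_comm

lemma integrable_design_quadForm (hP : Integrable (fun s : Obs k q => dom s) P)
    (W : Matrix (Fin k) (Fin k) ℝ) (i j : Fin q) :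
    Integrable (fun s : Obs k q => (s.2ᵀ * W * s.2) i j) P := by
  refine Integrable.mono' (hP.const_mul (asum W)) ?_ (Eventually.of_forall fun s => ?_)
  · have : Continuous fun s : Obs k q => (s.2ᵀ * W * s.2) i j :=
      ((continuous_snd.matrix_transpose.matrix_mul continuous_const).matrix_mul
        continuous_snd).matrix_elem i j
    exact this.aestronglyMeasurable
  · have h1 := asum_nonneg s.2
    have h2 := asum_nonneg W
    calc |(s.2ᵀ * W * s.2) i j| ≤ asum (s.2ᵀ * W * s.2) := abs_le_asum _ _ _
      _ ≤ asum s.2 * asum W * asum s.2 := by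
        refine (asum_mul_le _ _).trans (mul_le_mul_of_nonneg_right ?_ h1)
        exact (asum_mul_le _ _).trans (by rw [asum_transpose])
      _ ≤ asum W * dom s := by unfold dom; nlinarith [mul_nonneg h2 h1]

lemma hasInt_designInfo (hP : Integrable (fun s : Obs k q => dom s) P)
    (S : Matrix (Fin k) (Fin k) ℝ) (b b' : Fin q → ℝ) :
    HasInt P (fun s : Obs k q => (s.2 *ᵥ b) ⬝ᵥ (S⁻¹ *ᵥ (s.2 *ᵥ b')))
      (b ⬝ᵥ (designInfo S P *ᵥ b')) := by
  have J := HasInt.sum fun i => HasInt.sum fun j => HasInt.const_mul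
    (HasInt.of_integrable (integrable_design_quadForm hP S⁻¹ i j)) (b i * b' j)
  have e : ∀ (M : Matrix (Fin q) (Fin q) ℝ),
      b ⬝ᵥ (M *ᵥ b') = ∑ i, ∑ j, b i * b' j * M i j := fun M => by
    simp only [dotProduct, mulVec, Finset.mul_sum]
    exact Finset.sum_congr rfl fun a _ => Finset.sum_congr rfl fun b _ => by ring
  refine J.congr (fun s => ?_) ?_
  · rw [← e, ← mulVec_mulVec, ← mulVec_mulVec, mulVec_transpose, dotProduct_comm b,
      ← dotProduct_mulVec, dotProduct_comm]
  · rw [e]; rfl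

/-- The quadratic form is the mean of a nonnegative function. If it vanishes at `b`, then `X b = 0`
almost surely, and a single design of full rank forces `b = 0`. -/
lemma isUnit_det_designInfo [NeZero P] (hP : Integrable (fun s : Obs k q => dom s) P)
    (hX : ∀ᵐ s ∂P, s.2.rank = q) (hS : S.PosDef) : IsUnit (designInfo S P).det := by
  refine isUnit_det_of_quadForm fun b hb => ?_
  have h := hasInt_designInfo hP S b b
  have h0 : 0 ≤ᵐ[P] fun s : Obs k q => (s.2 *ᵥ b) ⬝ᵥ (S⁻¹ *ᵥ (s.2 *ᵥ b)) :=
    Eventually.of_forall fun s => posDef_nonneg hS.inv (s.2 *ᵥ b)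
  have h1 : ∀ᵐ s ∂P, (s.2 *ᵥ b) ⬝ᵥ (S⁻¹ *ᵥ (s.2 *ᵥ b)) = 0 :=
    (integral_eq_zero_iff_of_nonneg_ae h0 h.1).1 (h.2.trans hb)
  obtain ⟨s, hs, hr⟩ := (h1.and hX).exists
  have h2 : s.2 *ᵥ b = 0 := by
    by_contra hne
    exact (posDef_pos hS.inv hne).ne' hs
  have h3 : Function.Injective s.2.mulVecLin := by
    rw [← LinearMap.ker_eq_bot]
    have := LinearMap.finrank_range_add_finrank_ker s.2.mulVecLin
    rw [← Matrix.rank, hr, Module.finrank_fin_fun] at this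
    exact Submodule.finrank_eq_zero.1 (by omega)
  exact h3 (by simp [h2])

end information

/-! ### The constants of the influence functions and their signs -/

section constants

variable {k : ℕ} {ρ g : ℝ → ℝ} {c₀ : ℝ}

/-- `E[ρ'(‖z‖)‖z‖]` for the spherical distribution. -/
def scaleMoment (k : ℕ) (g ρ : ℝ → ℝ) : ℝ :=
  ∫ z, weightExt ρ (√(z ⬝ᵥ z)) * (z ⬝ᵥ z) ∂(radial k g)

lemma sq_sqrt_dotProduct (z : Fin k → ℝ) : √(z ⬝ᵥ z) ^ 2 = z ⬝ᵥ z :=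
  Real.sq_sqrt (dotProduct_self_star_nonneg z)

lemma alphaC_eq (hk : 0 < k) (hρ : IsRho ρ c₀) (hg : Measurable g)
    (hg0 : ∀ t, 0 ≤ t → 0 ≤ g t) [IsFiniteMeasure (radial k g)] :
    alphaC k g ρ = (1 - 1 / k) * (∫ z, weightExt ρ (√(z ⬝ᵥ z)) ∂(radial k g)) +
      1 / k * ∫ z, deriv (deriv ρ) (√(z ⬝ᵥ z)) ∂(radial k g) := by
  rw [alphaC, sphE_eq hg hg0, ← integral_const_mul, ← integral_const_mul, ← integral_add
    ((hρ.integrable_radial hρ.continuous_weightExt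
      fun s hs => hρ.weightExt_eq_zero hs).const_mul _)
    ((hρ.integrable_radial hρ.continuous_deriv_deriv
      fun s hs => hρ.deriv_deriv_eq_zero hs).const_mul _)]
  refine integral_congr_ae ?_
  filter_upwards [ae_radial_pos hk] with z hz
  rw [hρ.weightExt_of_ne hz.ne']

lemma sphE_combination (hρ : IsRho ρ c₀) (hg : Measurable g)
    (hg0 : ∀ t, 0 ≤ t → 0 ≤ g t) [IsFiniteMeasure (radial k g)] (a b : ℝ) :
    sphE k g (fun s => a * (deriv (deriv ρ) s * s ^ 2) + b * (deriv ρ s * s)) =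
      a * (∫ z, deriv (deriv ρ) (√(z ⬝ᵥ z)) * (z ⬝ᵥ z) ∂(radial k g)) +
        b * scaleMoment k g ρ := by
  rw [sphE_eq hg hg0, scaleMoment, ← integral_const_mul, ← integral_const_mul, ← integral_add
    ((hρ.integrable_radial_mul_sq hρ.continuous_deriv_deriv
      fun s hs => hρ.deriv_deriv_eq_zero hs).const_mul _)
    ((hρ.integrable_radial_mul_sq hρ.continuous_weightExt
      fun s hs => hρ.weightExt_eq_zero hs).const_mul _)]
  refine integral_congr_ae (Eventually.of_forall fun z => ?_)
  simp only [sq_sqrt_dotProduct]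
  rw [← hρ.weightExt_mul, mul_assoc (weightExt ρ _), ← pow_two, sq_sqrt_dotProduct]

lemma gammaOne_eq (hρ : IsRho ρ c₀) (hg : Measurable g)
    (hg0 : ∀ t, 0 ≤ t → 0 ≤ g t) [IsFiniteMeasure (radial k g)] :
    gammaOne k g ρ = ((∫ z, deriv (deriv ρ) (√(z ⬝ᵥ z)) * (z ⬝ᵥ z) ∂(radial k g)) +
        (k + 1) * scaleMoment k g ρ) / (k + 2) := by
  have := sphE_combination (k := k) hρ hg hg0 1 (k + 1)
  rw [gammaOne]
  simp only [one_mul] at this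
  rw [this]

/-- The terms in `ρ''` cancel. What is left is the rate at which the mean loss falls when the
covariance is inflated, see `eventually_integral_rho_lt`. -/
lemma gammaOne_sub_gammaTwo (hk : 0 < k) (hρ : IsRho ρ c₀) (hg : Measurable g)
    (hg0 : ∀ t, 0 ≤ t → 0 ≤ g t) [IsFiniteMeasure (radial k g)] :
    gammaOne k g ρ - k * gammaTwo k g ρ = scaleMoment k g ρ / 2 := by
  have hk0 : (k : ℝ) ≠ 0 := by exact_mod_cast hk.ne'
  have hk2 : (k : ℝ) + 2 ≠ 0 := by positivity
  rw [gammaOne_eq hρ hg hg0, gammaTwo, sphE_combination hρ hg hg0]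
  field_simp
  ring

/-- If the nonnegative integrand had mean zero, `ρ'(‖z‖)` would vanish almost surely. Since `ρ' ≥
0`, such points are minima of `ρ'`, so `ρ''(‖z‖)` would vanish too and could not have positive mean.
-/
lemma scaleMoment_pos (hk : 0 < k) (hρ : IsRho ρ c₀) (hg : Measurable g)
    (hg0 : ∀ t, 0 ≤ t → 0 ≤ g t) [IsFiniteMeasure (radial k g)]
    (h : 0 < sphE k g (deriv (deriv ρ))) : 0 < scaleMoment k g ρ := by
  have hnn : 0 ≤ᵐ[radial k g] fun z => weightExt ρ (√(z ⬝ᵥ z)) * (z ⬝ᵥ z) := by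
    filter_upwards [ae_radial_pos hk] with z hz
    exact mul_nonneg (hρ.weightExt_nonneg hz) (dotProduct_self_star_nonneg z)
  refine lt_of_le_of_ne (integral_nonneg_of_ae hnn) fun h0 => ?_
  have h1 := (integral_eq_zero_iff_of_nonneg_ae hnn (hρ.integrable_radial_mul_sq
    hρ.continuous_weightExt fun s hs => hρ.weightExt_eq_zero hs)).1 h0.symm
  rw [sphE_eq hg hg0] at h
  refine h.ne' ?_
  refine (integral_congr_ae (g := fun _ => 0) ?_).trans (integral_zero _ _)
  filter_upwards [h1, ae_radial_pos hk] with z hz hz0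
  refine hρ.deriv_deriv_eq_zero_of_deriv hz0 ?_
  have h2 : z ⬝ᵥ z ≠ 0 := fun h => by simp [h] at hz0
  rw [← hρ.weightExt_mul, (mul_eq_zero.1 hz).resolve_right h2, zero_mul]

lemma alphaC_pos (hk : 0 < k) (hρ : IsRho ρ c₀) (hg : Measurable g)
    (hg0 : ∀ t, 0 ≤ t → 0 ≤ g t) [IsFiniteMeasure (radial k g)]
    (h : 0 < sphE k g (deriv (deriv ρ))) : 0 < alphaC k g ρ := by
  rw [alphaC_eq hk hρ hg hg0]
  rw [sphE_eq hg hg0] at h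
  have hk1 : (1 : ℝ) ≤ k := by exact_mod_cast hk
  have h1 : 0 ≤ ∫ z, weightExt ρ (√(z ⬝ᵥ z)) ∂(radial k g) := by
    refine integral_nonneg_of_ae ?_
    filter_upwards [ae_radial_pos hk] with z hz using hρ.weightExt_nonneg hz
  have h2 : (0 : ℝ) ≤ 1 - 1 / k := by
    rw [sub_nonneg, div_le_one (by linarith)]; exact hk1
  have h3 : (0 : ℝ) < 1 / k := by positivity
  nlinarith [mul_nonneg h2 h1, mul_pos h3 h]

end constants

/-! ### The derivative of the mean score at the elliptical model -/

section evaluation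

variable {k q l : ℕ} {L : Fin l → Matrix (Fin k) (Fin k) ℝ} {ρ g : ℝ → ℝ} {c₀ : ℝ}
  {P : Measure (Obs k q)} [IsProbabilityMeasure P]

lemma integral_comp_standardized (hg : Measurable g) {β : Fin q → ℝ}
    {S N : Matrix (Fin k) (Fin k) ℝ} (hS : S.PosDef) (hN : S⁻¹ = Nᵀ * N) (hN0 : N.det ≠ 0)
    (hP : IsEllipticalGivenX g β S P) {F : ℝ → ℝ} (hF : Measurable F) :
    ∫ s, F ((N *ᵥ resid s β) ⬝ᵥ (N *ᵥ resid s β)) ∂P = ∫ z, F (z ⬝ᵥ z) ∂(radial k g) := by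
  have hmeas : Measurable fun s : Obs k q => ((N *ᵥ resid s β, s.2) : Obs k q) :=
    ((continuous_const.matrix_mulVec (continuous_resid β)).prodMk continuous_snd).measurable
  have hG : Measurable fun z : Fin k → ℝ => F (z ⬝ᵥ z) :=
    hF.comp (continuous_id.dotProduct continuous_id).measurable
  have hfin := isProbabilityMeasure_radial hg hS hP
  have hX : IsProbabilityMeasure (P.map Prod.snd) :=
    Measure.isProbabilityMeasure_map measurable_snd.aemeasurable
  have h1 := integral_map (μ := P) hmeas.aemeasurable
    (f := fun p : Obs k q => F (p.1 ⬝ᵥ p.1)) (hG.comp measurable_fst).aestronglyMeasurable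
  rw [← h1, map_standardized hg hN hN0 hP,
    integral_fun_fst (μ := radial k g) (ν := P.map Prod.snd) fun z => F (z ⬝ᵥ z)]
  simp

/-- The derivative of the expected score at an elliptical distribution. -/
lemma integral_dscore (hk : 0 < k) (hρ : IsRho ρ c₀) (hL : ∀ j, (L j).IsSymm)
    (hQ : Integrable (fun s : Obs k q => dom s) P) {ξ : Param q l} (hξ : (linCov L ξ.2).PosDef)
    (hg : Measurable g) (hg0 : ∀ t, 0 ≤ t → 0 ≤ g t)
    (hP : IsEllipticalGivenX g ξ.1 (linCov L ξ.2) P) {b₀ c : ℝ}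
    (hb : ∫ s, ρ (√(tau L ξ s)) ∂P = b₀) (hc : c * scaleMoment k g ρ = gammaOne k g ρ)
    (v v' : Param q l) :
    ∫ s, dscore L ρ b₀ c v ξ s v' ∂P =
      -(k * alphaC k g ρ) * (v.1 ⬝ᵥ (designInfo (linCov L ξ.2) P *ᵥ v'.1)) -
        gammaOne k g ρ / 2 * (v.2 ⬝ᵥ (covInfo L (linCov L ξ.2) *ᵥ v'.2)) := by
  obtain ⟨N, hN, hN0⟩ := exists_transpose_mul_self hξ.inv
  have hNu : IsUnit N.det := isUnit_iff_ne_zero.2 hN0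
  have hrad := isProbabilityMeasure_radial hg hξ hP
  have hXp : IsProbabilityMeasure (P.map Prod.snd) :=
    Measure.isProbabilityMeasure_map measurable_snd.aemeasurable
  have hcont : Continuous fun s : Obs k q => ((N *ᵥ resid s ξ.1, s.2) : Obs k q) :=
    (continuous_const.matrix_mulVec (continuous_resid ξ.1)).prodMk continuous_snd
  have hinv : Continuous fun p : Obs k q => ((N⁻¹ *ᵥ p.1 + p.2 *ᵥ ξ.1, p.2) : Obs k q) :=
    ((continuous_const.matrix_mulVec continuous_fst).add (continuous_design _)).prodMk
      continuous_snd
  set K := N * linCov L v.2 * Nᵀ with hK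
  set K' := N * linCov L v'.2 * Nᵀ with hK'
  have hsymm : ∀ η : Fin l → ℝ, (N * linCov L η * Nᵀ).IsSymm := fun η => by
    rw [Matrix.IsSymm, transpose_mul, transpose_mul, transpose_transpose,
      (linCov_isSymm hL η).eq, Matrix.mul_assoc]
  let G : Obs k q → ℝ := fun p =>
    stdDeriv ρ b₀ c K K' (N *ᵥ (p.2 *ᵥ v.1)) (N *ᵥ (p.2 *ᵥ v'.1)) p.1
  -- The standardization is inverted, so that joint measurability of `G` is inherited from `dscore`.
  have hGeq : G = fun p => dscore L ρ b₀ c v ξ (N⁻¹ *ᵥ p.1 + p.2 *ᵥ ξ.1, p.2) v' := by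
    funext p
    rw [dscore_eq_stdDeriv hL b₀ c hN]
    simp [resid, G, mulVec_mulVec, Matrix.mul_nonsing_inv _ hNu]
    rfl
  have hGm : Measurable G := by
    rw [hGeq]; exact (measurable_dscore L hρ b₀ c v ξ v').comp hinv.measurable
  have hds : ∀ s, dscore L ρ b₀ c v ξ s v' = G (N *ᵥ resid s ξ.1, s.2) := fun s =>
    dscore_eq_stdDeriv hL b₀ c hN v v' s
  have hGi : Integrable G ((radial k g).prod (P.map Prod.snd)) := by
    rw [← map_standardized hg hN hN0 hP,
      integrable_map_measure hGm.aestronglyMeasurable hcont.measurable.aemeasurable]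
    exact (integrable_dscore hρ hL hQ b₀ c v v' hξ).congr (Eventually.of_forall hds)
  have hb' : ∫ z, ρ (√(z ⬝ᵥ z)) ∂(radial k g) = b₀ := by
    have h1 := integral_comp_standardized hg hξ hN hN0 hP (F := fun x => ρ (√x))
      (hρ.continuous.comp Real.continuous_sqrt).measurable
    rw [← hb, ← h1]
    refine integral_congr_ae (Eventually.of_forall fun s => ?_)
    have hN' : prec L ξ = Nᵀ * N := hN
    simp only [tau, sres, hN']
    rw [← mulVec_mulVec, dotProduct_comm (resid s ξ.1), transpose_mulVec_dotProduct]
  have htr : (K * K').trace = v.2 ⬝ᵥ (covInfo L (linCov L ξ.2) *ᵥ v'.2) := by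
    rw [dotProduct_covInfo_mulVec hL (posDef_isSymm hξ.inv), hN,
      show K * K' = N * (linCov L v.2 * (Nᵀ * N) * linCov L v'.2 * Nᵀ) by
        simp only [hK, hK', Matrix.mul_assoc], Matrix.trace_mul_comm,
      Matrix.mul_assoc (Nᵀ * N), Matrix.mul_assoc (Nᵀ * N), Matrix.trace_mul_comm (Nᵀ * N)]
    simp only [Matrix.mul_assoc]
  have hD := hasInt_designInfo hQ (linCov L ξ.2) v.1 v'.1
  have hcX : Continuous fun X : Matrix (Fin k) (Fin q) ℝ =>
      (X *ᵥ v.1) ⬝ᵥ ((linCov L ξ.2)⁻¹ *ᵥ (X *ᵥ v'.1)) :=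
    (continuous_id.matrix_mulVec continuous_const).dotProduct
      (continuous_const.matrix_mulVec (continuous_id.matrix_mulVec continuous_const))
  have hDX : HasInt (P.map Prod.snd) (fun X : Matrix (Fin k) (Fin q) ℝ =>
      (X *ᵥ v.1) ⬝ᵥ ((linCov L ξ.2)⁻¹ *ᵥ (X *ᵥ v'.1)))
      (v.1 ⬝ᵥ (designInfo (linCov L ξ.2) P *ᵥ v'.1)) :=
    ⟨(integrable_map_measure hcX.aestronglyMeasurable measurable_snd.aemeasurable).2 hD.1,
      (integral_map measurable_snd.aemeasurable hcX.aestronglyMeasurable).trans hD.2⟩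
  have hfin := (hDX.const_mul (-(k * alphaC k g ρ))).sub (HasInt.of_integrable
    (integrable_const (gammaOne k g ρ / 2 * (v.2 ⬝ᵥ (covInfo L (linCov L ξ.2) *ᵥ v'.2)))))
  calc ∫ s, dscore L ρ b₀ c v ξ s v' ∂P = ∫ s, G (N *ᵥ resid s ξ.1, s.2) ∂P :=
        integral_congr_ae (Eventually.of_forall hds)
    _ = ∫ p, G p ∂((radial k g).prod (P.map Prod.snd)) := by
        rw [← map_standardized hg hN hN0 hP]
        exact (integral_map hcont.measurable.aemeasurable hGm.aestronglyMeasurable).symm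
    _ = ∫ X, ∫ z, G (z, X) ∂(radial k g) ∂(P.map Prod.snd) := integral_prod_symm _ hGi
    _ = _ := by
        refine (integral_congr_ae ?_).trans (hfin.2.trans ?_)
        -- For a fixed design the standardized designs are constants and the spherical mean applies.
        · filter_upwards [hGi.prod_left_ae] with X hX
          have h1 := integral_stdDeriv hk hρ (sphInv_radial hg) hb' (hsymm v.2) (hsymm v'.2)
            (N *ᵥ (X *ᵥ v.1)) (N *ᵥ (X *ᵥ v'.1)) hX rfl rfl rfl rfl
            (hc.trans (gammaOne_eq hρ hg hg0))
          have h2 : (X *ᵥ v.1) ⬝ᵥ ((linCov L ξ.2)⁻¹ *ᵥ (X *ᵥ v'.1)) =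
              (N *ᵥ (X *ᵥ v.1)) ⬝ᵥ (N *ᵥ (X *ᵥ v'.1)) := by
            rw [hN, ← mulVec_mulVec, dotProduct_comm, transpose_mulVec_dotProduct,
              dotProduct_comm]
          rw [h2, ← htr, gammaOne_eq hρ hg hg0, alphaC_eq hk hρ hg hg0]
          exact h1
        · simp

end evaluation

/-! ### First-order expansion of a family near a zero -/

section implicit

/-- If `F` has an injective derivative at its zero `x₀`, then the first-order behaviour of `F`
along a family determines that of the family. -/
lemma tendsto_smul_sub_of_hasFDerivAt {E G : Type*} [NormedAddCommGroup E] [NormedSpace ℝ E]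
    [FiniteDimensional ℝ E] [NormedAddCommGroup G] [NormedSpace ℝ G]
    {F : E → G} {D : E →L[ℝ] G} {x₀ w : E} (hF : HasFDerivAt F D x₀) (hF0 : F x₀ = 0)
    (hD : Function.Injective D) {x : ℝ → E} (hx : Tendsto x (𝓝[>] 0) (𝓝 x₀))
    (hw : Tendsto (fun h => h⁻¹ • F (x h)) (𝓝[>] 0) (𝓝 (D w))) :
    Tendsto (fun h => h⁻¹ • (x h - x₀)) (𝓝[>] 0) (𝓝 w) := by
  obtain ⟨K, hK0, hK⟩ := (D : E →ₗ[ℝ] G).exists_antilipschitzWith (LinearMap.ker_eq_bot.2 hD)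
  have hDle : ∀ y, ‖y‖ ≤ K * ‖D y‖ := fun y => by
    have := hK.le_mul_dist y 0
    simpa [dist_eq_norm] using this
  have hlit : (fun h => F (x h) - D (x h - x₀)) =o[𝓝[>] 0] fun h => x h - x₀ := by
    have h1 := hF.isLittleO.comp_tendsto hx
    simpa [Function.comp_def, hF0] using h1
  -- Since `D` is bounded below and the remainder is negligible against `x h - x₀`, the displacement
  -- is controlled by `F (x h)`, hence by `h`. This upgrades the remainder to `o(h)`.
  have hO1 : (fun h => x h - x₀) =O[𝓝[>] 0] fun h => F (x h) := by
    have h2 : (fun h => x h - x₀) =O[𝓝[>] 0] fun h => D (x h - x₀) :=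
      Asymptotics.IsBigO.of_bound K (Eventually.of_forall fun h => hDle _)
    have h4 : (fun h => D (x h - x₀)) =O[𝓝[>] 0] fun h => F (x h) := by
      have h5 := (hlit.trans_isBigO h2).right_isBigO_add
      simpa using h5
    exact h2.trans h4
  have hO2 : (fun h => F (x h)) =O[𝓝[>] 0] fun h : ℝ => h := by
    have h1 := hw.isBigO_one ℝ
    have h2 := (Asymptotics.isBigO_refl (fun h : ℝ => h) (𝓝[>] 0)).smul h1
    refine (h2.congr' ?_ ?_)
    · filter_upwards [self_mem_nhdsWithin] with h hh
      rw [smul_smul, mul_inv_cancel₀ (ne_of_gt hh), one_smul]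
    · exact Eventually.of_forall fun h => by simp
  have hlit2 : Tendsto (fun h : ℝ => h⁻¹ • (F (x h) - D (x h - x₀))) (𝓝[>] 0) (𝓝 0) := by
    have h1 := hlit.trans_isBigO (hO1.trans hO2)
    have h2 := (Asymptotics.isBigO_refl (fun h : ℝ => h⁻¹) (𝓝[>] 0)).smul_isLittleO h1
    have h3 : (fun h : ℝ => h⁻¹ • (F (x h) - D (x h - x₀))) =o[𝓝[>] 0] fun _ : ℝ => (1 : ℝ) := by
      refine h2.congr' EventuallyEq.rfl ?_
      filter_upwards [self_mem_nhdsWithin] with h hh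
      rw [smul_eq_mul, inv_mul_cancel₀ (ne_of_gt hh)]
    exact (Asymptotics.isLittleO_one_iff ℝ).1 h3
  have h1 : Tendsto (fun h => D (h⁻¹ • (x h - x₀) - w)) (𝓝[>] 0) (𝓝 0) := by
    have h2 := (hw.sub hlit2).sub_const (D w)
    simp only [sub_zero, sub_self] at h2
    refine h2.congr fun h => ?_
    rw [← smul_sub, sub_sub_cancel, map_sub D (h⁻¹ • _), map_smul]
  rw [tendsto_iff_norm_sub_tendsto_zero]
  refine squeeze_zero (fun _ => norm_nonneg _) (fun h => hDle _) ?_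
  simpa using h1.norm.const_mul (K : ℝ)

end implicit

/-! ### Contaminated measures -/

section contamination

variable {k q : ℕ} {P : Measure (Obs k q)} {s₀ : Obs k q} {h : ℝ}

lemma isProbabilityMeasure_contam [IsProbabilityMeasure P] (h0 : 0 ≤ h) (h1 : h ≤ 1) :
    IsProbabilityMeasure (contam P s₀ h) := by
  constructor
  simp only [contam, Measure.add_apply, Measure.smul_apply, measure_univ, smul_eq_mul, mul_one]
  rw [← ENNReal.ofReal_add (by linarith) h0]
  simp

lemma integrable_contam {f : Obs k q → ℝ} (hf : Integrable f P) :
    Integrable f (contam P s₀ h) :=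
  (hf.smul_measure ENNReal.ofReal_ne_top).add_measure
    ((integrable_dirac enorm_lt_top).smul_measure ENNReal.ofReal_ne_top)

lemma integral_contam {f : Obs k q → ℝ} (hf : Integrable f P) (h0 : 0 ≤ h) (h1 : h ≤ 1) :
    ∫ s, f s ∂(contam P s₀ h) = (1 - h) * ∫ s, f s ∂P + h * f s₀ := by
  rw [contam, integral_add_measure (hf.smul_measure ENNReal.ofReal_ne_top)
    ((integrable_dirac enorm_lt_top).smul_measure ENNReal.ofReal_ne_top), integral_smul_measure,
    integral_smul_measure, integral_dirac, ENNReal.toReal_ofReal (by linarith),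
    ENNReal.toReal_ofReal h0, smul_eq_mul, smul_eq_mul]

end contamination

/-! ### The influence functions -/

section influence

variable {k q l : ℕ} {L : Fin l → Matrix (Fin k) (Fin k) ℝ} {ρ g : ℝ → ℝ} {c₀ b₀ : ℝ}
  {P : Measure (Obs k q)}

/-- The two weights can differ only at distance zero, where the other factor vanishes; so the value
of `u` at zero is immaterial. -/
lemma weightExt_mul_scoreFactor (hρ : IsRho ρ c₀) (v : Param q l) {ξ : Param q l}
    (h : (linCov L ξ.2).PosDef) (s : Obs k q) :
    weightExt ρ (√(tau L ξ s)) * scoreFactor L v ξ s =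
      weight ρ (√(tau L ξ s)) * scoreFactor L v ξ s := by
  rcases eq_or_ne (√(tau L ξ s)) 0 with h0 | h0
  · rw [scoreFactor_eq_zero v h ((Real.sqrt_eq_zero (tau_nonneg h s)).1 h0), mul_zero, mul_zero]
  · rw [hρ.weightExt_of_ne h0, weight]

/-- The vector of scores in the coordinate directions. -/
def scoreVec (L : Fin l → Matrix (Fin k) (Fin k) ℝ) (ρ : ℝ → ℝ) (b₀ c : ℝ) (ξ : Param q l)
    (s : Obs k q) : Param q l :=
  (fun i => score L ρ b₀ c (Pi.single i 1, 0) ξ s, fun j => score L ρ b₀ c (0, Pi.single j 1) ξ s)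

/-- The vector of expected scores in the coordinate directions. -/
def meanScore (L : Fin l → Matrix (Fin k) (Fin k) ℝ) (ρ : ℝ → ℝ) (b₀ c : ℝ)
    (P : Measure (Obs k q)) (ξ : Param q l) : Param q l :=
  (fun i => ∫ s, score L ρ b₀ c (Pi.single i 1, 0) ξ s ∂P,
    fun j => ∫ s, score L ρ b₀ c (0, Pi.single j 1) ξ s ∂P)

lemma hasFD_meanScore [IsProbabilityMeasure P] (hk : 0 < k) (hρ : IsRho ρ c₀)
    (hL : ∀ j, (L j).IsSymm) (hQ : Integrable (fun s : Obs k q => dom s) P) {ξ : Param q l}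
    (hξ : (linCov L ξ.2).PosDef) (hg : Measurable g) (hg0 : ∀ t, 0 ≤ t → 0 ≤ g t)
    (hP : IsEllipticalGivenX g ξ.1 (linCov L ξ.2) P) {c : ℝ}
    (hb : ∫ s, ρ (√(tau L ξ s)) ∂P = b₀) (hc : c * scaleMoment k g ρ = gammaOne k g ρ) :
    HasFD (meanScore L ρ b₀ c P)
      (fun v => (-(k * alphaC k g ρ)) • (designInfo (linCov L ξ.2) P *ᵥ v.1,
        (0 : Fin l → ℝ)) + (-(gammaOne k g ρ / 2)) • ((0 : Fin q → ℝ),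
        covInfo L (linCov L ξ.2) *ᵥ v.2)) ξ := by
  have h1 := HasFD.pi fun i : Fin q => hasFD_integral_score hρ hL hQ b₀ c (Pi.single i 1, 0) hξ
  have h2 := HasFD.pi fun j : Fin l => hasFD_integral_score hρ hL hQ b₀ c (0, Pi.single j 1) hξ
  obtain ⟨A, hA, hA'⟩ := h1
  obtain ⟨B, hB, hB'⟩ := h2
  refine ⟨A.prod B, hA.prodMk hB, fun v => ?_⟩
  rw [ContinuousLinearMap.prod_apply, hA', hB']
  simp only [integral_dscore hk hρ hL hQ hξ hg hg0 hP hb hc]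
  ext i <;> simp

/-- The score equation at the contaminated measure is `(1 - h)` times the mean under `P` plus `h`
times the score at `s₀`. -/
lemma meanScore_contam [IsProbabilityMeasure P] (hk : 0 < k) (hρ : IsRho ρ c₀)
    (hL : ∀ j, (L j).IsSymm) (hQ : Integrable (fun s : Obs k q => dom s) P) {s₀ : Obs k q} {h : ℝ}
    (h0 : 0 ≤ h) (h1 : h < 1) (c : ℝ) {ξ : Param q l}
    (hξ : IsSSolution ρ b₀ L (contam P s₀ h) ξ) :
    meanScore L ρ b₀ c P ξ = -(h * (1 - h)⁻¹) • scoreVec L ρ b₀ c ξ s₀ := by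
  have hp := isProbabilityMeasure_contam (P := P) (s₀ := s₀) h0 h1.le
  have key : ∀ v : Param q l, ∫ s, score L ρ b₀ c v ξ s ∂P =
      -(h * (1 - h)⁻¹) * score L ρ b₀ c v ξ s₀ := fun v => by
    have h2 := hξ.integral_score_eq_zero hk hρ hL (integrable_contam hQ) c v
    rw [integral_contam (integrable_score hρ hL hQ b₀ c v hξ.1.1) h0 h1.le] at h2
    have h3 : 1 - h ≠ 0 := by linarith
    field_simp
    linarith
  ext i
  · exact key _
  · exact key _

lemma meanScore_eq_zero [IsProbabilityMeasure P] (hk : 0 < k) (hρ : IsRho ρ c₀)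
    (hL : ∀ j, (L j).IsSymm) (hQ : Integrable (fun s : Obs k q => dom s) P) (c : ℝ)
    {ξ : Param q l} (hξ : IsSSolution ρ b₀ L P ξ) : meanScore L ρ b₀ c P ξ = 0 := by
  ext i
  · exact hξ.integral_score_eq_zero hk hρ hL hQ c _
  · exact hξ.integral_score_eq_zero hk hρ hL hQ c _

lemma continuousAt_scoreVec (hρ : IsRho ρ c₀) (hL : ∀ j, (L j).IsSymm) (c : ℝ) {ξ : Param q l}
    (hξ : (linCov L ξ.2).PosDef) (s : Obs k q) :
    ContinuousAt (fun ξ => scoreVec L ρ b₀ c ξ s) ξ :=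
  (continuousAt_pi.2 fun _ => (hasFD_score hρ hL b₀ c _ hξ s).continuousAt).prodMk
    (continuousAt_pi.2 fun _ => (hasFD_score hρ hL b₀ c _ hξ s).continuousAt)

/-- The score vector in closed form. -/
lemma scoreVec_eq (hρ : IsRho ρ c₀) (hL : ∀ j, (L j).IsSymm) {ξ : Param q l}
    (hξ : (linCov L ξ.2).PosDef) (c : ℝ) (s : Obs k q) :
    scoreVec L ρ b₀ c ξ s =
      ((k * weight ρ (√(tau L ξ s))) • (s.2ᵀ *ᵥ sres L ξ s),
        (k / 2 * weight ρ (√(tau L ξ s))) •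
          ((vecMat L)ᵀ *ᵥ (prec L ξ * vecMulVec (resid s ξ.1) (resid s ξ.1) * prec L ξ).vec) +
        (-(weight ρ (√(tau L ξ s)) * tau L ξ s / 2) + c * (ρ (√(tau L ξ s)) - b₀)) •
          (covInfo L (linCov L ξ.2) *ᵥ ξ.2)) := by
  have hW := prec_isSymm hξ
  have e1 : prec L ξ * vecMulVec (resid s ξ.1) (resid s ξ.1) * prec L ξ =
      vecMulVec (sres L ξ s) (sres L ξ s) := by
    rw [mul_vecMulVec, vecMulVec_mul, ← mulVec_transpose, hW.eq, sres]
  -- Since `V⁻¹ V(θ) V⁻¹ = V⁻¹`, the gradient of the log-determinant is the information matrix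
  -- applied to `θ`. Inverting that matrix returns `θ`, the origin of the multiple of `θ(P)` in the
  -- influence function.
  have e2 : covInfo L (linCov L ξ.2) *ᵥ ξ.2 = (vecMat L)ᵀ *ᵥ (prec L ξ).vec := by
    rw [covInfo_mulVec (posDef_isSymm hξ.inv), Matrix.nonsing_inv_mul _ (posDef_isUnit_det hξ),
      Matrix.one_mul, prec]
  have e3 : ∀ (M : Matrix (Fin k) (Fin k) ℝ) (j : Fin l),
      ((vecMat L)ᵀ *ᵥ M.vec) j = (linCov L (Pi.single j 1) * M).trace := fun M j => by
    rw [← mulVec_transpose_vecMat_dotProduct hL, single_dotProduct, one_mul]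
  rw [e1, e2]
  ext i
  · simp only [scoreVec, score, weightExt_mul_scoreFactor hρ _ hξ]
    have e4 : sres L ξ s ⬝ᵥ (s.2 *ᵥ Pi.single i 1) = (s.2ᵀ *ᵥ sres L ξ s) i := by
      rw [mulVec_transpose, dotProduct_mulVec, dotProduct_single, mul_one]
    simp only [scoreFactor, trPrec, linCov_zero, e4, zero_mulVec, dotProduct_zero, mul_zero,
      Matrix.trace_zero, Pi.smul_apply, smul_eq_mul]
    ring
  · simp only [scoreVec, score, weightExt_mul_scoreFactor hρ _ hξ]
    simp only [scoreFactor, trPrec, Pi.add_apply, Pi.smul_apply, e3, smul_eq_mul, mulVec_zero,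
      dotProduct_zero, mul_zero, mul_vecMulVec, trace_vecMulVec, zero_add]
    rw [Matrix.trace_mul_comm (prec L ξ), dotProduct_comm (sres L ξ s)]
    ring

/-- The influence functions of the regression and the covariance parameters. -/
theorem hasInfluence [IsProbabilityMeasure P] (hk : 0 < k) (hρ : IsRho ρ c₀)
    (hL : ∀ j, (L j).IsSymm) (hLrank : (vecMat L).rank = l)
    (hQ : Integrable (fun s : Obs k q => dom s) P) (hX : ∀ᵐ s ∂P, s.2.rank = q)
    (T : Measure (Obs k q) → Param q l) (hT : IsSSolution ρ b₀ L P (T P))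
    (hg : Measurable g) (hg0 : ∀ t, 0 ≤ t → 0 ≤ g t)
    (hP : IsEllipticalGivenX g (T P).1 (linCov L (T P).2) P)
    (hρ'' : 0 < sphE k g (deriv (deriv ρ))) (hγ : 0 < gammaOne k g ρ) (s₀ : Obs k q)
    (hsol : ∀ᶠ h in 𝓝[>] (0 : ℝ), IsSSolution ρ b₀ L (contam P s₀ h) (T (contam P s₀ h)))
    (hlim : Tendsto (fun h : ℝ => T (contam P s₀ h)) (𝓝[>] 0) (𝓝 (T P))) :
    Tendsto (fun h : ℝ => h⁻¹ • (T (contam P s₀ h) - T P)) (𝓝[>] 0)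
      (𝓝 ((weight ρ (√(tau L (T P) s₀)) / alphaC k g ρ) •
          ((designInfo (linCov L (T P).2) P)⁻¹ *ᵥ (s₀.2ᵀ *ᵥ sres L (T P) s₀)),
        (k * weight ρ (√(tau L (T P) s₀)) / gammaOne k g ρ) •
          ((covInfo L (linCov L (T P).2))⁻¹ *ᵥ ((vecMat L)ᵀ *ᵥ (prec L (T P) *
            vecMulVec (resid s₀ (T P).1) (resid s₀ (T P).1) * prec L (T P)).vec)) +
        (-(weight ρ (√(tau L (T P) s₀)) * tau L (T P) s₀ / gammaOne k g ρ) +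
          (ρ (√(tau L (T P) s₀)) - b₀) / (gammaOne k g ρ - k * gammaTwo k g ρ)) • (T P).2)) := by
  have hξ : (linCov L (T P).2).PosDef := hT.1.1
  have hrad := isProbabilityMeasure_radial hg hξ hP
  have he := scaleMoment_pos hk hρ hg hg0 hρ''
  have hα := alphaC_pos hk hρ hg hg0 hρ''
  have hk0 : (k : ℝ) ≠ 0 := by exact_mod_cast hk.ne'
  have hDI := isUnit_det_designInfo hQ hX hξ
  have hCI := isUnit_det_covInfo hL hLrank hξ
  rw [gammaOne_sub_gammaTwo hk hρ hg hg0]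
  -- The value for which the `tr K tr K'` term disappears and the derivative becomes block diagonal.
  set c := gammaOne k g ρ / scaleMoment k g ρ with hc
  obtain ⟨D, hD, hD'⟩ := hasFD_meanScore hk hρ hL hQ hξ hg hg0 hP (hT.integral_eq hk hρ hL hQ)
    (c := c) (div_mul_cancel₀ _ he.ne')
  have hinj : ∀ {n : ℕ} {A : Matrix (Fin n) (Fin n) ℝ}, IsUnit A.det → ∀ b, A *ᵥ b = 0 → b = 0 :=
    fun hA b hb => Matrix.mulVec_injective_of_isUnit ((Matrix.isUnit_iff_isUnit_det _).2 hA)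
      (hb.trans (mulVec_zero _).symm)
  refine tendsto_smul_sub_of_hasFDerivAt hD (meanScore_eq_zero hk hρ hL hQ c hT) ?_ hlim ?_
  · refine (injective_iff_map_eq_zero D).2 fun v hv => ?_
    rw [hD', Prod.ext_iff] at hv
    obtain ⟨h1, h2⟩ := hv
    simp only [Prod.fst_add, Prod.smul_fst, smul_zero, add_zero, Prod.fst_zero,
      Prod.snd_add, Prod.smul_snd, zero_add, Prod.snd_zero] at h1 h2
    refine Prod.ext (hinj hDI _ ((smul_eq_zero.1 h1).resolve_left ?_))
      (hinj hCI _ ((smul_eq_zero.1 h2).resolve_left ?_))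
    · exact neg_ne_zero.2 (mul_ne_zero hk0 hα.ne')
    · exact neg_ne_zero.2 (by positivity)
  · have h1 : Tendsto (fun h : ℝ => (-(1 - h)⁻¹) • scoreVec L ρ b₀ c (T (contam P s₀ h)) s₀)
        (𝓝[>] 0) (𝓝 ((-(1 - (0 : ℝ))⁻¹) • scoreVec L ρ b₀ c (T P) s₀)) := by
      refine Tendsto.smul ?_ ((continuousAt_scoreVec hρ hL c hξ s₀).tendsto.comp hlim)
      refine Tendsto.mono_left ?_ nhdsWithin_le_nhds
      exact ((continuousAt_const.sub continuousAt_id).inv₀ (by simp)).neg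
    refine (h1.congr' ?_).mono_right (le_of_eq (congrArg 𝓝 ?_))
    · filter_upwards [hsol, self_mem_nhdsWithin,
        mem_nhdsWithin_of_mem_nhds (Iio_mem_nhds (zero_lt_one' ℝ))] with h hh h0 h1
      have h0' : h ≠ 0 := ne_of_gt h0
      rw [meanScore_contam hk hρ hL hQ (le_of_lt h0) h1 c hh, smul_smul]
      congr 1
      field_simp
    · rw [hD', scoreVec_eq hρ hL hξ]
      simp only [mulVec_add, mulVec_smul]
      rw [mulVec_mulVec, mulVec_mulVec _ _ (_)⁻¹, Matrix.mul_nonsing_inv _ hDI,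
        Matrix.mul_nonsing_inv _ hCI, one_mulVec, one_mulVec]
      refine Prod.ext ?_ ?_
      · simp only [Prod.smul_fst, Prod.fst_add, smul_zero, add_zero, smul_smul]
        congr 1
        field_simp
        ring
      · simp only [Prod.smul_snd, Prod.snd_add, smul_zero, zero_add, smul_smul, smul_add, add_smul]
        rw [hc]
        have he' := he.ne'
        have hγ' := hγ.ne'
        congr 1
        · congr 1
          field_simp
          ring
        · rw [← add_smul, ← add_smul]
          congr 1
          field_simp
          ring

end influence

/-! ### Small probability of thin slabs -/

section slab

variable {k : ℕ} {ν : Measure (Fin k → ℝ)}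

/-- All standardized linear forms have the same distribution under a spherical distribution. -/
lemma SphInv.measure_linear (h : SphInv ν) {w : Fin k → ℝ} (hw : w ≠ 0) (i : Fin k) {A : Set ℝ}
    (hA : MeasurableSet A) :
    ν {z | w ⬝ᵥ z / √(w ⬝ᵥ w) ∈ A} = ν {z | z i ∈ A} := by
  have hpos : 0 < w ⬝ᵥ w := lt_of_le_of_ne (dotProduct_self_star_nonneg w)
    fun h => hw (dotProduct_self_eq_zero.1 h.symm)
  set ω := √(w ⬝ᵥ w) with hω
  have hω0 : 0 < ω := Real.sqrt_pos.2 hpos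
  have hωsq : w ⬝ᵥ w = ω * ω := (Real.mul_self_sqrt hpos.le).symm
  -- Reflection along this vector carries `w` to `ω eᵢ`, and so turns `w ⬝ z / ω` into a coordinate;
  -- if `v = 0` the two already agree.
  set v : Fin k → ℝ := w - ω • Pi.single i 1 with hv
  have hvz : ∀ z, v ⬝ᵥ z = w ⬝ᵥ z - ω * z i := fun z => by
    rw [hv, sub_dotProduct, smul_dotProduct, single_dotProduct, one_mul, smul_eq_mul]
  have hvi : v i = w i - ω := by simp [hv]
  have hvv : v ⬝ᵥ v = 2 * ω * (ω - w i) := by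
    rw [hvz, hvi, dotProduct_comm, hvz, hωsq]; ring
  by_cases hv0 : v ⬝ᵥ v = 0
  · have h1 : w = ω • Pi.single i 1 := sub_eq_zero.1 (dotProduct_self_eq_zero.1 hv0)
    have h2 : ∀ z : Fin k → ℝ, w ⬝ᵥ z / ω = z i := fun z => by
      have := hvz z
      rw [dotProduct_self_eq_zero.1 hv0, zero_dotProduct] at this
      rw [show w ⬝ᵥ z = ω * z i by linarith]
      field_simp
    simp only [h2]
  · have hT := h.reflect hv0
    have hm : MeasurableSet {z : Fin k → ℝ | z i ∈ A} := measurable_pi_apply i hA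
    rw [← hT.measure_preimage hm.nullMeasurableSet]
    congr 1
    ext z
    have h1 : ω - w i ≠ 0 := fun h0 => hv0 (by rw [hvv, h0, mul_zero])
    have h2 : SEst.reflect v z i = w ⬝ᵥ z / ω := by
      rw [reflect_apply, Pi.sub_apply, Pi.smul_apply, smul_eq_mul, hvv, hvz, hvi]
      field_simp
      ring
    simp [h2]

/-- The ε–δ form of absolute continuity, from integrability of the Radon–Nikodym density. -/
lemma exists_measure_lt_of_absolutelyContinuous {α : Type*} [MeasurableSpace α] {μ μ' : Measure α}
    [IsFiniteMeasure μ'] [SigmaFinite μ] (h : μ' ≪ μ) {δ : ENNReal} (hδ : δ ≠ 0) :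
    ∃ η > 0, ∀ A, MeasurableSet A → μ A < η → μ' A < δ := by
  have h1 : ∫⁻ x, μ'.rnDeriv μ x ∂μ ≠ ⊤ := Measure.lintegral_rnDeriv_lt_top μ' μ |>.ne
  obtain ⟨η, hη, h2⟩ := exists_pos_setLIntegral_lt_of_measure_lt h1 hδ
  refine ⟨η, hη, fun A hA hlt => ?_⟩
  have h3 := h2 A hlt
  rwa [← withDensity_apply _ hA, Measure.withDensity_rnDeriv_eq μ' μ h] at h3

/-- Thin slabs have small probability, uniformly in their direction and position. -/
lemma SphInv.exists_slab (h : SphInv ν) [IsFiniteMeasure ν] (hac : ν ≪ volume) (hk : 0 < k)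
    {δ : ENNReal} (hδ : δ ≠ 0) :
    ∃ ε : ℝ, 0 < ε ∧ ∀ w : Fin k → ℝ, w ≠ 0 → ∀ m : ℝ,
      ν {z | |w ⬝ᵥ z + m| ≤ ε * √(w ⬝ᵥ w)} ≤ δ := by
  set i : Fin k := ⟨0, hk⟩
  have hmi : Measurable fun z : Fin k → ℝ => z i := measurable_pi_apply i
  have hac' : ν.map (fun z => z i) ≪ volume :=
    (hac.map hmi).trans (Measure.quasiMeasurePreserving_eval (fun _ : Fin k => volume) i).2
  have hfin : IsFiniteMeasure (ν.map fun z => z i) := inferInstance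
  -- Short intervals have small mass under the law of one coordinate, wherever they lie;
  -- `SphInv.measure_linear` transfers this to all directions.
  obtain ⟨η, hη, hη'⟩ := exists_measure_lt_of_absolutelyContinuous hac' hδ
  obtain ⟨ε, hε, hεη⟩ : ∃ ε : ℝ, 0 < ε ∧ ENNReal.ofReal (2 * ε) < η := by
    have h1 : Tendsto (fun ε : ℝ => ENNReal.ofReal (2 * ε)) (𝓝[>] 0) (𝓝 0) := by
      have h2 : Tendsto (fun ε : ℝ => ENNReal.ofReal (2 * ε)) (𝓝 0) (𝓝 (ENNReal.ofReal (2 * 0))) :=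
        (ENNReal.continuous_ofReal.comp (continuous_const.mul continuous_id)).tendsto 0
      simp only [mul_zero, ENNReal.ofReal_zero] at h2
      exact h2.mono_left nhdsWithin_le_nhds
    obtain ⟨ε, h3, h4⟩ := ((h1.eventually_lt_const hη).and self_mem_nhdsWithin).exists
    exact ⟨ε, h4, h3⟩
  refine ⟨ε, hε, fun w hw m => ?_⟩
  have hω0 : 0 < √(w ⬝ᵥ w) := Real.sqrt_pos.2 (lt_of_le_of_ne (dotProduct_self_star_nonneg w)
    fun h => hw (dotProduct_self_eq_zero.1 h.symm))
  set ω := √(w ⬝ᵥ w)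
  have h1 : {z : Fin k → ℝ | |w ⬝ᵥ z + m| ≤ ε * ω} =
      {z | w ⬝ᵥ z / ω ∈ Metric.closedBall (-(m / ω)) ε} := by
    ext z
    simp only [Set.mem_ofPred_eq, Metric.mem_closedBall, Real.dist_eq, sub_neg_eq_add]
    rw [← add_div, abs_div, abs_of_pos hω0, div_le_iff₀ hω0]
  rw [h1, h.measure_linear hw i measurableSet_closedBall]
  have h2 := hη' _ (measurableSet_closedBall (x := -(m / ω)) (ε := ε))
    (by rw [Real.volume_closedBall]; exact hεη)
  rw [Measure.map_apply hmi measurableSet_closedBall] at h2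
  exact h2.le

variable {q : ℕ} {g : ℝ → ℝ} {P : Measure (Obs k q)} [IsProbabilityMeasure P]

/-- Under an elliptical model the residuals avoid thin slabs, uniformly in the parameters. -/
lemma exists_slab_resid (hk : 0 < k) (hg : Measurable g) {β₀ : Fin q → ℝ}
    {S : Matrix (Fin k) (Fin k) ℝ} (hS : S.PosDef) (hP : IsEllipticalGivenX g β₀ S P)
    {δ : ENNReal} (hδ : δ ≠ 0) :
    ∃ ε : ℝ, 0 < ε ∧ ∀ v : Fin k → ℝ, v ≠ 0 → ∀ β : Fin q → ℝ,
      P {s | |v ⬝ᵥ resid s β| ≤ ε * √(v ⬝ᵥ v)} ≤ δ := by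
  obtain ⟨N, hN, hN0⟩ := exists_transpose_mul_self hS.inv
  have hNu : IsUnit N.det := isUnit_iff_ne_zero.2 hN0
  have hrad := isProbabilityMeasure_radial hg hS hP
  have hXp : IsProbabilityMeasure (P.map Prod.snd) :=
    Measure.isProbabilityMeasure_map measurable_snd.aemeasurable
  obtain ⟨ε, hε, hsl⟩ := (sphInv_radial (k := k) hg).exists_slab radial_absolutelyContinuous hk hδ
  set B := asum S⁻¹ + 1 with hB
  have hB0 : 0 < B := by have := asum_nonneg S⁻¹; positivity
  refine ⟨ε / √B, by positivity, fun v hv β => ?_⟩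
  -- Then `v ⬝ r = w ⬝ (N r)`. For a fixed design, a change of `β` only shifts this linear form, so
  -- the slab bound is uniform in `β`.
  set w : Fin k → ℝ := (N⁻¹)ᵀ *ᵥ v with hw
  have hvw : Nᵀ *ᵥ w = v := by
    rw [hw, mulVec_mulVec, ← transpose_mul, Matrix.nonsing_inv_mul _ hNu, transpose_one, one_mulVec]
  have hw0 : w ≠ 0 := fun h => hv (by rw [← hvw, h, mulVec_zero])
  have hvv : v ⬝ᵥ v ≤ B * (w ⬝ᵥ w) := by
    have h1 := dotProduct_self_le_asum hS.inv v
    have h2 : v ⬝ᵥ (S⁻¹⁻¹ *ᵥ v) = w ⬝ᵥ w := by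
      rw [hN, Matrix.mul_inv_rev, ← mulVec_mulVec, ← Matrix.transpose_nonsing_inv, ← hw,
        dotProduct_mulVec, ← mulVec_transpose]
    rw [h2] at h1
    have h3 : 0 ≤ w ⬝ᵥ w := dotProduct_self_star_nonneg w
    rw [hB]; linarith
  have hmeas : Measurable fun s : Obs k q => ((N *ᵥ resid s β₀, s.2) : Obs k q) :=
    ((continuous_const.matrix_mulVec (continuous_resid β₀)).prodMk continuous_snd).measurable
  let A : Set (Obs k q) := {p | |w ⬝ᵥ p.1 + v ⬝ᵥ (p.2 *ᵥ (β₀ - β))| ≤ ε * √(w ⬝ᵥ w)}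
  have hA : MeasurableSet A := measurableSet_le
    (((continuous_const.dotProduct continuous_fst).add
      (continuous_const.dotProduct (continuous_design _))).abs.measurable) measurable_const
  calc P {s | |v ⬝ᵥ resid s β| ≤ ε / √B * √(v ⬝ᵥ v)}
      ≤ P ((fun s : Obs k q => ((N *ᵥ resid s β₀, s.2) : Obs k q)) ⁻¹' A) := by
        refine measure_mono fun s hs => ?_
        have h1 : v ⬝ᵥ resid s β = w ⬝ᵥ (N *ᵥ resid s β₀) + v ⬝ᵥ (s.2 *ᵥ (β₀ - β)) := by
          rw [← transpose_mulVec_dotProduct, hvw, ← dotProduct_add]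
          congr 1
          simp only [resid, mulVec_sub]
          abel
        simp only [Set.mem_ofPred_eq, Set.mem_preimage, A] at hs ⊢
        rw [← h1]
        refine hs.trans ?_
        rw [div_mul_eq_mul_div, div_le_iff₀ (by positivity), mul_assoc]
        refine mul_le_mul_of_nonneg_left ?_ hε.le
        rw [mul_comm, ← Real.sqrt_mul hB0.le]
        exact Real.sqrt_le_sqrt hvv
    _ = ((radial k g).prod (P.map Prod.snd)) A := by
        rw [← map_standardized hg hN hN0 hP, Measure.map_apply hmeas hA]
    _ = ∫⁻ X, (radial k g) ((fun z => (z, X)) ⁻¹' A) ∂(P.map Prod.snd) :=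
        Measure.prod_apply_symm hA
    _ ≤ ∫⁻ _, δ ∂(P.map Prod.snd) := lintegral_mono fun X => hsl w hw0 (v ⬝ᵥ (X *ᵥ (β₀ - β)))
    _ = δ := by simp

end slab

/-! ### Bounds for the covariance and regression parameters -/

section bounds

variable {k q l : ℕ} {L : Fin l → Matrix (Fin k) (Fin k) ℝ}

/-- A positive definite matrix with eigenvalues bounded away from zero is bounded in terms of its
determinant. -/
lemma asum_le_of_det_le {V : Matrix (Fin k) (Fin k) ℝ} (hV : V.PosDef) {lam C : ℝ} (hlam : 0 < lam)
    (h : ∀ v, lam * (v ⬝ᵥ v) ≤ v ⬝ᵥ (V *ᵥ v)) (hC : V.det ≤ C) :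
    asum V ≤ k * (k * (k * (C / lam ^ (k - 1)))) := by
  have hH := hV.isHermitian
  have h1 : ∀ i, lam ≤ hH.eigenvalues i := fun i => by
    set e := (hH.eigenvectorBasis i).ofLp with he
    have h2 : e ⬝ᵥ e = 1 := by
      have h3 := hH.eigenvectorBasis.orthonormal.1 i
      have h4 := EuclideanSpace.real_norm_sq_eq (hH.eigenvectorBasis i)
      rw [h3] at h4
      simp only [dotProduct, ← pow_two]
      rw [he, ← h4, one_pow]
    have h3 := h e
    rwa [hH.mulVec_eigenvectorBasis i, dotProduct_smul, ← he, h2, mul_one, smul_eq_mul,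
      mul_one] at h3
  -- Each eigenvalue is the determinant divided by the product of the `k - 1` others, all at least
  -- `lam`.
  have h2 : ∀ i, hH.eigenvalues i ≤ C / lam ^ (k - 1) := fun i => by
    rw [le_div_iff₀ (by positivity)]
    refine le_trans ?_ hC
    have h3 : V.det = ∏ i, hH.eigenvalues i := by simpa using hH.det_eq_prod_eigenvalues
    rw [h3, ← Finset.mul_prod_erase _ _ (Finset.mem_univ i)]
    refine mul_le_mul_of_nonneg_left ?_ (hlam.le.trans (h1 i))
    calc lam ^ (k - 1) = ∏ _j ∈ Finset.univ.erase i, lam := by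
          rw [Finset.prod_const, Finset.card_erase_of_mem (Finset.mem_univ i), Finset.card_univ,
            Fintype.card_fin]
      _ ≤ _ := Finset.prod_le_prod (fun _ _ => hlam.le) fun j _ => h1 j
  have h3 : V.trace ≤ k * (C / lam ^ (k - 1)) := by
    have h4 : V.trace = ∑ i, hH.eigenvalues i := by simpa using hH.trace_eq_sum_eigenvalues
    rw [h4]
    refine (Finset.sum_le_sum fun i _ => h2 i).trans (by simp)
  have h4 : ∀ i j, (Pi.single i 1 : Fin k → ℝ) ⬝ᵥ (V *ᵥ Pi.single j 1) = V i j := fun i j => by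
    simp
  have h5 : ∀ i, 0 ≤ V i i := fun i => by rw [← h4]; exact posDef_nonneg hV _
  have h6 : ∀ i, V i i ≤ V.trace := fun i =>
    Finset.single_le_sum (f := fun i => V i i) (fun i _ => h5 i) (Finset.mem_univ i)
  -- By Cauchy–Schwarz `V i j ^ 2 ≤ V i i * V j j`, and both factors are at most the trace.
  have h7 : ∀ i j, |V i j| ≤ k * (C / lam ^ (k - 1)) := fun i j => by
    refine le_trans ?_ h3
    have h8 := sq_dotProduct_le hV (Pi.single i 1) (V *ᵥ Pi.single j 1)
    rw [mulVec_mulVec, Matrix.nonsing_inv_mul _ (posDef_isUnit_det hV), one_mulVec,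
      dotProduct_comm (V *ᵥ _), h4, h4, h4] at h8
    refine abs_le_of_sq_le_sq (h8.trans ?_) ((h5 i).trans (h6 i))
    rw [pow_two]
    exact mul_le_mul (h6 i) (h6 j) (h5 j) ((h5 i).trans (h6 i))
  unfold asum
  calc ∑ i, ∑ j, |V i j| ≤ ∑ _i : Fin k, ∑ _j : Fin k, (k * (C / lam ^ (k - 1)) : ℝ) :=
        Finset.sum_le_sum fun i _ => Finset.sum_le_sum fun j _ => h7 i j
    _ = _ := by simp

lemma exists_norm_le_asum (hLrank : (vecMat L).rank = l) :
    ∃ K : ℝ, 0 ≤ K ∧ ∀ θ, ‖θ‖ ≤ K * asum (linCov L θ) := by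
  have hker : LinearMap.ker (vecMat L).mulVecLin = ⊥ := by
    rw [LinearMap.ker_eq_bot]
    intro a b hab
    exact linCov_injective hLrank (vec_inj.1 (by simpa only [mulVecLin_apply, vecMat_mulVec] using hab))
  obtain ⟨K, -, hK⟩ := (vecMat L).mulVecLin.exists_antilipschitzWith hker
  refine ⟨K, K.2, fun θ => ?_⟩
  have h1 := hK.le_mul_dist θ 0
  simp only [dist_zero_right, map_zero, mulVecLin_apply, vecMat_mulVec] at h1
  refine h1.trans (mul_le_mul_of_nonneg_left ?_ K.2)
  exact (pi_norm_le_iff_of_nonneg (asum_nonneg _)).2 fun p => abs_le_asum _ _ _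

variable {P : Measure (Obs k q)} [IsProbabilityMeasure P]

/-- With large probability, bounded residuals force bounded regression parameters. -/
lemma exists_regression_bound (hX : ∀ᵐ s ∂P, s.2.rank = q) (C : ℝ) {δ : ENNReal} (hδ : δ ≠ 0) :
    ∃ n : ℕ, 1 < δ + P {s | ∀ β, ‖resid s β‖ ≤ C → ‖β‖ ≤ n} := by
  let E : ℕ → Set (Obs k q) := fun n => {s | ∀ β, ‖resid s β‖ ≤ C → ‖β‖ ≤ n}
  -- The sets `E n` increase to a set of full measure, because a full-rank design is bounded below
  -- as a linear map.
  have hmono : Monotone E := fun m n hmn s hs β hβ => (hs β hβ).trans (by exact_mod_cast hmn)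
  have h1 : P (⋃ n, E n) = 1 := by
    refine (measure_congr (eventuallyEq_univ.2 ?_)).trans measure_univ
    filter_upwards [hX] with s hs
    have hker : LinearMap.ker s.2.mulVecLin = ⊥ := by
      have := LinearMap.finrank_range_add_finrank_ker s.2.mulVecLin
      rw [← Matrix.rank, hs, Module.finrank_fin_fun] at this
      exact Submodule.finrank_eq_zero.1 (by omega)
    obtain ⟨K, -, hK⟩ := s.2.mulVecLin.exists_antilipschitzWith hker
    obtain ⟨n, hn⟩ := exists_nat_ge (K * (‖s.1‖ + C))
    refine Set.mem_iUnion.2 ⟨n, fun β hβ => ?_⟩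
    have h1 := hK.le_mul_dist β 0
    simp only [dist_zero_right, map_zero, mulVecLin_apply] at h1
    refine h1.trans (le_trans (mul_le_mul_of_nonneg_left ?_ K.2) hn)
    calc ‖s.2 *ᵥ β‖ = ‖s.1 - resid s β‖ := by rw [resid, sub_sub_cancel]
      _ ≤ ‖s.1‖ + ‖resid s β‖ := norm_sub_le _ _
      _ ≤ ‖s.1‖ + C := by linarith
  rw [hmono.measure_iUnion] at h1
  have h2 : 1 < ⨆ n, (δ + P (E n)) := by
    rw [← ENNReal.add_iSup, h1]
    rw [add_comm]
    exact ENNReal.lt_add_right ENNReal.one_ne_top hδ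
  exact lt_iSup_iff.1 h2

end bounds

/-! ### Existence and convergence of S-solutions under contamination -/

section compactness

variable {k q l : ℕ} {L : Fin l → Matrix (Fin k) (Fin k) ℝ} {ρ g : ℝ → ℝ} {c₀ b₀ : ℝ}
  {P : Measure (Obs k q)} [IsProbabilityMeasure P]

/-- If the mean loss stays below its maximum, then small distances have positive probability. -/
lemma le_measure_tau_lt (hρ : IsRho ρ c₀) {b : ℝ} {ξ : Param q l}
    (hJ : ∫ s, ρ (√(tau L ξ s)) ∂P ≤ b) :
    ENNReal.ofReal (1 - b / ρ c₀) ≤ P {s | tau L ξ s < c₀ ^ 2} := by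
  have hpos : 0 < ρ c₀ := hρ.rho_pos
  -- Markov's inequality at the maximal level: `ρ(d) < ρ(c₀)` forces `d < c₀`.
  have h1 := mul_meas_ge_le_integral_of_nonneg (μ := P)
    (Eventually.of_forall fun s => hρ.nonneg (Real.sqrt_nonneg (tau L ξ s)))
    (integrable_rho_tau hρ ξ) (ρ c₀)
  have hA : MeasurableSet {s | ρ c₀ ≤ ρ (√(tau L ξ s))} :=
    measurableSet_le measurable_const (continuous_rho_tau L hρ ξ).measurable
  have h2 : P.real {s | ρ c₀ ≤ ρ (√(tau L ξ s))} ≤ b / ρ c₀ := by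
    rw [le_div_iff₀ hpos, mul_comm]; exact h1.trans hJ
  have h3 := probReal_compl_eq_one_sub hA (μ := P)
  refine ENNReal.ofReal_le_of_le_toReal ?_
  refine le_trans (b := P.real {s | ρ c₀ ≤ ρ (√(tau L ξ s))}ᶜ) (by rw [h3]; linarith) ?_
  refine measureReal_mono fun s hs => ?_
  simp only [Set.mem_compl_iff, Set.mem_ofPred_eq, not_le] at hs ⊢
  by_contra! hcon
  rw [hρ.const _ (Real.le_sqrt_of_sq_le hcon)] at hs
  exact lt_irrefl _ hs

/-- Parameters with small mean loss and small determinant are confined to a compact set of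
positive definite parameters. -/
lemma exists_isCompact_posDef (hk : 0 < k) (hρ : IsRho ρ c₀) (hL : ∀ j, (L j).IsSymm)
    (hLrank : (vecMat L).rank = l) (hX : ∀ᵐ s ∂P, s.2.rank = q) (hg : Measurable g)
    {β₀ : Fin q → ℝ} {S : Matrix (Fin k) (Fin k) ℝ} (hS : S.PosDef)
    (hP : IsEllipticalGivenX g β₀ S P) {b : ℝ} (hb : b < ρ c₀) (C : ℝ) :
    ∃ K : Set (Param q l), IsCompact K ∧ (∀ ξ ∈ K, (linCov L ξ.2).PosDef) ∧
      ∀ ξ : Param q l, (linCov L ξ.2).PosDef → ∫ s, ρ (√(tau L ξ s)) ∂P ≤ b →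
        (linCov L ξ.2).det ≤ C → ξ ∈ K := by
  have hpos : 0 < ρ c₀ := hρ.rho_pos
  have hδ : 0 < 1 - b / ρ c₀ := by
    rw [sub_pos, div_lt_one hpos]; exact hb
  set δ := 1 - b / ρ c₀ with hδdef
  have hδ2 : ENNReal.ofReal (δ / 2) ≠ 0 := by
    rw [Ne, ENNReal.ofReal_eq_zero, not_le]; positivity
  have hδ3 : ENNReal.ofReal δ ≠ 0 := by
    rw [Ne, ENNReal.ofReal_eq_zero, not_le]; exact hδ
  obtain ⟨ε, hε, hslab⟩ := exists_slab_resid hk hg hS hP hδ2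
  obtain ⟨κ, hκ0, hκ⟩ := exists_norm_le_asum (L := L) hLrank
  have hc₀ := hρ.pos
  -- Some observation has `|v ⬝ r| > ε ‖v‖` and `d < c₀`; Cauchy–Schwarz, `(v ⬝ r)² ≤ (v ⬝ V v) d²`,
  -- then gives this lower bound for the eigenvalues.
  set lam := ε ^ 2 / c₀ ^ 2 with hlam
  have hlam0 : 0 < lam := by positivity
  set B : ℝ := k * (k * (k * (C / lam ^ (k - 1)))) with hB
  obtain ⟨n, hn⟩ := exists_regression_bound hX (√(B * c₀ ^ 2)) hδ3
  have hmeas : ∀ ξ : Param q l, MeasurableSet {s | tau L ξ s < c₀ ^ 2} := fun ξ =>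
    measurableSet_lt (continuous_tau L ξ).measurable measurable_const
  let K : Set (Param q l) := {ξ | ‖ξ.1‖ ≤ n ∧ ‖ξ.2‖ ≤ κ * B ∧
    ∀ v, lam * (v ⬝ᵥ v) ≤ v ⬝ᵥ (linCov L ξ.2 *ᵥ v)}
  have hcov : Continuous fun ξ : Param q l => linCov L ξ.2 :=
    (continuous_linCov L).comp continuous_snd
  refine ⟨K, ?_, fun ξ hξ => ?_, fun ξ hpd hJ hdet => ?_⟩
  · refine Metric.isCompact_of_isClosed_isBounded ?_ ?_
    · have hKeq : K = {ξ | ‖ξ.1‖ ≤ n} ∩ ({ξ | ‖ξ.2‖ ≤ κ * B} ∩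
          ⋂ v, {ξ | lam * (v ⬝ᵥ v) ≤ v ⬝ᵥ (linCov L ξ.2 *ᵥ v)}) := by
        ext; simp [K]
      rw [hKeq]
      exact (isClosed_le continuous_fst.norm continuous_const).inter
        ((isClosed_le continuous_snd.norm continuous_const).inter
          (isClosed_iInter fun v => isClosed_le continuous_const
            (continuous_const.dotProduct (hcov.matrix_mulVec continuous_const))))
    · refine (Metric.isBounded_closedBall (x := (0 : Param q l)) (r := max n (κ * B))).subset
        fun ξ hξ => ?_
      rw [mem_closedBall_zero_iff, Prod.norm_def]
      exact max_le_max hξ.1 hξ.2.1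
  · refine Matrix.PosDef.of_dotProduct_mulVec_pos ?_ fun {x} hx => ?_
    · rw [Matrix.IsHermitian, conjTranspose_eq_transpose_of_trivial]
      exact linCov_isSymm hL _
    · rw [star_trivial]
      refine lt_of_lt_of_le (mul_pos hlam0 ?_) (hξ.2.2 x)
      exact lt_of_le_of_ne (dotProduct_self_star_nonneg x)
        fun h => hx (dotProduct_self_eq_zero.1 h.symm)
  · have hprob := le_measure_tau_lt hρ hJ
    have hlow : ∀ v, lam * (v ⬝ᵥ v) ≤ v ⬝ᵥ (linCov L ξ.2 *ᵥ v) := fun v => by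
      rcases eq_or_ne v 0 with rfl | hv
      · simp
      have h1 := hslab v hv ξ.1
      have hm2 : MeasurableSet {s : Obs k q | |v ⬝ᵥ resid s ξ.1| ≤ ε * √(v ⬝ᵥ v)} :=
        measurableSet_le ((continuous_const.dotProduct (continuous_resid _)).abs.measurable)
          measurable_const
      -- The event `d < c₀` has probability at least `δ` and the slab at most `δ / 2`.
      have h2 : ∃ s, tau L ξ s < c₀ ^ 2 ∧ ε * √(v ⬝ᵥ v) < |v ⬝ᵥ resid s ξ.1| := by
        by_contra! hcon
        have h3 : P {s | tau L ξ s < c₀ ^ 2} ≤ ENNReal.ofReal (δ / 2) :=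
          (measure_mono fun s hs => hcon s hs).trans h1
        have h4 := hprob.trans h3
        rw [ENNReal.ofReal_le_ofReal_iff (by positivity)] at h4
        linarith
      obtain ⟨s, hs1, hs2⟩ := h2
      have hvv : 0 ≤ v ⬝ᵥ v := dotProduct_self_star_nonneg v
      have h3 : ε ^ 2 * (v ⬝ᵥ v) ≤ (v ⬝ᵥ resid s ξ.1) ^ 2 := by
        rw [← sq_abs (v ⬝ᵥ resid s ξ.1), ← Real.sq_sqrt hvv, ← mul_pow]
        exact pow_le_pow_left₀ (by positivity) hs2.le 2
      have h4 := sq_dotProduct_le hpd v (resid s ξ.1)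
      have h5 : v ⬝ᵥ (linCov L ξ.2 *ᵥ v) * (resid s ξ.1 ⬝ᵥ ((linCov L ξ.2)⁻¹ *ᵥ resid s ξ.1)) ≤
          v ⬝ᵥ (linCov L ξ.2 *ᵥ v) * c₀ ^ 2 :=
        mul_le_mul_of_nonneg_left hs1.le (posDef_nonneg hpd v)
      rw [hlam, div_mul_eq_mul_div, div_le_iff₀ (by positivity)]
      linarith
    have hasum := asum_le_of_det_le hpd hlam0 hlow hdet
    refine ⟨?_, (hκ ξ.2).trans (mul_le_mul_of_nonneg_left hasum hκ0), hlow⟩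
    -- The probabilities of the two events sum to more than one, so they meet. At a common point the
    -- residual is bounded, hence so is `β`.
    have h1 : ({s | ∀ β, ‖resid s β‖ ≤ √(B * c₀ ^ 2) → ‖β‖ ≤ n} ∩
        {s | tau L ξ s < c₀ ^ 2}).Nonempty := by
      refine nonempty_inter_of_measure_lt_add P (hmeas ξ) (Set.subset_univ _)
        (Set.subset_univ _) ?_
      rw [measure_univ, add_comm]
      exact hn.trans_le (add_le_add_left hprob _)
    obtain ⟨s, hs1, hs2⟩ := h1
    refine hs1 ξ.1 (Real.le_sqrt_of_sq_le ((sq_norm_le_asum hpd _).trans ?_))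
    exact mul_le_mul hasum (le_of_lt hs2) (tau_nonneg hpd s) ((asum_nonneg _).trans hasum)

lemma continuousAt_integral_rho (hρ : IsRho ρ c₀) (hL : ∀ j, (L j).IsSymm)
    {Q : Measure (Obs k q)} [IsFiniteMeasure Q]
    (hQ : Integrable (fun s : Obs k q => dom s) Q) {ξ : Param q l} (h : (linCov L ξ.2).PosDef) :
    ContinuousAt (fun ξ => ∫ s, ρ (√(tau L ξ s)) ∂Q) ξ :=
  (hasFD_integral_rho hρ hL hQ h).continuousAt

/-- Inflating the covariance matrix at an S-solution makes the constraint inactive. -/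
lemma eventually_integral_rho_lt (hk : 0 < k) (hρ : IsRho ρ c₀) (hL : ∀ j, (L j).IsSymm)
    (hQ : Integrable (fun s : Obs k q => dom s) P) (hg : Measurable g)
    (hg0 : ∀ t, 0 ≤ t → 0 ≤ g t) (hρ'' : 0 < sphE k g (deriv (deriv ρ))) {ξ : Param q l}
    (hξ : IsSSolution ρ b₀ L P ξ) (hP : IsEllipticalGivenX g ξ.1 (linCov L ξ.2) P) :
    ∀ᶠ t in 𝓝[>] (0 : ℝ), ∫ s, ρ (√(tau L (ξ + t • ((0, ξ.2) : Param q l)) s)) ∂P < b₀ := by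
  have hpd : (linCov L ξ.2).PosDef := hξ.1.1
  obtain ⟨N, hN, hN0⟩ := exists_transpose_mul_self hpd.inv
  have hrad := isProbabilityMeasure_radial hg hpd hP
  have h1 := (hasFD_integral_rho hρ hL hQ hpd).hasDerivAt_line (0, ξ.2)
  -- By `dtau_scale` the derivative of the mean loss in the scale direction is `-E[u(d) d²] / 2`.
  have h2 : ∫ s, weightExt ρ (√(tau L ξ s)) / 2 * dtau L ξ s (0, ξ.2) ∂P =
      -(scaleMoment k g ρ / 2) := by
    have h3 := integral_comp_standardized hg hpd hN hN0 hP
      (F := fun x => weightExt ρ (√x) * x)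
      ((hρ.continuous_weightExt.comp Real.continuous_sqrt).mul continuous_id).measurable
    rw [scaleMoment, ← h3, ← integral_div, ← integral_neg]
    refine integral_congr_ae (Eventually.of_forall fun s => ?_)
    have hN' : prec L ξ = Nᵀ * N := hN
    have h4 : tau L ξ s = (N *ᵥ resid s ξ.1) ⬝ᵥ (N *ᵥ resid s ξ.1) := by
      rw [tau, sres, hN', ← mulVec_mulVec, dotProduct_comm (resid s ξ.1),
        transpose_mulVec_dotProduct]
    simp only [dtau_scale hpd, h4]
    ring
  rw [h2] at h1
  have h5 := eventually_lt_of_hasDerivAt_neg h1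
    (neg_lt_zero.2 (half_pos (scaleMoment_pos hk hρ hg hg0 hρ'')))
  rw [zero_smul, add_zero, hξ.integral_eq hk hρ hL hQ] at h5
  exact h5

lemma integral_rho_contam (hρ : IsRho ρ c₀) {s₀ : Obs k q} {h : ℝ} (h0 : 0 ≤ h) (h1 : h ≤ 1)
    (ξ : Param q l) :
    ∫ s, ρ (√(tau L ξ s)) ∂(contam P s₀ h) =
      (1 - h) * ∫ s, ρ (√(tau L ξ s)) ∂P + h * ρ (√(tau L ξ s₀)) :=
  integral_contam (integrable_rho_tau hρ ξ) h0 h1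

/-- Feasible parameters at a contaminated distribution are almost feasible at the original one. -/
lemma integral_rho_le_of_contam (hρ : IsRho ρ c₀) {s₀ : Obs k q} {h : ℝ} (h0 : 0 ≤ h)
    (h1 : h < 1) {ξ : Param q l} (hξ : IsFeasible ρ b₀ L (contam P s₀ h) ξ) :
    ∫ s, ρ (√(tau L ξ s)) ∂P ≤ b₀ / (1 - h) := by
  have h2 : ∫ s, ρ (√(tau L ξ s)) ∂(contam P s₀ h) ≤ b₀ := hξ.2
  rw [integral_rho_contam hρ h0 h1.le] at h2
  have h3 := mul_nonneg h0 (hρ.nonneg (Real.sqrt_nonneg (tau L ξ s₀)))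
  rw [le_div_iff₀ (by linarith)]
  linarith

/-- A strictly feasible parameter stays feasible under small contamination. -/
lemma eventually_isFeasible_contam (hρ : IsRho ρ c₀) (s₀ : Obs k q) {ξ : Param q l}
    (hpd : (linCov L ξ.2).PosDef) (hJ : ∫ s, ρ (√(tau L ξ s)) ∂P < b₀) :
    ∀ᶠ h in 𝓝[>] (0 : ℝ), IsFeasible ρ b₀ L (contam P s₀ h) ξ := by
  have h1 : Tendsto (fun h : ℝ => (1 - h) * ∫ s, ρ (√(tau L ξ s)) ∂P + h * ρ (√(tau L ξ s₀)))
      (𝓝[>] 0) (𝓝 ((1 - 0) * ∫ s, ρ (√(tau L ξ s)) ∂P + 0 * ρ (√(tau L ξ s₀)))) := by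
    refine Tendsto.mono_left (Continuous.tendsto ?_ 0) nhdsWithin_le_nhds
    fun_prop
  rw [sub_zero, one_mul, zero_mul, add_zero] at h1
  filter_upwards [h1.eventually_lt_const hJ, self_mem_nhdsWithin,
    mem_nhdsWithin_of_mem_nhds (Iio_mem_nhds (zero_lt_one' ℝ))] with h h2 h3 h4
  refine ⟨hpd, le_of_lt ?_⟩
  have h5 := integral_rho_contam (P := P) (L := L) hρ (s₀ := s₀) (le_of_lt h3) (le_of_lt h4) ξ
  exact h5.trans_lt h2

/-- A bound that holds eventually up to every `ε` passes to cluster points by continuity at the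
cluster point alone. -/
lemma le_of_mapClusterPt {X Y : Type*} [TopologicalSpace X] {f : Y → X} {m : Filter Y} {y : X}
    {φ : X → ℝ} {b : ℝ} (hφ : ContinuousAt φ y) (hy : MapClusterPt y m f)
    (h : ∀ ε > 0, ∀ᶠ x in m, φ (f x) ≤ b + ε) : φ y ≤ b := by
  refine le_of_forall_pos_le_add fun ε hε => ?_
  by_contra! hcon
  have h1 : ∃ᶠ x in m, b + ε < φ (f x) :=
    mapClusterPt_iff_frequently.1 hy {x | b + ε < φ x} (hφ.eventually_const_lt hcon)
  obtain ⟨x, h2, h3⟩ := (h1.and_eventually (h ε hε)).exists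
  linarith

lemma inflate_snd (ξ : Param q l) (t : ℝ) :
    (ξ + t • ((0, ξ.2) : Param q l)).2 = (1 + t) • ξ.2 := by
  simp [add_smul]

/-- Near a distribution at which the S-solution is unique, S-solutions exist and are close. -/
theorem exists_and_tendsto_of_unique (hk : 0 < k) (hρ : IsRho ρ c₀) (hL : ∀ j, (L j).IsSymm)
    (hLrank : (vecMat L).rank = l) (hQ : Integrable (fun s : Obs k q => dom s) P)
    (hX : ∀ᵐ s ∂P, s.2.rank = q) (hb₀ : b₀ < ρ c₀) {ξ₀ : Param q l}
    (hsol : IsSSolution ρ b₀ L P ξ₀) (hg : Measurable g) (hg0 : ∀ t, 0 ≤ t → 0 ≤ g t)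
    (hP : IsEllipticalGivenX g ξ₀.1 (linCov L ξ₀.2) P)
    (hρ'' : 0 < sphE k g (deriv (deriv ρ))) (s₀ : Obs k q)
    (huniq : ∀ ξ : Param q l, IsSSolution ρ b₀ L P ξ → ξ = ξ₀) :
    (∀ᶠ h in 𝓝[>] (0 : ℝ), ∃ ξ : Param q l, IsSSolution ρ b₀ L (contam P s₀ h) ξ) ∧
      ∀ ξ : ℝ → Param q l, (∀ᶠ h in 𝓝[>] (0 : ℝ), IsSSolution ρ b₀ L (contam P s₀ h) (ξ h)) →
        Tendsto ξ (𝓝[>] 0) (𝓝 ξ₀) := by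
  have hpd : (linCov L ξ₀.2).PosDef := hsol.1.1
  have hlt := eventually_integral_rho_lt hk hρ hL hQ hg hg0 hρ'' hsol hP
  have hpdt : ∀ t : ℝ, 0 < t → (linCov L (ξ₀ + t • ((0, ξ₀.2) : Param q l)).2).PosDef :=
    fun t ht => by rw [inflate_snd]; exact linCov_posDef_smul hpd (by linarith)
  have hdetc : Continuous fun ξ : Param q l => (linCov L ξ.2).det :=
    ((continuous_linCov L).comp continuous_snd).matrix_det
  -- The inflated point `ξ₁` is strictly feasible at `P`, hence feasible for all small
  -- contaminations; its determinant caps the search for minimizers.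
  obtain ⟨t₁, ht₁, ht₁0⟩ := (hlt.and self_mem_nhdsWithin).exists
  set ξ₁ := ξ₀ + t₁ • ((0, ξ₀.2) : Param q l) with hξ₁
  have hfeas₁ := eventually_isFeasible_contam hρ s₀ (hpdt t₁ ht₁0) ht₁
  -- Feasibility at the contaminated measure only bounds the mean loss under `P` by `b₀ / (1 - h)`,
  -- so a level strictly between `b₀` and `ρ c₀` is used.
  obtain ⟨K, hK, hKpd, hKmem⟩ := exists_isCompact_posDef hk hρ hL hLrank hX hg hpd hP
    (b := (b₀ + ρ c₀) / 2) (by linarith) (linCov L ξ₁.2).det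
  have hbh : ∀ b' > b₀, ∀ᶠ h in 𝓝[>] (0 : ℝ), b₀ / (1 - h) ≤ b' := fun b' hb' => by
    have h1 : Tendsto (fun h : ℝ => b₀ / (1 - h)) (𝓝[>] 0) (𝓝 (b₀ / (1 - 0))) := by
      refine Tendsto.mono_left ?_ nhdsWithin_le_nhds
      exact (continuousAt_const.div (continuousAt_const.sub continuousAt_id) (by simp)).tendsto
    rw [sub_zero, div_one] at h1
    exact (h1.eventually_lt_const hb').mono fun _ h => h.le
  have hsmall : ∀ᶠ h in 𝓝[>] (0 : ℝ), 0 < h ∧ h < 1 := by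
    filter_upwards [self_mem_nhdsWithin,
      mem_nhdsWithin_of_mem_nhds (Iio_mem_nhds (zero_lt_one' ℝ))] with h h1 h2 using ⟨h1, h2⟩
  have hinK : ∀ᶠ h in 𝓝[>] (0 : ℝ), ∀ ξ, IsFeasible ρ b₀ L (contam P s₀ h) ξ →
      (linCov L ξ.2).det ≤ (linCov L ξ₁.2).det → ξ ∈ K := by
    filter_upwards [hsmall, hbh ((b₀ + ρ c₀) / 2) (by linarith)] with h h1 h2 ξ hξ hdet
    exact hKmem ξ hξ.1 ((integral_rho_le_of_contam hρ h1.1.le h1.2 hξ).trans h2) hdet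
  refine ⟨?_, fun ξ hξ => ?_⟩
  · filter_upwards [hsmall, hinK, hfeas₁] with h h1 h2 h3
    have hp := isProbabilityMeasure_contam (P := P) (s₀ := s₀) h1.1.le h1.2.le
    have hcont : ContinuousOn (fun ξ : Param q l => ∫ s, ρ (√(tau L ξ s)) ∂(contam P s₀ h)) K :=
      fun ξ hξ => (continuousAt_integral_rho hρ hL (integrable_contam hQ)
        (hKpd ξ hξ)).continuousWithinAt
    have hKh : IsCompact (K ∩ (fun ξ : Param q l => ∫ s, ρ (√(tau L ξ s)) ∂(contam P s₀ h)) ⁻¹'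
        Set.Iic b₀) :=
      hK.of_isClosed_subset (hcont.preimage_isClosed_of_isClosed hK.isClosed isClosed_Iic)
        Set.inter_subset_left
    obtain ⟨ξ, hξK, hmin⟩ := hKh.exists_isMinOn ⟨ξ₁, h2 ξ₁ h3 le_rfl, h3.2⟩ hdetc.continuousOn
    refine ⟨ξ, ⟨hKpd ξ hξK.1, hξK.2⟩, fun ξ' hξ' => ?_⟩
    by_cases hd : (linCov L ξ'.2).det ≤ (linCov L ξ₁.2).det
    · exact hmin ⟨h2 ξ' hξ' hd, hξ'.2⟩
    · exact (hmin ⟨h2 ξ₁ h3 le_rfl, h3.2⟩ : (linCov L ξ.2).det ≤ (linCov L ξ₁.2).det).trans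
        (not_le.1 hd).le
  -- Inside the compact set it suffices that every cluster point is an S-solution at `P`.
  · refine hK.tendsto_nhds_of_unique_mapClusterPt (f := ξ) ?_ fun y hyK hy => huniq y ?_
    · filter_upwards [hξ, hinK, hfeas₁] with h h1 h2 h3 using h2 _ h1.1 (h1.2 ξ₁ h3)
    · refine ⟨⟨hKpd y hyK, ?_⟩, fun ξ' hξ' => le_trans ?_ (hsol.2 ξ' hξ')⟩
      · refine le_of_mapClusterPt (φ := fun ξ : Param q l => ∫ s, ρ (√(tau L ξ s)) ∂P)
          (continuousAt_integral_rho hρ hL hQ (hKpd y hyK)) hy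
          fun ε hε => ?_
        filter_upwards [hsmall, hξ, hbh (b₀ + ε) (by linarith)] with h h1 h2 h3
        exact (integral_rho_le_of_contam hρ h1.1.le h1.2 h2.1).trans h3
      -- The comparison is with inflations of `ξ₀`: they are feasible under small contamination, and
      -- their determinants tend to that of `ξ₀`.
      · refine le_of_mapClusterPt (φ := fun ξ : Param q l => (linCov L ξ.2).det) hdetc.continuousAt hy fun ε hε => ?_
        have h1 : Tendsto (fun t : ℝ => (linCov L (ξ₀ + t • ((0, ξ₀.2) : Param q l)).2).det)
            (𝓝[>] 0) (𝓝 (linCov L ξ₀.2).det) := by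
          have h2 : Continuous fun t : ℝ =>
              (linCov L (ξ₀ + t • ((0, ξ₀.2) : Param q l)).2).det :=
            hdetc.comp (continuous_const.add (continuous_id.smul continuous_const))
          have h3 := h2.tendsto 0
          rw [zero_smul, add_zero] at h3
          exact h3.mono_left nhdsWithin_le_nhds
        obtain ⟨t, ⟨ht1, ht2⟩, ht3⟩ := ((hlt.and self_mem_nhdsWithin).and
          (h1.eventually_lt_const (lt_add_of_pos_right _ hε))).exists
        filter_upwards [hξ, eventually_isFeasible_contam hρ s₀ (hpdt t ht2) ht1] with h h4 h5
        exact (h4.2 _ h5).trans ht3.le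

end compactness

end SEst

end

theorem mainTheorem3 {k q l : ℕ} (hk : 0 < k)
    -- the loss function and the constant of the constraint
    (ρ : ℝ → ℝ) (c₀ b₀ : ℝ) (hρ : SEst.IsRho ρ c₀) (hb₀ : 0 < b₀) (hb₀' : b₀ < ρ c₀)
    -- the linear covariance structure
    (L : Fin l → Matrix (Fin k) (Fin k) ℝ) (hLsymm : ∀ j, (L j).IsSymm)
    (hLrank : (SEst.vecMat L).rank = l)
    -- the distribution of `(y, X)`
    (P : Measure (SEst.Obs k q)) [IsProbabilityMeasure P]
    (hXint : Integrable (fun s : SEst.Obs k q => ∑ i, ∑ j, (s.2 i j) ^ 2) P)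
    (hXrank : ∀ᵐ s ∂P, s.2.rank = q)
    -- the S-functional `T = (β(·), θ(·))`
    (T : Measure (SEst.Obs k q) → SEst.Param q l)
    (hTP : SEst.IsSSolution ρ b₀ L P (T P))
    -- `y | X` is elliptical with parameters `X β(P)` and `Σ = V(θ(P))`
    (β : Fin q → ℝ) (θ : Fin l → ℝ) (S : Matrix (Fin k) (Fin k) ℝ)
    (hβ : β = (T P).1) (hθ : θ = (T P).2) (hS : S = SEst.linCov L θ)
    (g : ℝ → ℝ) (hg : Measurable g) (hg0 : ∀ t, 0 ≤ t → 0 ≤ g t)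
    (hP : SEst.IsEllipticalGivenX g β S P)
    (hρ'' : 0 < SEst.sphE k g (deriv (deriv ρ)))
    (hγ₁ : 0 < SEst.gammaOne k g ρ)
    -- the point of contamination
    (s₀ : SEst.Obs k q) (r₀ : Fin k → ℝ) (d₀ : ℝ)
    (hr₀ : r₀ = SEst.resid s₀ β) (hd₀ : d₀ = SEst.mahal S β s₀) :
    -- the inverses and quotients below are genuine
    (0 < SEst.alphaC k g ρ ∧
      0 < SEst.gammaOne k g ρ - (k : ℝ) * SEst.gammaTwo k g ρ ∧
      IsUnit (SEst.designInfo S P).det ∧ IsUnit (SEst.covInfo L S).det) ∧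
    -- the influence functions of `β` and `θ`
    ((∀ᶠ h in 𝓝[>] (0 : ℝ),
        SEst.IsSSolution ρ b₀ L (SEst.contam P s₀ h) (T (SEst.contam P s₀ h))) →
      Tendsto (fun h : ℝ => T (SEst.contam P s₀ h)) (𝓝[>] 0) (𝓝 (T P)) →
        SEst.HasInfluence (fun Q => (T Q).1) P s₀
          ((SEst.weight ρ d₀ / SEst.alphaC k g ρ) •
            ((SEst.designInfo S P)⁻¹ *ᵥ (s₀.2ᵀ *ᵥ (S⁻¹ *ᵥ r₀)))) ∧
        SEst.HasInfluence (fun Q => (T Q).2) P s₀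
          (((k : ℝ) * SEst.weight ρ d₀ / SEst.gammaOne k g ρ) •
              ((SEst.covInfo L S)⁻¹ *ᵥ
                ((SEst.vecMat L)ᵀ *ᵥ (S⁻¹ * Matrix.vecMulVec r₀ r₀ * S⁻¹).vec)) +
            (-(SEst.weight ρ d₀ * d₀ ^ 2 / SEst.gammaOne k g ρ) +
              (ρ d₀ - b₀) /
                (SEst.gammaOne k g ρ - (k : ℝ) * SEst.gammaTwo k g ρ)) • θ)) ∧
    -- solutions near `P` exist and converge whenever the solution at `P` is unique
    ((∀ ξ : SEst.Param q l, SEst.IsSSolution ρ b₀ L P ξ → ξ = T P) →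
      (∀ᶠ h in 𝓝[>] (0 : ℝ), ∃ ξ : SEst.Param q l,
        SEst.IsSSolution ρ b₀ L (SEst.contam P s₀ h) ξ) ∧
      ((∀ᶠ h in 𝓝[>] (0 : ℝ),
          SEst.IsSSolution ρ b₀ L (SEst.contam P s₀ h) (T (SEst.contam P s₀ h))) →
        Tendsto (fun h : ℝ => T (SEst.contam P s₀ h)) (𝓝[>] 0) (𝓝 (T P)))) := by
  have hQ := SEst.integrable_dom hXint
  have hpd : (SEst.linCov L (T P).2).PosDef := hTP.1.1
  subst hS hr₀ hd₀ hβ hθ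
  have hrad := SEst.isProbabilityMeasure_radial hg hpd hP
  refine ⟨⟨SEst.alphaC_pos hk hρ hg hg0 hρ'', ?_, SEst.isUnit_det_designInfo hQ hXrank hpd,
    SEst.isUnit_det_covInfo hLsymm hLrank hpd⟩, fun hsol hlim => ?_, fun huniq => ?_⟩
  · rw [SEst.gammaOne_sub_gammaTwo hk hρ hg hg0]
    exact half_pos (SEst.scaleMoment_pos hk hρ hg hg0 hρ'')
  · have h := SEst.hasInfluence hk hρ hLsymm hLrank hQ hXrank T hTP hg hg0 hP hρ'' hγ₁ s₀ hsol hlim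
    rw [SEst.mahal_eq_sqrt_tau, Real.sq_sqrt (SEst.tau_nonneg hpd s₀)]
    exact ⟨(continuous_fst.tendsto _).comp h, (continuous_snd.tendsto _).comp h⟩
  · obtain ⟨h1, h2⟩ := SEst.exists_and_tendsto_of_unique hk hρ hLsymm hLrank hQ hXrank hb₀' hTP hg
      hg0 hP hρ'' s₀ huniq
    exact ⟨h1, fun hsol => h2 _ hsol⟩
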